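/- For $N\ge 2$ let $\Omega_N=\{x\in\mathbb R^{N-1}: 0\le x_1\le\dots\le x_{N-1}\le N\}$, with $x_0=0$ and $x_N=N$. For $\alpha>0$ let $\rho_\alpha(u)=\frac{\Gamma(2\alpha)}{\Gamma(\alpha)^2}[u(1-u)]^{\alpha-1}$ on $[0,1]$, and let $\pi_{N,\alpha}$ be the probability measure on $\Omega_N$ with density $\frac{\Gamma(N\alpha)}{\Gamma(\alpha)^N N^{N\alpha-1}}\prod_{i=1}^N(x_i-x_{i-1})^{\alpha-1}$ with respect to Lebesgue measure. Consider the continuous-time Markov chain on $\Omega_N$ with semigroup $P_t=e^{t\mathcal L_{N,\alpha}}$ and generator $$(\mathcal L_{N,\alpha}f)(x)=\sum_{i=1}^{N-1}\int_0^1\big(f(x^{(i,u)})-f(x)\big)\rho_\alpha(u)\,du,$$ where $x^{(i,u)}$ is obtained from $x$ by replacing $x_i$ by $u x_{i-1}+(1-u)x_{i+1}$. Let $\mathrm{gap}_N$ be its spectral gap, that is, the smallest eigenvalue of $-\mathcal L_{N,\alpha}$ in $L^2(\Omega_N,\pi_{N,\alpha})$ having a nonconstant eigenfunction. Let $\wedge=(N,\dots,N)\in\Omega_N$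 be the maximal configuration. Fix $\alpha\ge 1$, an integer $K\ge 1$ and $\delta>0$, and set $t_\delta=(1+\delta)\frac{\log N}{2\,\mathrm{gap}_N}$. Let $\mu_t=\delta_\wedge P_t$ be the law at time $t$ of the chain started from $\wedge$. For a probability measure $\mu$ on $\Omega_N$, let $\bar\mu$ be the law under $\mu$ of the positions $(x_{u_1},\dots,x_{u_{K-1}})$ of the special particles, where $u_i=\lfloor iN/K\rfloor$. Then $$\lim_{N\to\infty}\big\|\bar\mu_{t_\delta}-\bar\pi_{N,\alpha}\big\|_{TV}=0,$$ where $\|\mu-\nu\|_{TV}=\sup_B(\mu(B)-\nu(B))$ is the supremum over Borel sets $B$. -/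

import Mathlib

open MeasureTheory ProbabilityTheory Filter Topology

namespace BetaResampling

/-- The position `x_k` of the particle with label `k`, for a vector `x = (x_1, …, x_{N-1})`, with the
boundary conventions `x_0 = 0` and `x_N = N`. The coordinate `i : Fin (N - 1)` carries the
label `i + 1`. -/
noncomputable def pos (N : ℕ) (x : Fin (N - 1) → ℝ) (k : ℕ) : ℝ :=
  if k = 0 then 0 else if h : k - 1 < N - 1 then x ⟨k - 1, h⟩ else (N : ℝ)

/-- The state space `Ω_N = {0 ≤ x_1 ≤ ⋯ ≤ x_{N-1} ≤ N}`. -/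
def stateSpace (N : ℕ) : Set (Fin (N - 1) → ℝ) :=
  {x | ∀ k < N, pos N x k ≤ pos N x (k + 1)}

/-- The equilibrium measure `π_{N,α}`: the density
`Γ(Nα) / (Γ(α)^N N^{Nα-1}) ∏_{k=1}^N (x_k - x_{k-1})^{α-1}` on `Ω_N` with respect to Lebesgue measure. -/
noncomputable def equilibrium (N : ℕ) (α : ℝ) : Measure (Fin (N - 1) → ℝ) :=
  (volume.restrict (stateSpace N)).withDensity fun x =>
    ENNReal.ofReal (Real.Gamma (N * α) / (Real.Gamma α ^ N * (N : ℝ) ^ (N * α - 1)) *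
      ∏ k ∈ Finset.range N, (pos N x (k + 1) - pos N x k) ^ (α - 1))

/-- The update `x ↦ x^{(j,u)}` at the particle with label `j = i + 1`:
its position is replaced by `u x_{j-1} + (1-u) x_{j+1}`. -/
noncomputable def resample (N : ℕ) (i : Fin (N - 1)) (u : ℝ) (x : Fin (N - 1) → ℝ) :
    Fin (N - 1) → ℝ :=
  Function.update x i (u * pos N x i + (1 - u) * pos N x (i + 2))

/-- The generator `(L f)(x) = ∑_j ∫ (f(x^{(j,u)}) - f(x)) ρ_α(u) du`, with `ρ_α` the density of the
symmetric Beta law of parameter `α` on `[0,1]`. -/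
noncomputable def generator (N : ℕ) (α : ℝ) (f : (Fin (N - 1) → ℝ) → ℝ)
    (x : Fin (N - 1) → ℝ) : ℝ :=
  ∑ i : Fin (N - 1), ∫ u, (f (resample N i u x) - f x) ∂(betaMeasure α α)

/-- `lam` is a nontrivial eigenvalue of `-L` in `L²(π_{N,α})`: it has an eigenfunction that is not
almost everywhere equal to a constant. -/
def IsNontrivialEigenvalue (N : ℕ) (α lam : ℝ) : Prop :=
  ∃ f : (Fin (N - 1) → ℝ) → ℝ,
    MemLp f 2 (equilibrium N α) ∧
    (¬ ∃ c : ℝ, f =ᵐ[equilibrium N α] fun _ => c) ∧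
    (fun x => -generator N α f x) =ᵐ[equilibrium N α] fun x => lam * f x

/-- The spectral gap: the smallest nontrivial eigenvalue of `-L`. -/
noncomputable def spectralGap (N : ℕ) (α : ℝ) : ℝ :=
  sInf {lam : ℝ | IsNontrivialEigenvalue N α lam}

/-- The measure `μ Q_i`: the law of `X^{(i,U)}`, where `X` has law `μ` and `U` is an independent
symmetric Beta variable of parameter `α`. -/
noncomputable def updateLaw (N : ℕ) (α : ℝ) (i : Fin (N - 1)) (μ : Measure (Fin (N - 1) → ℝ)) :
    Measure (Fin (N - 1) → ℝ) :=
  (μ.prod (betaMeasure α α)).map fun p => resample N i p.2 p.1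

/-- The measure `∑_i μ Q_i`. -/
noncomputable def updateSum (N : ℕ) (α : ℝ) (μ : Measure (Fin (N - 1) → ℝ)) :
    Measure (Fin (N - 1) → ℝ) :=
  ∑ i : Fin (N - 1), updateLaw N α i μ

/-- The law `μ P_t` at time `t ≥ 0` of the continuous time Markov chain with initial law `μ` in which
every particle is resampled at rate one. Since `L = ∑_i Q_i - (N-1)` is bounded,
`P_t = exp (t L) = ∑_n e^{-(N-1)t} (t^n / n!) (∑_i Q_i)^n`; equivalently, the total number of updates
up to time `t` is Poisson of mean `(N-1)t`, and each update is at a uniformly chosen particle. -/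
noncomputable def lawAt (N : ℕ) (α t : ℝ) (μ : Measure (Fin (N - 1) → ℝ)) :
    Measure (Fin (N - 1) → ℝ) :=
  Measure.sum fun n : ℕ =>
    ENNReal.ofReal (Real.exp (-(((N - 1 : ℕ) : ℝ) * t)) * t ^ n / (n.factorial : ℝ)) •
      (updateSum N α)^[n] μ

/-- The maximal configuration `∧ = (N, …, N)`. -/
def maxConfig (N : ℕ) : Fin (N - 1) → ℝ := fun _ => (N : ℝ)

/-- The positions `y_i = x_{u_i}`, `u_i = ⌊iN/K⌋`, `i = 1, …, K-1`, of the special particles. -/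
noncomputable def specialPositions (N K : ℕ) (x : Fin (N - 1) → ℝ) : Fin (K - 1) → ℝ :=
  fun i => pos N x (((i : ℕ) + 1) * N / K)

/-- The marginal on the special particle positions. -/
noncomputable def specialMarginal (N K : ℕ) (μ : Measure (Fin (N - 1) → ℝ)) :
    Measure (Fin (K - 1) → ℝ) :=
  μ.map (specialPositions N K)

/-- Total variation distance `sup_B (μ(B) - ν(B))`, over all measurable sets `B`. -/
noncomputable def tvDist {E : Type*} [MeasurableSpace E] (μ ν : Measure E) : ℝ :=
  ⨆ B : {B : Set E // MeasurableSet B}, (μ.real B - ν.real B)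

/-- The time `t_δ = (1+δ) log N / (2 gap_N)`. -/
noncomputable def mixTime (N : ℕ) (α δ : ℝ) : ℝ :=
  (1 + δ) * (Real.log N / (2 * spectralGap N α))

end BetaResampling

namespace BetaResampling

section Positions

variable {N : ℕ} {x x' : Fin (N - 1) → ℝ}

@[simp] lemma pos_zero : pos N x 0 = 0 := by simp [pos]

@[simp] lemma pos_succ (i : Fin (N - 1)) : pos N x (i + 1) = x i := by
  simp [pos]

lemma pos_of_le {k : ℕ} (hk : N ≤ k) (h0 : k ≠ 0) : pos N x k = N := by
  have : ¬ (k - 1 < N - 1) := by omega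
  simp [pos, h0, this]

lemma pos_eq_coord {k : ℕ} (h0 : k ≠ 0) (hk : k < N) :
    pos N x k = x ⟨k - 1, by omega⟩ := by
  have : k - 1 < N - 1 := by omega
  simp [pos, h0, this]

lemma pos_update (i : Fin (N - 1)) (z : ℝ) (k : ℕ) :
    pos N (Function.update x i z) k = if k = i + 1 then z else pos N x k := by
  by_cases h0 : k = 0
  · subst h0; simp
  by_cases hk : k < N
  · rw [pos_eq_coord h0 hk, pos_eq_coord h0 hk, Function.update_apply]
    congr 1
    rw [Fin.ext_iff]; simp only [eq_iff_iff]; omega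
  · rw [pos_of_le (by omega) h0, pos_of_le (by omega) h0, if_neg]
    have := i.2; omega

lemma pos_continuous (k : ℕ) : Continuous fun x : Fin (N - 1) → ℝ => pos N x k := by
  unfold pos
  split_ifs <;> fun_prop

lemma pos_mono (h : x ≤ x') (k : ℕ) : pos N x k ≤ pos N x' k := by
  unfold pos
  split_ifs
  · exact le_rfl
  · exact h _
  · exact le_rfl

lemma pos_sup (k : ℕ) : pos N (x ⊔ x') k = max (pos N x k) (pos N x' k) := by
  unfold pos
  split_ifs <;> simp

lemma resample_continuous (i : Fin (N - 1)) :
    Continuous fun p : (Fin (N - 1) → ℝ) × ℝ => resample N i p.2 p.1 := by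
  unfold resample
  have h := fun k => (pos_continuous (N := N) k).comp
    (continuous_fst : Continuous (Prod.fst : (Fin (N - 1) → ℝ) × ℝ → _))
  simp only [Function.comp_def] at h
  have h1 := h i
  have h2 := h (i + 2)
  exact continuous_fst.update i (by fun_prop)

lemma resample_mono (i : Fin (N - 1)) {u : ℝ} (hu : u ∈ Set.Icc (0 : ℝ) 1) (h : x ≤ x') :
    resample N i u x ≤ resample N i u x' := by
  unfold resample
  intro j
  rcases eq_or_ne j i with rfl | hj
  · simp only [Function.update_self]
    have h1 := pos_mono h j
    have h2 := pos_mono h (j + 2)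
    have := hu.1; have := hu.2
    gcongr
  · simpa [hj] using h j

lemma resample_apply_of_ne {i j : Fin (N - 1)} (hj : j ≠ i) (u : ℝ) :
    resample N i u x j = x j := by
  simp [resample, hj]

lemma mem_stateSpace_sup (hx : x ∈ stateSpace N) (hx' : x' ∈ stateSpace N) :
    x ⊔ x' ∈ stateSpace N := by
  intro k hk
  rw [pos_sup, pos_sup]
  exact max_le_max (hx k hk) (hx' k hk)

lemma pos_mono_of_mem (hx : x ∈ stateSpace N) {k l : ℕ} (hkl : k ≤ l) (hl : l ≤ N) :
    pos N x k ≤ pos N x l := by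
  induction l, hkl using Nat.le_induction with
  | base => exact le_rfl
  | succ m _ ih => exact (ih (by omega)).trans (hx m (by omega))

lemma coord_mem_Icc (hx : x ∈ stateSpace N) (i : Fin (N - 1)) :
    x i ∈ Set.Icc (0 : ℝ) N := by
  have hi := i.2
  rw [← pos_succ (x := x) i]
  constructor
  · have := pos_mono_of_mem hx (Nat.zero_le (i + 1)) (by omega)
    simpa using this
  · have := pos_mono_of_mem hx (show (i : ℕ) + 1 ≤ N by omega) le_rfl
    rwa [pos_of_le (k := N) le_rfl (by omega)] at this

lemma isClosed_stateSpace : IsClosed (stateSpace N) := by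
  have : stateSpace N = ⋂ k, ⋂ _ : k < N, {x | pos N x k ≤ pos N x (k + 1)} := by
    ext; simp [stateSpace]
  rw [this]
  exact isClosed_iInter fun k => isClosed_iInter fun _ =>
    isClosed_le (pos_continuous k) (pos_continuous (k + 1))

lemma isCompact_stateSpace : IsCompact (stateSpace N) := by
  refine (isCompact_univ_pi fun _ : Fin (N - 1) => isCompact_Icc (a := (0 : ℝ)) (b := N)).of_isClosed_subset
    isClosed_stateSpace fun x hx i _ => coord_mem_Icc hx i

end Positions

section Beta

variable {α : ℝ}

lemma betaMeasure_compl_Icc : betaMeasure α α (Set.Icc (0 : ℝ) 1)ᶜ = 0 := by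
  rw [betaMeasure, withDensity_apply _ measurableSet_Icc.compl]
  refine setLIntegral_eq_zero measurableSet_Icc.compl fun u hu => ?_
  by_cases h : u ≤ 0
  · exact betaPDF_eq_zero_of_nonpos h
  · refine betaPDF_eq_zero_of_one_le ?_
    by_contra h'
    exact hu ⟨by linarith, by linarith⟩

lemma betaMeasure_ae_mem : ∀ᵐ u ∂(betaMeasure α α), u ∈ Set.Icc (0 : ℝ) 1 :=
  betaMeasure_compl_Icc

lemma betaMeasure_restrict : (betaMeasure α α).restrict (Set.Icc 0 1) = betaMeasure α α :=
  Measure.restrict_eq_self_of_ae_mem betaMeasure_ae_mem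

lemma integrable_betaMeasure (hα : 0 < α) {g : ℝ → ℝ} (hg : Continuous g) :
    Integrable g (betaMeasure α α) := by
  have := isProbabilityMeasureBeta hα hα
  have := hg.continuousOn.integrableOn_compact (μ := betaMeasure α α) (isCompact_Icc (a := (0:ℝ)) (b := 1))
  rwa [IntegrableOn, betaMeasure_restrict] at this

lemma betaPDF_symm (u : ℝ) : betaPDF α α (1 - u) = betaPDF α α u := by
  rw [betaPDF_eq, betaPDF_eq]
  congr 1
  by_cases h : 0 < u ∧ u < 1
  · rw [if_pos h, if_pos ⟨by linarith [h.2], by linarith [h.1]⟩, sub_sub_cancel]; ring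
  · rw [if_neg h, if_neg]
    rintro ⟨h1, h2⟩
    exact h ⟨by linarith, by linarith⟩

lemma map_one_sub_betaMeasure : (betaMeasure α α).map (fun u => 1 - u) = betaMeasure α α := by
  have hm : MeasurePreserving (fun u : ℝ => 1 - u) volume volume :=
    Measure.measurePreserving_sub_left volume 1
  ext s hs
  have hpdf : Measurable (betaPDF α α) := (measurable_betaPDFReal α α).ennreal_ofReal
  rw [Measure.map_apply (by fun_prop) hs, betaMeasure, withDensity_apply _ hs,
    withDensity_apply _ (hs.preimage (by fun_prop)), ← lintegral_indicator hs,
    ← lintegral_indicator (hs.preimage (by fun_prop)),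
    ← hm.lintegral_comp (hpdf.indicator hs)]
  congr 1
  ext u
  simp only [Set.indicator, Set.mem_preimage, betaPDF_symm]
  rfl

lemma integral_id_betaMeasure (hα : 0 < α) : ∫ u, u ∂(betaMeasure α α) = 1 / 2 := by
  have := isProbabilityMeasureBeta hα hα
  have h : ∫ u, u ∂(betaMeasure α α) = ∫ u, (1 - u) ∂(betaMeasure α α) := by
    conv_lhs => rw [← map_one_sub_betaMeasure]
    rw [integral_map (by fun_prop) (by fun_prop)]
  rw [integral_sub (integrable_const _) (integrable_betaMeasure hα continuous_id')] at h
  simp at h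
  linarith

end Beta

/-- The kernel `Q_i` acting on functions. -/
noncomputable def updateFun (N : ℕ) (α : ℝ) (i : Fin (N - 1)) (F : (Fin (N - 1) → ℝ) → ℝ)
    (x : Fin (N - 1) → ℝ) : ℝ :=
  ∫ u, F (resample N i u x) ∂(betaMeasure α α)

/-- The operator `∑_{i ∈ U} Q_i` acting on functions. -/
noncomputable def updateOp (N : ℕ) (α : ℝ) (U : Finset (Fin (N - 1)))
    (F : (Fin (N - 1) → ℝ) → ℝ) (x : Fin (N - 1) → ℝ) : ℝ :=
  ∑ i ∈ U, updateFun N α i F x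

section Operator

variable {N : ℕ} {α : ℝ} {i : Fin (N - 1)} {U : Finset (Fin (N - 1))}
  {F G : (Fin (N - 1) → ℝ) → ℝ} {x x' : Fin (N - 1) → ℝ}

lemma continuous_resample_right (i : Fin (N - 1)) (x : Fin (N - 1) → ℝ) :
    Continuous fun u => resample N i u x :=
  (resample_continuous i).comp (by fun_prop : Continuous fun u : ℝ => (x, u))

lemma integrable_comp_resample (hα : 0 < α) (hF : Continuous F) (i : Fin (N - 1))
    (x : Fin (N - 1) → ℝ) : Integrable (fun u => F (resample N i u x)) (betaMeasure α α) :=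
  integrable_betaMeasure hα (hF.comp (continuous_resample_right i x))

lemma updateFun_continuous (hα : 0 < α) (hF : Continuous F) : Continuous (updateFun N α i F) := by
  have := isProbabilityMeasureBeta hα hα
  have h := continuous_parametric_integral_of_continuous (μ := betaMeasure α α)
    (f := fun x u => F (resample N i u x)) (hF.comp (resample_continuous i))
    (isCompact_Icc (a := (0 : ℝ)) (b := 1))
  rwa [betaMeasure_restrict] at h

lemma updateOp_continuous (hα : 0 < α) (hF : Continuous F) : Continuous (updateOp N α U F) :=
  continuous_finsetSum _ fun _ _ => updateFun_continuous hα hF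

lemma updateFun_mono (hα : 0 < α) (hF : Continuous F) (hm : Monotone F) :
    Monotone (updateFun N α i F) := fun _ _ h =>
  integral_mono_ae (integrable_comp_resample hα hF i _) (integrable_comp_resample hα hF i _) <| by
    filter_upwards [betaMeasure_ae_mem] with u hu using hm (resample_mono i hu h)

lemma updateOp_mono (hα : 0 < α) (hF : Continuous F) (hm : Monotone F) :
    Monotone (updateOp N α U F) := fun _ _ h =>
  Finset.sum_le_sum fun _ _ => updateFun_mono hα hF hm h

lemma updateOp_iterate_continuous (hα : 0 < α) (hF : Continuous F) (n : ℕ) :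
    Continuous ((updateOp N α U)^[n] F) := by
  induction n with
  | zero => exact hF
  | succ n ih => rw [Function.iterate_succ_apply']; exact updateOp_continuous hα ih

lemma updateOp_iterate_mono (hα : 0 < α) (hF : Continuous F) (hm : Monotone F) (n : ℕ) :
    Monotone ((updateOp N α U)^[n] F) := by
  induction n with
  | zero => exact hm
  | succ n ih =>
    rw [Function.iterate_succ_apply']
    exact updateOp_mono hα (updateOp_iterate_continuous hα hF n) ih

lemma updateOp_nonneg (hF : ∀ x, 0 ≤ F x) (x : Fin (N - 1) → ℝ) : 0 ≤ updateOp N α U F x :=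
  Finset.sum_nonneg fun _ _ => integral_nonneg fun _ => hF _

lemma updateOp_iterate_nonneg (hF : ∀ x, 0 ≤ F x) (n : ℕ) (x : Fin (N - 1) → ℝ) :
    0 ≤ (updateOp N α U)^[n] F x := by
  induction n generalizing x with
  | zero => exact hF x
  | succ n ih => rw [Function.iterate_succ_apply']; exact updateOp_nonneg ih x

end Operator

/-- `F` has a modulus of continuity of the form `∑_{i ∈ U} w_i |x_i - x'_i|` along configurations that
agree off `U`, with weights whose `φ`-average is at most `M`. -/
def HasModulus (N : ℕ) (φ : ℕ → ℝ) (U : Finset (Fin (N - 1))) (M : ℝ)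
    (F : (Fin (N - 1) → ℝ) → ℝ) : Prop :=
  ∃ w : ℕ → ℝ, (∀ k, 0 ≤ w k) ∧ w 0 = 0 ∧ (∀ k, N ≤ k → w k = 0) ∧
    (∀ i : Fin (N - 1), i ∉ U → w (i + 1) = 0) ∧ ∑ i : Fin (N - 1), φ (i + 1) * w (i + 1) ≤ M ∧
    ∀ x x' : Fin (N - 1) → ℝ, (∀ i, i ∉ U → x i = x' i) →
      |F x - F x'| ≤ ∑ i : Fin (N - 1), w (i + 1) * |x i - x' i|

/-- Summation by parts for the discrete Laplacian. -/
lemma sum_mul_neighbors (a b : ℕ → ℝ) (M : ℕ) :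
    ∑ j ∈ Finset.range M, a (j + 1) * (b j + b (j + 2)) =
      ∑ j ∈ Finset.range M, b (j + 1) * (a j + a (j + 2)) +
        (a 1 * b 0 - a 0 * b 1) - (a (M + 1) * b M - a M * b (M + 1)) := by
  induction M with
  | zero => simp
  | succ n ih => rw [Finset.sum_range_succ, Finset.sum_range_succ, ih]; ring

section Modulus

variable {N : ℕ} {α : ℝ} {U : Finset (Fin (N - 1))}
  {F : (Fin (N - 1) → ℝ) → ℝ} {x x' : Fin (N - 1) → ℝ}

lemma integral_affine_betaMeasure (hα : 0 < α) (a b : ℝ) :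
    ∫ u, (u * a + (1 - u) * b) ∂(betaMeasure α α) = (a + b) / 2 := by
  have := isProbabilityMeasureBeta hα hα
  have h : (fun u : ℝ => u * a + (1 - u) * b) = fun u => u * (a - b) + b := by ext; ring
  rw [h, integral_add (integrable_betaMeasure hα (by fun_prop)) (integrable_const _),
    integral_mul_const, integral_id_betaMeasure hα]
  simp
  ring

/-- The increment of `Q_j F` under the coupling that uses the same Beta variable. -/
lemma abs_updateFun_sub_le (hα : 0 < α) (hF : Continuous F) {w : ℕ → ℝ} (hw : ∀ k, 0 ≤ w k)
    (hmod : ∀ x x' : Fin (N - 1) → ℝ, (∀ i, i ∉ U → x i = x' i) →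
      |F x - F x'| ≤ ∑ i : Fin (N - 1), w (i + 1) * |x i - x' i|)
    (j : Fin (N - 1)) (hj : j ∈ U) (hx : ∀ i, i ∉ U → x i = x' i) :
    |updateFun N α j F x - updateFun N α j F x'| ≤
      ∑ i : Fin (N - 1), w (i + 1) * |x i - x' i| - w (j + 1) * |x j - x' j| +
      w (j + 1) * ((|pos N x j - pos N x' j| + |pos N x (j + 2) - pos N x' (j + 2)|) / 2) := by
  have := isProbabilityMeasureBeta hα hα
  set a := |pos N x j - pos N x' j|
  set b := |pos N x (j + 2) - pos N x' (j + 2)|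
  set S := ∑ i : Fin (N - 1), w (i + 1) * |x i - x' i| - w (j + 1) * |x j - x' j| with hS
  have hbound : ∀ u ∈ Set.Icc (0 : ℝ) 1, |F (resample N j u x) - F (resample N j u x')| ≤
      S + w (j + 1) * (u * a + (1 - u) * b) := by
    intro u hu
    refine (hmod _ _ fun i hi => ?_).trans ?_
    · have : i ≠ j := fun h => hi (h ▸ hj)
      rw [resample_apply_of_ne this, resample_apply_of_ne this, hx i hi]
    · rw [hS, ← Finset.add_sum_erase _ _ (Finset.mem_univ j),
        ← Finset.add_sum_erase (f := fun i : Fin (N - 1) => w (i + 1) * |x i - x' i|) _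
          (Finset.mem_univ j)]
      have h1 : ∑ i ∈ Finset.univ.erase j, w (i + 1) * |resample N j u x i - resample N j u x' i| =
          ∑ i ∈ Finset.univ.erase j, w (i + 1) * |x i - x' i| :=
        Finset.sum_congr rfl fun i hi => by
          have : i ≠ j := Finset.ne_of_mem_erase hi
          rw [resample_apply_of_ne this, resample_apply_of_ne this]
      have h2 : |resample N j u x j - resample N j u x' j| ≤ u * a + (1 - u) * b := by
        simp only [resample, Function.update_self]
        have : u * pos N x j + (1 - u) * pos N x (j + 2) -
            (u * pos N x' j + (1 - u) * pos N x' (j + 2)) =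
            u * (pos N x j - pos N x' j) + (1 - u) * (pos N x (j + 2) - pos N x' (j + 2)) := by ring
        rw [this]
        refine (abs_add_le _ _).trans ?_
        rw [abs_mul, abs_mul, abs_of_nonneg hu.1, abs_of_nonneg (sub_nonneg.2 hu.2)]
      rw [h1]
      have := mul_le_mul_of_nonneg_left h2 (hw (j + 1))
      linarith
  have hi1 := integrable_comp_resample hα hF j x
  have hi2 := integrable_comp_resample hα hF j x'
  have hi3 : Integrable (fun u => S + w (j + 1) * (u * a + (1 - u) * b)) (betaMeasure α α) :=
    integrable_betaMeasure hα (by fun_prop)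
  calc |updateFun N α j F x - updateFun N α j F x'|
      = |∫ u, (F (resample N j u x) - F (resample N j u x')) ∂(betaMeasure α α)| := by
        rw [integral_sub hi1 hi2]; rfl
    _ ≤ ∫ u, |F (resample N j u x) - F (resample N j u x')| ∂(betaMeasure α α) :=
        abs_integral_le_integral_abs
    _ ≤ ∫ u, (S + w (j + 1) * (u * a + (1 - u) * b)) ∂(betaMeasure α α) := by
        refine integral_mono_ae (hi1.sub hi2).abs hi3 ?_
        filter_upwards [betaMeasure_ae_mem] with u hu using hbound u hu
    _ = S + w (j + 1) * ((a + b) / 2) := by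
        rw [integral_add (integrable_const _) (integrable_betaMeasure hα (by fun_prop)),
          integral_const_mul, integral_affine_betaMeasure hα]
        simp

/-- `∑_{i ∈ U} Q_i` contracts the modulus of continuity when `φ` is a positive eigenfunction of the
discrete Laplacian. -/
lemma HasModulus.updateOp (hα : 0 < α) {φ : ℕ → ℝ} {c M : ℝ} (hφ : ∀ k ≤ N, 0 ≤ φ k)
    (hc : 0 ≤ c) (hφc : ∀ k, φ k + φ (k + 2) = 2 * c * φ (k + 1)) (hU : U.Nonempty)
    (hF : Continuous F) (h : HasModulus N φ U M F) :
    HasModulus N φ U ((U.card - 1 + c) * M) (updateOp N α U F) := by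
  obtain ⟨w, hw, hw0, hwN, hwU, hM, hmod⟩ := h
  have hcard : (1 : ℝ) ≤ U.card := by exact_mod_cast hU.card_pos
  have hN : 0 < N - 1 := by
    obtain ⟨i, -⟩ := hU; exact i.pos
  set v : ℕ → ℝ := fun k => (U.card - 1) * w k + (w (k - 1) + w (k + 1)) / 2 with hv
  set L : ℕ → Prop := fun k => ∃ i ∈ U, k = (i : ℕ) + 1 with hL
  classical
  refine ⟨fun k => if L k then v k else 0, ?_, ?_, ?_, ?_, ?_, ?_⟩
  · intro k
    have h1 := hw k; have h2 := hw (k - 1); have h3 := hw (k + 1)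
    have : 0 ≤ v k := by
      have : 0 ≤ ((U.card : ℝ) - 1) * w k := mul_nonneg (by linarith) h1
      simp only [hv]; linarith
    beta_reduce
    split_ifs <;> [exact this; exact le_rfl]
  · beta_reduce; rw [if_neg]; rintro ⟨i, -, h⟩; omega
  · intro k hk
    beta_reduce; rw [if_neg]; rintro ⟨i, -, h⟩; have := i.2; omega
  · intro i hi
    beta_reduce; rw [if_neg]; rintro ⟨j, hj, h⟩
    have : i = j := Fin.ext (by omega)
    exact hi (this ▸ hj)
  · have hvn : ∀ k, 0 ≤ v k := by
      intro k
      have h1 := hw k; have h2 := hw (k - 1); have h3 := hw (k + 1)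
      have : 0 ≤ ((U.card : ℝ) - 1) * w k := mul_nonneg (by linarith) h1
      simp only [hv]; linarith
    have h1 : ∑ i : Fin (N - 1), φ (i + 1) * (if L (i + 1) then v (i + 1) else 0) ≤
        ∑ i : Fin (N - 1), φ (i + 1) * v (i + 1) := by
      refine Finset.sum_le_sum fun i _ => ?_
      have := i.2
      refine mul_le_mul_of_nonneg_left ?_ (hφ _ (by omega))
      split_ifs <;> [exact le_rfl; exact hvn _]
    have h2 : ∑ i : Fin (N - 1), φ (i + 1) * v (i + 1) =
        (U.card - 1) * ∑ i : Fin (N - 1), φ (i + 1) * w (i + 1) +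
        (∑ j ∈ Finset.range (N - 1), φ (j + 1) * (w j + w (j + 2))) / 2 := by
      rw [← Fin.sum_univ_eq_sum_range (fun j => φ (j + 1) * (w j + w (j + 2))), Finset.mul_sum,
        Finset.sum_div, ← Finset.sum_add_distrib]
      refine Finset.sum_congr rfl fun i _ => ?_
      simp only [hv, Nat.add_sub_cancel]
      ring
    have h3 : ∑ j ∈ Finset.range (N - 1), φ (j + 1) * (w j + w (j + 2)) ≤
        2 * c * ∑ i : Fin (N - 1), φ (i + 1) * w (i + 1) := by
      rw [sum_mul_neighbors, hw0, hwN (N - 1 + 1) (by omega), Finset.mul_sum,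
        ← Fin.sum_univ_eq_sum_range (fun j => w (j + 1) * (φ j + φ (j + 2)))]
      have e1 := mul_nonneg (hφ 0 (by omega)) (hw 1)
      have e2 := mul_nonneg (hφ (N - 1 + 1) (by omega)) (hw (N - 1))
      have : ∑ i : Fin (N - 1), w (i + 1) * (φ i + φ (i + 2)) =
          ∑ i : Fin (N - 1), 2 * c * (φ (i + 1) * w (i + 1)) :=
        Finset.sum_congr rfl fun i _ => by rw [hφc]; ring
      linarith
    calc _ ≤ _ := h1
      _ ≤ (U.card - 1 + c) * ∑ i : Fin (N - 1), φ (i + 1) * w (i + 1) := by rw [h2]; linarith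
      _ ≤ _ := mul_le_mul_of_nonneg_left hM (by linarith)
  · intro x x' hx
    set d : ℕ → ℝ := fun k => |pos N x k - pos N x' k| with hd
    have hdi : ∀ i : Fin (N - 1), |x i - x' i| = d (i + 1) := fun i => by simp [hd]
    have hd0 : d 0 = 0 := by simp [hd]
    have hdN : d (N - 1 + 1) = 0 := by simp [hd, pos_of_le (N := N) (k := N - 1 + 1) (by omega)]
    have hdU : ∀ i : Fin (N - 1), i ∉ U → d (i + 1) = 0 := fun i hi => by simp [hd, hx i hi]
    set S := ∑ i : Fin (N - 1), w (i + 1) * |x i - x' i| with hS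
    have h1 : |BetaResampling.updateOp N α U F x - BetaResampling.updateOp N α U F x'| ≤
        ∑ j ∈ U, (S - w (j + 1) * d (j + 1) + w (j + 1) * ((d j + d (j + 2)) / 2)) := by
      unfold BetaResampling.updateOp
      rw [← Finset.sum_sub_distrib]
      refine (Finset.abs_sum_le_sum_abs _ _).trans (Finset.sum_le_sum fun j hj => ?_)
      rw [← hdi]
      exact abs_updateFun_sub_le hα hF hw hmod j hj hx
    have hext : ∀ g : Fin (N - 1) → ℝ, ∑ j ∈ U, w (j + 1) * g j = ∑ j : Fin (N - 1), w (j + 1) * g j :=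
      fun g => Finset.sum_subset (Finset.subset_univ _) fun j _ hj => by rw [hwU j hj, zero_mul]
    have h2 : ∑ j ∈ U, (S - w (j + 1) * d (j + 1) + w (j + 1) * ((d j + d (j + 2)) / 2)) =
        U.card * S - S + (∑ j : Fin (N - 1), w (j + 1) * (d j + d (j + 2))) / 2 := by
      rw [Finset.sum_add_distrib, Finset.sum_sub_distrib, hext (fun j => d (j + 1)),
        hext (fun j => (d j + d (j + 2)) / 2), Finset.sum_const, nsmul_eq_mul, Finset.sum_div]
      congr 1
      · congr 1
        exact Finset.sum_congr rfl fun i _ => by rw [hdi]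
      · exact Finset.sum_congr rfl fun i _ => by ring
    have h3 : ∑ j : Fin (N - 1), w (j + 1) * (d j + d (j + 2)) =
        ∑ j : Fin (N - 1), d (j + 1) * (w j + w (j + 2)) := by
      rw [Fin.sum_univ_eq_sum_range (fun j => w (j + 1) * (d j + d (j + 2))), sum_mul_neighbors,
        hw0, hd0, hdN, hwN (N - 1 + 1) (by omega),
        Fin.sum_univ_eq_sum_range (fun j => d (j + 1) * (w j + w (j + 2)))]
      ring
    refine h1.trans (le_of_eq ?_)
    rw [h2, h3, hS]
    rw [show (U.card : ℝ) * ∑ i : Fin (N - 1), w (i + 1) * |x i - x' i| -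
        ∑ i : Fin (N - 1), w (i + 1) * |x i - x' i| =
        ∑ i : Fin (N - 1), (U.card - 1) * (w (i + 1) * |x i - x' i|) by
      rw [← Finset.mul_sum]; ring, Finset.sum_div, ← Finset.sum_add_distrib]
    refine Finset.sum_congr rfl fun i _ => ?_
    beta_reduce
    by_cases hi : i ∈ U
    · rw [if_pos ⟨i, hi, rfl⟩, hdi]
      simp only [hv, Nat.add_sub_cancel]
      ring
    · rw [hdi, hdU i hi]; simp

lemma HasModulus.updateOp_iterate (hα : 0 < α) {φ : ℕ → ℝ} {c M : ℝ} (hφ : ∀ k ≤ N, 0 ≤ φ k)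
    (hc : 0 ≤ c) (hφc : ∀ k, φ k + φ (k + 2) = 2 * c * φ (k + 1)) (hU : U.Nonempty)
    (hF : Continuous F) (h : HasModulus N φ U M F) (n : ℕ) :
    HasModulus N φ U ((U.card - 1 + c) ^ n * M) ((BetaResampling.updateOp N α U)^[n] F) := by
  induction n with
  | zero => simpa using h
  | succ n ih =>
    rw [Function.iterate_succ_apply', pow_succ', mul_assoc]
    exact ih.updateOp hα hφ hc hφc hU (updateOp_iterate_continuous hα hF n)

lemma HasModulus.abs_sub_le {φ : ℕ → ℝ} {M b D : ℝ} (hb : 0 < b) (hφ : ∀ k ≤ N, b ≤ φ k)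
    (h : HasModulus N φ U M F) (hx : ∀ i, i ∉ U → x i = x' i) (hD : ∀ i, |x i - x' i| ≤ D) (hD0 : 0 ≤ D) :
    |F x - F x'| ≤ D / b * M := by
  obtain ⟨w, hw, -, -, -, hM, hmod⟩ := h
  calc |F x - F x'| ≤ ∑ i : Fin (N - 1), w (i + 1) * |x i - x' i| := hmod x x' hx
    _ ≤ ∑ i : Fin (N - 1), D / b * (φ (i + 1) * w (i + 1)) := by
        refine Finset.sum_le_sum fun i _ => ?_
        have hi := i.2
        have h1 := hφ (i + 1) (by omega)
        have h2 := hw (i + 1)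
        calc w (i + 1) * |x i - x' i| ≤ w (i + 1) * D := by gcongr; exact hD i
          _ = D / b * (b * w (i + 1)) := by field_simp
          _ ≤ _ := by gcongr
    _ ≤ _ := by rw [← Finset.mul_sum]; gcongr

lemma abs_sub_le_of_mem_stateSpace (hx : x ∈ stateSpace N) (hx' : x' ∈ stateSpace N) (i : Fin (N - 1)) :
    |x i - x' i| ≤ N := by
  have h1 := coord_mem_Icc hx i
  have h2 := coord_mem_Icc hx' i
  rw [abs_le]; constructor <;> linarith [h1.1, h1.2, h2.1, h2.2]

end Modulus

section Reversibility

open scoped ENNReal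

variable {N : ℕ} {α : ℝ}

lemma measurable_pos (k : ℕ) : Measurable fun x : Fin (N - 1) → ℝ => pos N x k :=
  (pos_continuous k).measurable

/-- The equilibrium density. -/
noncomputable def equilibriumDensity (N : ℕ) (α : ℝ) (x : Fin (N - 1) → ℝ) : ℝ≥0∞ :=
  ENNReal.ofReal (Real.Gamma (N * α) / (Real.Gamma α ^ N * (N : ℝ) ^ (N * α - 1)) *
      ∏ k ∈ Finset.range N, (pos N x (k + 1) - pos N x k) ^ (α - 1))

lemma measurable_equilibriumDensity : Measurable (equilibriumDensity N α) := by
  unfold equilibriumDensity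
  have h := fun k => measurable_pos (N := N) k
  exact ((Finset.measurable_prod _ fun k _ =>
    ((h (k + 1)).sub (h k)).pow_const _).const_mul _).ennreal_ofReal

lemma lintegral_equilibrium {f : (Fin (N - 1) → ℝ) → ℝ≥0∞} (hf : Measurable f) :
    ∫⁻ x, f x ∂(equilibrium N α) =
      ∫⁻ x, (stateSpace N).indicator (equilibriumDensity N α) x * f x := by
  have : equilibrium N α = (volume.restrict (stateSpace N)).withDensity (equilibriumDensity N α) :=
    rfl
  rw [this, lintegral_withDensity_eq_lintegral_mul _ measurable_equilibriumDensity hf,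
    ← lintegral_indicator isClosed_stateSpace.measurableSet]
  congr 1
  ext x
  by_cases hx : x ∈ stateSpace N <;> simp [hx]

lemma equilibrium_ae_mem : ∀ᵐ x ∂(equilibrium N α), x ∈ stateSpace N := by
  refine (withDensity_absolutelyContinuous _ _).ae_le ?_
  exact ae_restrict_mem isClosed_stateSpace.measurableSet

/-- The unnormalised conditional density of a particle given its neighbours at `a` and `b`. -/
noncomputable def localDensity (α a b z : ℝ) : ℝ≥0∞ :=
  (Set.Icc a b).indicator (fun z => ENNReal.ofReal ((z - a) ^ (α - 1) * (b - z) ^ (α - 1))) z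

lemma measurable_localDensity (a b : ℝ) : Measurable (localDensity α a b) :=
  Measurable.indicator (by fun_prop) measurableSet_Icc

lemma lintegral_comp_affine {c : ℝ} (hc : c ≠ 0) (b : ℝ) {G : ℝ → ℝ≥0∞} (hG : Measurable G) :
    ENNReal.ofReal |c| * ∫⁻ u, G (b + c * u) = ∫⁻ z, G z := by
  rw [← lintegral_add_left_eq_self G b]
  conv_rhs => rw [← Real.smul_map_volume_mul_left hc]
  rw [lintegral_smul_measure, lintegral_map (by fun_prop) (by fun_prop), smul_eq_mul]

lemma lintegral_localDensity (hα : 0 < α) {a b : ℝ} (hab : a < b) {G : ℝ → ℝ≥0∞}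
    (hG : Measurable G) :
    ∫⁻ z, localDensity α a b z * G z =
      ENNReal.ofReal (b - a) * ENNReal.ofReal (beta α α * (b - a) ^ (α - 1 + (α - 1))) *
        ∫⁻ u, G (u * a + (1 - u) * b) ∂(betaMeasure α α) := by
  have hpdf : Measurable (betaPDF α α) := (measurable_betaPDFReal α α).ennreal_ofReal
  rw [betaMeasure, lintegral_withDensity_eq_lintegral_mul _ hpdf (by fun_prop),
    ← lintegral_comp_affine (G := fun z => localDensity α a b z * G z) (c := a - b)
      (by linarith) b ((measurable_localDensity a b).mul hG),
    mul_assoc, ← lintegral_const_mul _ (hpdf.mul (by fun_prop)), abs_sub_comm,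
    abs_of_pos (sub_pos.2 hab)]
  congr 1
  refine lintegral_congr_ae ?_
  have h0 : ∀ᵐ u : ℝ, u ≠ 0 := by simp [ae_iff]
  have h1 : ∀ᵐ u : ℝ, u ≠ 1 := by simp [ae_iff]
  filter_upwards [h0, h1] with u hu0 hu1
  have hz : b + (a - b) * u = u * a + (1 - u) * b := by ring
  simp only [Pi.mul_apply, hz, ← mul_assoc]
  congr 1
  rw [localDensity, betaPDF_eq]
  by_cases hu : 0 < u ∧ u < 1
  · have hba := sub_pos.2 hab
    have hu' : 0 < 1 - u := by linarith [hu.2]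
    rw [if_pos hu, Set.indicator_of_mem, ← ENNReal.ofReal_mul
      (mul_nonneg (beta_pos hα hα).le (Real.rpow_nonneg hba.le _))]
    · congr 1
      rw [show u * a + (1 - u) * b - a = (b - a) * (1 - u) by ring,
        show b - (u * a + (1 - u) * b) = (b - a) * u by ring,
        Real.mul_rpow hba.le hu'.le, Real.mul_rpow hba.le hu.1.le, Real.rpow_add hba]
      have := (beta_pos hα hα).ne'
      field_simp
    · constructor
      · nlinarith [mul_pos hba hu']
      · nlinarith [mul_pos hba hu.1]
  · rw [if_neg hu, Set.indicator_of_notMem]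
    · simp
    · rintro ⟨h1, h2⟩
      have hba := sub_pos.2 hab
      apply hu
      constructor
      · refine lt_of_le_of_ne ?_ hu0.symm
        by_contra hneg
        nlinarith [mul_pos hba (neg_pos.2 (not_le.1 hneg))]
      · refine lt_of_le_of_ne ?_ hu1
        by_contra hneg
        nlinarith [mul_pos hba (sub_pos.2 (not_le.1 hneg))]

lemma lintegral_localDensity_symm (hα : 0 < α) (a b : ℝ) {F : ℝ → ℝ → ℝ≥0∞}
    (hF : Measurable (Function.uncurry F)) :
    ∫⁻ z, localDensity α a b z * ∫⁻ u, F z (u * a + (1 - u) * b) ∂(betaMeasure α α) =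
      ∫⁻ z, localDensity α a b z * ∫⁻ u, F (u * a + (1 - u) * b) z ∂(betaMeasure α α) := by
  rcases lt_or_ge a b with hab | hab
  · set Z := ENNReal.ofReal (b - a) * ENNReal.ofReal (beta α α * (b - a) ^ (α - 1 + (α - 1)))
    have hba := sub_pos.2 hab
    have hZ0 : Z ≠ 0 := mul_ne_zero (by simpa using hab) (by
      simpa using mul_pos (beta_pos hα hα) (Real.rpow_pos_of_pos hba _))
    have hZt : Z ≠ ∞ := ENNReal.mul_ne_top ENNReal.ofReal_ne_top ENNReal.ofReal_ne_top
    have key : ∀ G : ℝ → ℝ≥0∞, Measurable G → ∫⁻ u, G (u * a + (1 - u) * b) ∂(betaMeasure α α) =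
        Z⁻¹ * ∫⁻ z, localDensity α a b z * G z := fun G hG => by
      rw [lintegral_localDensity hα hab hG, ← mul_assoc, ENNReal.inv_mul_cancel hZ0 hZt, one_mul]
    have hq := measurable_localDensity (α := α) a b
    have hF1 : ∀ z, Measurable (F z) := fun z => hF.comp (by fun_prop : Measurable fun y => (z, y))
    have hF2 : ∀ z, Measurable fun y => F y z :=
      fun z => hF.comp (by fun_prop : Measurable fun y => (y, z))
    have e1 : ∀ z, localDensity α a b z * ∫⁻ u, F z (u * a + (1 - u) * b) ∂(betaMeasure α α) =
        ∫⁻ z', Z⁻¹ * (localDensity α a b z * (localDensity α a b z' * F z z')) := fun z => by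
      have hm := hq.mul (hF1 z)
      simp only [Pi.mul_def] at hm
      rw [key _ (hF1 z), lintegral_const_mul _ (hm.const_mul _), lintegral_const_mul _ hm]
      ring
    have e2 : ∀ z, localDensity α a b z * ∫⁻ u, F (u * a + (1 - u) * b) z ∂(betaMeasure α α) =
        ∫⁻ z', Z⁻¹ * (localDensity α a b z * (localDensity α a b z' * F z' z)) := fun z => by
      have hm := hq.mul (hF2 z)
      simp only [Pi.mul_def] at hm
      rw [key _ (hF2 z), lintegral_const_mul _ (hm.const_mul _), lintegral_const_mul _ hm]
      ring
    simp_rw [e1, e2]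
    rw [lintegral_lintegral_swap]
    · refine lintegral_congr fun z => lintegral_congr fun z' => ?_
      ring
    · have hF' : Measurable fun p : ℝ × ℝ => F p.1 p.2 := hF
      have h1 : Measurable fun p : ℝ × ℝ => localDensity α a b p.1 := hq.comp measurable_fst
      have h2 : Measurable fun p : ℝ × ℝ => localDensity α a b p.2 := hq.comp measurable_snd
      exact ((h1.mul (h2.mul hF')).const_mul _).aemeasurable
  · have h0 : ∀ᵐ z : ℝ, localDensity α a b z = 0 := by
      have : ∀ᵐ z : ℝ, z ≠ a := by simp [ae_iff]
      filter_upwards [this] with z hz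
      refine Set.indicator_of_notMem ?_ _
      rintro ⟨h1, h2⟩
      exact hz (le_antisymm (h2.trans hab) h1)
    refine lintegral_congr_ae ?_
    filter_upwards [h0] with z hz
    rw [hz, zero_mul, zero_mul]

lemma indicator_equilibriumDensity_update (hα : 0 < α) (i : Fin (N - 1)) (x : Fin (N - 1) → ℝ) :
    ∃ W : ℝ≥0∞, ∀ z, (stateSpace N).indicator (equilibriumDensity N α) (Function.update x i z) =
      W * localDensity α (pos N x i) (pos N x (i + 2)) z := by
  classical
  have hi := i.2
  set C := Real.Gamma (N * α) / (Real.Gamma α ^ N * (N : ℝ) ^ (N * α - 1))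
  set R := (Finset.range N).erase i |>.erase (i + 1) with hR
  set W : ℝ≥0∞ := if ∀ k ∈ R, pos N x k ≤ pos N x (k + 1) then
    ENNReal.ofReal (C * ∏ k ∈ R, (pos N x (k + 1) - pos N x k) ^ (α - 1)) else 0 with hW
  have hrange : ∀ k, k < N ↔ k ∈ R ∨ k = i ∨ k = i + 1 := by
    intro k; simp only [hR, Finset.mem_erase, Finset.mem_range]; omega
  have hposR : ∀ z, ∀ k ∈ R, pos N (Function.update x i z) k = pos N x k ∧
      pos N (Function.update x i z) (k + 1) = pos N x (k + 1) := by
    intro z k hk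
    simp only [hR, Finset.mem_erase, Finset.mem_range] at hk
    rw [pos_update, pos_update, if_neg (by omega), if_neg (by omega)]
    exact ⟨rfl, rfl⟩
  have hp0 : ∀ z, pos N (Function.update x i z) i = pos N x i := fun z => by
    rw [pos_update, if_neg (by omega)]
  have hp1 : ∀ z, pos N (Function.update x i z) (i + 1) = z := fun z => by
    rw [pos_update, if_pos rfl]
  have hp2 : ∀ z, pos N (Function.update x i z) (i + 1 + 1) = pos N x (i + 2) := fun z => by
    rw [pos_update, if_neg (by omega)]
  have hmem : ∀ z, Function.update x i z ∈ stateSpace N ↔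
      (∀ k ∈ R, pos N x k ≤ pos N x (k + 1)) ∧ z ∈ Set.Icc (pos N x i) (pos N x (i + 2)) := by
    intro z
    constructor
    · intro h
      refine ⟨fun k hk => ?_, ?_, ?_⟩
      · have := h k ((hrange k).2 (Or.inl hk))
        rwa [(hposR z k hk).1, (hposR z k hk).2] at this
      · have := h i (by omega)
        rwa [hp0, hp1] at this
      · have := h (i + 1) (by omega)
        rwa [hp1, hp2] at this
    · rintro ⟨h1, h2, h3⟩ k hk
      rcases (hrange k).1 hk with hk | rfl | rfl
      · rw [(hposR z k hk).1, (hposR z k hk).2]; exact h1 k hk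
      · rw [hp0, hp1]; exact h2
      · rw [hp1, hp2]; exact h3
  have hC : 0 ≤ C := div_nonneg (Real.Gamma_nonneg_of_nonneg (by positivity))
    (mul_nonneg (pow_nonneg (Real.Gamma_nonneg_of_nonneg hα.le) _) (by positivity))
  refine ⟨W, fun z => ?_⟩
  by_cases hR' : ∀ k ∈ R, pos N x k ≤ pos N x (k + 1)
  · by_cases hz : z ∈ Set.Icc (pos N x i) (pos N x (i + 2))
    · rw [Set.indicator_of_mem ((hmem z).2 ⟨hR', hz⟩), localDensity, Set.indicator_of_mem hz, hW,
        if_pos hR', ← ENNReal.ofReal_mul, equilibriumDensity]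
      · change ENNReal.ofReal (C * _) = _
        congr 1
        rw [mul_assoc]
        congr 1
        rw [← Finset.mul_prod_erase (Finset.range N) _ (a := (i : ℕ)) (by simp; omega),
          ← Finset.mul_prod_erase ((Finset.range N).erase i) _ (a := (i : ℕ) + 1)
            (by simp; omega), hp0, hp1, hp2, ← hR,
          Finset.prod_congr rfl fun k hk => by rw [(hposR z k hk).1, (hposR z k hk).2]]
        ring
      · exact mul_nonneg hC (Finset.prod_nonneg fun k hk =>
          Real.rpow_nonneg (sub_nonneg.2 (hR' k hk)) _)
    · rw [Set.indicator_of_notMem (fun h => hz ((hmem z).1 h).2), localDensity,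
        Set.indicator_of_notMem hz, mul_zero]
  · rw [Set.indicator_of_notMem (fun h => hR' ((hmem z).1 h).1), hW, if_neg hR', zero_mul]

lemma resample_update (i : Fin (N - 1)) (x : Fin (N - 1) → ℝ) (u z : ℝ) :
    resample N i u (Function.update x i z) =
      Function.update x i (u * pos N x i + (1 - u) * pos N x (i + 2)) := by
  rw [resample, pos_update, pos_update, if_neg (by omega), if_neg (by omega), Function.update_idem]

/-- Reversibility of `Q_i` with respect to the equilibrium measure. -/
lemma lintegral_resample_symm (hα : 0 < α) (i : Fin (N - 1))
    {F : (Fin (N - 1) → ℝ) → (Fin (N - 1) → ℝ) → ℝ≥0∞} (hF : Measurable (Function.uncurry F)) :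
    ∫⁻ x, ∫⁻ u, F x (resample N i u x) ∂(betaMeasure α α) ∂(equilibrium N α) =
      ∫⁻ x, ∫⁻ u, F (resample N i u x) x ∂(betaMeasure α α) ∂(equilibrium N α) := by
  have := isProbabilityMeasureBeta hα hα
  have hres : Measurable fun p : (Fin (N - 1) → ℝ) × ℝ => resample N i p.2 p.1 :=
    (resample_continuous i).measurable
  have hm1 : Measurable fun p : (Fin (N - 1) → ℝ) × ℝ => F p.1 (resample N i p.2 p.1) :=
    hF.comp (measurable_fst.prodMk hres)
  have hm2 : Measurable fun p : (Fin (N - 1) → ℝ) × ℝ => F (resample N i p.2 p.1) p.1 :=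
    hF.comp (hres.prodMk measurable_fst)
  have hd := (measurable_equilibriumDensity (N := N) (α := α)).indicator
    isClosed_stateSpace.measurableSet
  have hi1 := hm1.lintegral_prod_right' (ν := betaMeasure α α)
  have hi2 := hm2.lintegral_prod_right' (ν := betaMeasure α α)
  rw [lintegral_equilibrium hi1, lintegral_equilibrium hi2, volume_pi]
  refine lintegral_eq_of_lmarginal_eq {i} (hd.mul hi1) (hd.mul hi2) ?_
  ext x
  rw [lmarginal_singleton, lmarginal_singleton]
  obtain ⟨W, hW⟩ := indicator_equilibriumDensity_update hα i x
  have hF' : Measurable (Function.uncurry fun z z' =>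
      F (Function.update x i z) (Function.update x i z')) :=
    hF.comp (((measurable_update x).comp measurable_fst).prodMk
      ((measurable_update x).comp measurable_snd))
  simp_rw [hW, resample_update, mul_assoc]
  have key := lintegral_localDensity_symm hα (pos N x i) (pos N x (i + 2)) hF'
  have hq := measurable_localDensity (α := α) (pos N x i) (pos N x (i + 2))
  have hup : Measurable fun p : ℝ × ℝ => (p.1, p.2 * pos N x i + (1 - p.2) * pos N x (i + 2)) := by
    fun_prop
  have h1 := (hF'.comp hup).lintegral_prod_right' (ν := betaMeasure α α)
  have h2 := (hF'.comp (measurable_swap.comp hup)).lintegral_prod_right' (ν := betaMeasure α α)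
  simp only [Function.comp_def, Function.uncurry, Prod.swap] at h1 h2
  have h3 := hq.mul h1
  have h4 := hq.mul h2
  simp only [Pi.mul_def] at h3 h4
  rw [lintegral_const_mul _ h3, lintegral_const_mul _ h4, key]

end Reversibility

section Gamma

open scoped ENNReal

lemma lintegral_prod_apply {m : ℕ} (f : Fin m → ℝ → ℝ≥0∞) (hf : ∀ i, Measurable (f i)) :
    ∫⁻ x : Fin m → ℝ, ∏ i, f i (x i) = ∏ i, ∫⁻ x, f i x := by
  induction m with
  | zero => simp [volume_pi]
  | succ m ih =>
    rw [← ((volume_preserving_piFinSuccAbove (fun _ : Fin (m + 1) => ℝ) 0).symm).lintegral_comp_emb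
      (MeasurableEquiv.measurableEmbedding _)]
    have h : ∀ p : ℝ × (Fin m → ℝ), ∏ i, f i
        ((MeasurableEquiv.piFinSuccAbove (fun _ : Fin (m + 1) => ℝ) 0).symm p i) =
        f 0 p.1 * ∏ i : Fin m, f i.succ (p.2 i) := fun p => by
      rw [Fin.prod_univ_succ]
      rfl
    simp_rw [h]
    have hm : Measurable fun y : Fin m → ℝ => ∏ i : Fin m, f i.succ (y i) :=
      Finset.measurable_prod _ fun i _ => (hf i.succ).comp (measurable_pi_apply i)
    rw [Fin.prod_univ_succ, Measure.volume_eq_prod,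
      lintegral_prod_mul (hf 0).aemeasurable hm.aemeasurable,
      ih _ fun i => hf i.succ]

/-- The product of `m` Gamma laws of shape `α` and rate `1`. -/
noncomputable def gammaProd (m : ℕ) (α : ℝ) : Measure (Fin m → ℝ) :=
  volume.withDensity fun g => ∏ j, gammaPDF α 1 (g j)

lemma measurable_gammaPDF (α : ℝ) : Measurable (gammaPDF α 1) :=
  (measurable_gammaPDFReal α 1).ennreal_ofReal

lemma measurable_prod_gammaPDF (m : ℕ) (α : ℝ) :
    Measurable fun g : Fin m → ℝ => ∏ j, gammaPDF α 1 (g j) :=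
  Finset.measurable_prod _ fun j _ => (measurable_gammaPDF α).comp (measurable_pi_apply j)

lemma lintegral_prod_gammaProd {m : ℕ} {α : ℝ} (f : Fin m → ℝ → ℝ≥0∞)
    (hf : ∀ i, Measurable (f i)) :
    ∫⁻ g, ∏ i, f i (g i) ∂(gammaProd m α) = ∏ i, ∫⁻ x, gammaPDF α 1 x * f i x := by
  have hm : Measurable fun g : Fin m → ℝ => ∏ i, f i (g i) :=
    Finset.measurable_prod _ fun i _ => (hf i).comp (measurable_pi_apply i)
  rw [gammaProd, lintegral_withDensity_eq_lintegral_mul _ (measurable_prod_gammaPDF m α) hm,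
    ← lintegral_prod_apply (fun i x => gammaPDF α 1 x * f i x)
      fun i => (measurable_gammaPDF α).mul (hf i)]
  simp [Finset.prod_mul_distrib]

lemma isProbabilityMeasure_gammaProd (m : ℕ) {α : ℝ} (hα : 0 < α) :
    IsProbabilityMeasure (gammaProd m α) := by
  constructor
  have := lintegral_prod_gammaProd (m := m) (α := α) (fun _ _ => 1) fun _ => measurable_const
  simpa [lintegral_gammaPDF_eq_one hα one_pos] using this

lemma gammaProd_ae_nonneg (m : ℕ) (α : ℝ) : ∀ᵐ g ∂(gammaProd m α), ∀ j, 0 ≤ g j := by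
  rw [gammaProd, ae_withDensity_iff (measurable_prod_gammaPDF m α)]
  refine ae_of_all _ fun g hg j => ?_
  by_contra hj
  exact hg (Finset.prod_eq_zero (Finset.mem_univ j) (gammaPDF_of_neg (not_le.1 hj)))

lemma lintegral_exp_mul_gammaPDF {α : ℝ} (hα : 0 < α) {l : ℝ} (hl : l < 1) :
    ∫⁻ x, gammaPDF α 1 x * ENNReal.ofReal (Real.exp (l * x)) =
      ENNReal.ofReal ((1 - l) ^ (-α)) := by
  have hl' : 0 < 1 - l := by linarith
  have hm : Measurable (gammaPDF α (1 - l)) := (measurable_gammaPDFReal α (1 - l)).ennreal_ofReal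
  rw [← mul_one (ENNReal.ofReal ((1 - l) ^ (-α))), ← lintegral_gammaPDF_eq_one hα hl',
    ← lintegral_const_mul _ hm]
  refine lintegral_congr fun x => ?_
  rcases lt_or_ge x 0 with hx | hx
  · rw [gammaPDF_of_neg hx, gammaPDF_of_neg hx, zero_mul, mul_zero]
  · rw [gammaPDF_of_nonneg hx, gammaPDF_of_nonneg hx, ← ENNReal.ofReal_mul', ← ENNReal.ofReal_mul]
    · congr 1
      have h1 : (1 - l) ^ (-α) * (1 - l) ^ α = 1 := by
        rw [← Real.rpow_add hl']; simp
      have h2 : Real.exp (-((1 - l) * x)) = Real.exp (-(1 * x)) * Real.exp (l * x) := by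
        rw [← Real.exp_add]; ring_nf
      rw [h2, Real.one_rpow]
      linear_combination (-(x ^ (α - 1) * Real.exp (-(1 * x)) * Real.exp (l * x) / Real.Gamma α)) * h1
    · positivity
    · positivity

/-- The sum of the entries with index less than `k`. -/
noncomputable def psum {m : ℕ} (g : Fin m → ℝ) (k : ℕ) : ℝ :=
  ∑ j : Fin m, if (j : ℕ) < k then g j else 0

lemma psum_zero {m : ℕ} (g : Fin m → ℝ) : psum g 0 = 0 := by simp [psum]

lemma psum_succ {m : ℕ} (g : Fin m → ℝ) (j : Fin m) : psum g (j + 1) = psum g j + g j := by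
  have : ∀ i : Fin m, (if (i : ℕ) < j + 1 then g i else 0) =
      (if (i : ℕ) < j then g i else 0) + if i = j then g i else 0 := by
    intro i
    rcases lt_trichotomy i j with h | h | h
    · have h' : (i : ℕ) < j := h
      simp [h', h.ne, Nat.lt_succ_of_lt h']
    · subst h; simp
    · have h' : (j : ℕ) < i := h
      simp [h'.not_gt, h.ne', show ¬ (i : ℕ) < j + 1 by omega]
  simp only [psum, this, Finset.sum_add_distrib]
  simp

lemma measurable_psum {m : ℕ} (k : ℕ) : Measurable fun g : Fin m → ℝ => psum g k := by
  unfold psum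
  refine Finset.measurable_sum _ fun j _ => ?_
  split_ifs <;> fun_prop

lemma lintegral_comp_cumulative {m : ℕ} {K : (Fin m → ℝ) → ℝ≥0∞} (hK : Measurable K) :
    ∫⁻ g : Fin m → ℝ, K (fun i => psum g (i + 1)) = ∫⁻ s, K s := by
  set M : Matrix (Fin m) (Fin m) ℝ := Matrix.of fun i j => if (j : ℕ) < i + 1 then 1 else 0 with hM
  have hlow : M.IsLowerTriangular := by
    intro i j hij
    have : i < j := hij
    simp [hM, this]
  have hdet : M.det = 1 := by
    rw [Matrix.det_of_isLowerTriangular _ hlow]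
    simp [hM]
  have hmap := Real.map_matrix_volume_pi_eq_smul_volume_pi (M := M) (by rw [hdet]; exact one_ne_zero)
  have hfun : ∀ g : Fin m → ℝ, Matrix.toLin' M g = fun i : Fin m => psum g (i + 1) := by
    intro g; ext i
    simp [hM, Matrix.mulVec, dotProduct, psum]
  rw [hdet] at hmap
  simp only [inv_one, abs_one, ENNReal.ofReal_one, one_smul] at hmap
  conv_rhs => rw [← hmap]
  rw [lintegral_map hK (LinearMap.continuous_on_pi _).measurable]
  simp_rw [hfun]

lemma lintegral_comp_smul_pi {n : ℕ} {r : ℝ} (hr : 0 < r) {G : (Fin n → ℝ) → ℝ≥0∞}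
    (hG : Measurable G) :
    ∫⁻ y, G y = ENNReal.ofReal (r ^ n) * ∫⁻ x, G (r • x) := by
  have h := Measure.map_addHaar_smul (volume : Measure (Fin n → ℝ)) hr.ne'
  rw [← lintegral_map (f := G) (g := fun x => r • x) hG (by fun_prop), h, lintegral_smul_measure,
    smul_eq_mul, ← mul_assoc, ← ENNReal.ofReal_mul (by positivity)]
  simp only [Module.finrank_fintype_fun_eq_card, Fintype.card_fin]
  rw [abs_of_pos (by positivity), mul_inv_cancel₀ (by positivity)]
  simp

/-- Entry number `k` of a list of partial sums, with the convention that entry `0` is `0`. -/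
noncomputable def partialEntry {m : ℕ} (s : Fin m → ℝ) (k : ℕ) : ℝ :=
  if k = 0 then 0 else if h : k - 1 < m then s ⟨k - 1, h⟩ else 0

lemma measurable_partialEntry {m : ℕ} (k : ℕ) :
    Measurable fun s : Fin m → ℝ => partialEntry s k := by
  unfold partialEntry
  split_ifs <;> fun_prop

lemma partialEntry_psum {m : ℕ} (g : Fin m → ℝ) {k : ℕ} (hk : k ≤ m) :
    partialEntry (fun i : Fin m => psum g (i + 1)) k = psum g k := by
  rcases Nat.eq_zero_or_pos k with rfl | h
  · simp [partialEntry, psum_zero]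
  · simp [partialEntry, h.ne', show k - 1 < m by omega, Nat.sub_add_cancel h]

lemma partialEntry_insertNth {n : ℕ} {r S : ℝ} (hS : r * ((n + 1 : ℕ) : ℝ) = S) (x : Fin n → ℝ) {k : ℕ}
    (hk : k ≤ n + 1) :
    partialEntry (Fin.insertNth (α := fun _ => ℝ) (Fin.last n) S (r • x) : Fin (n + 1) → ℝ) k =
      r * pos (n + 1) x k := by
  rcases Nat.eq_zero_or_pos k with rfl | h
  · simp [partialEntry]
  · rcases hk.eq_or_lt with rfl | hk
    · rw [pos_of_le le_rfl (by omega), hS, partialEntry, if_neg (by omega), dif_pos (by omega)]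
      exact Fin.insertNth_apply_same (α := fun _ => ℝ) (Fin.last n) S (r • x)
    · rw [pos_eq_coord (N := n + 1) (by omega) hk, partialEntry, if_neg (by omega), dif_pos (by omega),
        Fin.insertNth_last']
      have : (⟨k - 1, by omega⟩ : Fin (n + 1)) = Fin.castSucc (⟨k - 1, by omega⟩ : Fin n) := rfl
      rw [this, Fin.snoc_castSucc]
      simp

/-- The configuration whose gaps are proportional to `g`. -/
noncomputable def gammaConfig (n : ℕ) (g : Fin (n + 1) → ℝ) : Fin (n + 1 - 1) → ℝ :=
  fun i => ((n + 1 : ℕ) : ℝ) * psum g (i + 1) / psum g (n + 1)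

lemma measurable_gammaConfig (n : ℕ) : Measurable (gammaConfig n) := by
  refine measurable_pi_lambda _ fun i => ?_
  exact ((measurable_psum _).const_mul _).div (measurable_psum _)

lemma prod_gammaPDF_smul {n : ℕ} {α : ℝ} (hα : 0 < α) {r : ℝ} (hr : 0 < r) (x : Fin n → ℝ) :
    ∏ k ∈ Finset.range (n + 1), gammaPDF α 1 (r * pos (n + 1) x (k + 1) - r * pos (n + 1) x k) =
      ENNReal.ofReal ((Real.Gamma α)⁻¹ ^ (n + 1) * r ^ (((n + 1 : ℕ) : ℝ) * (α - 1)) *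
        Real.exp (-(r * (n + 1 : ℕ)))) *
      (stateSpace (n + 1)).indicator (fun x : Fin (n + 1 - 1) → ℝ => ENNReal.ofReal
        (∏ k ∈ Finset.range (n + 1), (pos (n + 1) x (k + 1) - pos (n + 1) x k) ^ (α - 1))) x := by
  by_cases hx : x ∈ stateSpace (n + 1)
  · have hΓ := Real.Gamma_pos_of_pos hα
    have hnn : ∀ k ∈ Finset.range (n + 1), 0 ≤ pos (n + 1) x (k + 1) - pos (n + 1) x k :=
      fun k hk => sub_nonneg.2 (hx k (Finset.mem_range.1 hk))
    have h1 : ∀ k ∈ Finset.range (n + 1),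
        gammaPDF α 1 (r * pos (n + 1) x (k + 1) - r * pos (n + 1) x k) =
        ENNReal.ofReal ((Real.Gamma α)⁻¹ * r ^ (α - 1) *
          Real.exp (-(r * pos (n + 1) x (k + 1) - r * pos (n + 1) x k)) *
          (pos (n + 1) x (k + 1) - pos (n + 1) x k) ^ (α - 1)) := by
      intro k hk
      rw [← mul_sub, gammaPDF_of_nonneg (mul_nonneg hr.le (hnn k hk)),
        Real.mul_rpow hr.le (hnn k hk), Real.one_rpow]
      congr 1
      ring_nf
    rw [Set.indicator_of_mem hx, Finset.prod_congr rfl h1,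
      ← ENNReal.ofReal_prod_of_nonneg, ← ENNReal.ofReal_mul (by positivity)]
    · congr 1
      simp only [Finset.prod_mul_distrib, Finset.prod_const, Finset.card_range]
      rw [← Real.exp_sum, Finset.sum_neg_distrib,
        Finset.sum_range_sub (fun k => r * pos (n + 1) x k), pos_zero,
        pos_of_le (N := n + 1) le_rfl (by omega), mul_comm (((n + 1 : ℕ) : ℝ)) (α - 1),
        Real.rpow_mul hr.le, Real.rpow_natCast]
      ring_nf
    · intro k hk
      have := Real.rpow_nonneg (hnn k hk) (α - 1)
      positivity
  · rw [Set.indicator_of_notMem hx, mul_zero]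
    obtain ⟨k, hk, hlt⟩ : ∃ k, k < n + 1 ∧ pos (n + 1) x (k + 1) < pos (n + 1) x k := by
      by_contra! h
      exact hx h
    refine Finset.prod_eq_zero (Finset.mem_range.2 hk) (gammaPDF_of_neg ?_)
    nlinarith

/-- The equilibrium measure is the law of the normalised partial sums of independent Gamma
variables. -/
lemma lintegral_gammaConfig {n : ℕ} {α : ℝ} (hα : 0 < α) {f : (Fin (n + 1 - 1) → ℝ) → ℝ≥0∞}
    (hf : Measurable f) :
    ∫⁻ g, f (gammaConfig n g) ∂(gammaProd (n + 1) α) = ∫⁻ x, f x ∂(equilibrium (n + 1) α) := by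
  set N : ℝ := ((n + 1 : ℕ) : ℝ) with hN
  have hNpos : 0 < N := by positivity
  have hΓ := Real.Gamma_pos_of_pos hα
  have hΓN := Real.Gamma_pos_of_pos (mul_pos hNpos hα)
  set C := Real.Gamma (N * α) / (Real.Gamma α ^ (n + 1) * N ^ (N * α - 1)) with hC
  set D : (Fin (n + 1 - 1) → ℝ) → ℝ≥0∞ :=
    (stateSpace (n + 1)).indicator (fun x : Fin (n + 1 - 1) → ℝ => ENNReal.ofReal
        (∏ k ∈ Finset.range (n + 1), (pos (n + 1) x (k + 1) - pos (n + 1) x k) ^ (α - 1))) with hD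
  have hDm : Measurable D := by
    have h := fun k => measurable_pos (N := n + 1) k
    exact Measurable.indicator (Finset.measurable_prod _ fun k _ =>
      ((h (k + 1)).sub (h k)).pow_const _).ennreal_ofReal isClosed_stateSpace.measurableSet
  have hDf : Measurable fun x => D x * f x := hDm.mul hf
  have hrhs : ∫⁻ x, f x ∂(equilibrium (n + 1) α) = ENNReal.ofReal C * ∫⁻ x, D x * f x := by
    rw [lintegral_equilibrium hf, ← lintegral_const_mul _ hDf]
    refine lintegral_congr fun x => ?_
    by_cases hx : x ∈ stateSpace (n + 1)
    · rw [hD, Set.indicator_of_mem hx, Set.indicator_of_mem hx, ← mul_assoc,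
        ← ENNReal.ofReal_mul (by positivity)]
      rfl
    · rw [hD, Set.indicator_of_notMem hx, Set.indicator_of_notMem hx]; simp
  set K : (Fin (n + 1) → ℝ) → ℝ≥0∞ := fun s =>
    (∏ k ∈ Finset.range (n + 1), gammaPDF α 1 (partialEntry s (k + 1) - partialEntry s k)) *
      f (fun i : Fin (n + 1 - 1) => N * partialEntry s (i + 1) / partialEntry s (n + 1)) with hK
  have hKm : Measurable K := by
    have h := fun k => measurable_partialEntry (m := n + 1) k
    refine (Finset.measurable_prod _ fun k _ => (measurable_gammaPDF α).comp
      ((h (k + 1)).sub (h k))).mul (hf.comp (measurable_pi_lambda _ fun i => ?_))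
    exact ((h _).const_mul _).div (h _)
  have hlhs : ∫⁻ g, f (gammaConfig n g) ∂(gammaProd (n + 1) α) = ∫⁻ s, K s := by
    have hm : Measurable fun g => f (gammaConfig n g) := hf.comp (measurable_gammaConfig n)
    rw [gammaProd, lintegral_withDensity_eq_lintegral_mul _ (measurable_prod_gammaPDF _ α) hm, ← lintegral_comp_cumulative hKm]
    refine lintegral_congr fun g => ?_
    simp only [Pi.mul_apply, hK]
    congr 1
    · rw [← Fin.prod_univ_eq_prod_range (fun k => gammaPDF α 1
        (partialEntry (fun i : Fin (n + 1) => psum g (i + 1)) (k + 1) -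
          partialEntry (fun i : Fin (n + 1) => psum g (i + 1)) k))]
      refine Finset.prod_congr rfl fun j _ => ?_
      have := j.2
      rw [partialEntry_psum g (by omega), partialEntry_psum g (by omega), psum_succ]
      simp
    · congr 1
      ext i
      have := i.2
      rw [partialEntry_psum g le_rfl, partialEntry_psum g (by omega)]
      rfl
  have hinner : ∀ᵐ S : ℝ, ∫⁻ y : Fin n → ℝ, K (Fin.insertNth (α := fun _ => ℝ) (Fin.last n) S y) =
      gammaPDF (N * α) 1 S * (ENNReal.ofReal C * ∫⁻ x, D x * f x) := by
    have h0 : ∀ᵐ S : ℝ, S ≠ 0 := by simp [ae_iff]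
    filter_upwards [h0] with S hS0
    rcases lt_or_gt_of_ne hS0 with hS | hS
    · rw [gammaPDF_of_neg hS, zero_mul, lintegral_eq_zero_of_ae_eq_zero]
      refine ae_of_all _ fun y => ?_
      simp only [hK, Pi.zero_apply, mul_eq_zero]
      left
      set s : Fin (n + 1) → ℝ := Fin.insertNth (α := fun _ => ℝ) (Fin.last n) S y with hs
      by_contra hne
      rw [Finset.prod_eq_zero_iff] at hne
      push Not at hne
      have hsum : ∑ k ∈ Finset.range (n + 1), (partialEntry s (k + 1) - partialEntry s k) = S := by
        rw [Finset.sum_range_sub]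
        simp only [partialEntry, Nat.add_sub_cancel]
        have : s (Fin.last n) = S :=
          Fin.insertNth_apply_same (α := fun _ => ℝ) (Fin.last n) S y
        simpa [Fin.last] using this
      have : 0 ≤ S := by
        rw [← hsum]
        refine Finset.sum_nonneg fun k hk => ?_
        by_contra hlt
        exact hne k hk (gammaPDF_of_neg (not_le.1 hlt))
      linarith
    · set r := S / N with hr
      have hrpos : 0 < r := div_pos hS hNpos
      have hrS : r * N = S := by rw [hr]; field_simp
      have hins : Measurable fun y : Fin n → ℝ =>
          (Fin.insertNth (α := fun _ => ℝ) (Fin.last n) S y : Fin (n + 1) → ℝ) :=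
        ((MeasurableEquiv.piFinSuccAbove (fun _ : Fin (n + 1) => ℝ) (Fin.last n)).symm.measurable).comp
          (measurable_const.prodMk measurable_id)
      have hcomp : Measurable fun y : Fin n → ℝ =>
          K (Fin.insertNth (α := fun _ => ℝ) (Fin.last n) S y) := hKm.comp hins
      rw [lintegral_comp_smul_pi hrpos hcomp]
      have hpt : ∀ x : Fin n → ℝ, K (Fin.insertNth (α := fun _ => ℝ) (Fin.last n) S (r • x)) =
          ENNReal.ofReal ((Real.Gamma α)⁻¹ ^ (n + 1) * r ^ (N * (α - 1)) * Real.exp (-S)) *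
            (D x * f x) := by
        intro x
        have hent := fun k (hk : k ≤ n + 1) => partialEntry_insertNth hrS x hk
        simp only [hK]
        rw [Finset.prod_congr rfl fun k hk => by
          have := Finset.mem_range.1 hk
          rw [hent (k + 1) (by omega), hent k (by omega)], prod_gammaPDF_smul hα hrpos, ← hN, hrS,
          mul_assoc]
        congr 3
        ext i
        have := i.2
        rw [hent _ (by omega), hent _ le_rfl, pos_of_le (N := n + 1) le_rfl (by omega), pos_succ, ← hN]
        field_simp
      simp_rw [hpt]
      have hconst : ∀ c : ℝ≥0∞, ∫⁻ x : Fin n → ℝ, c * (D x * f x) =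
          c * ∫⁻ x : Fin (n + 1 - 1) → ℝ, D x * f x := fun c => lintegral_const_mul c hDf
      rw [hconst, ← mul_assoc, ← mul_assoc,
        ← ENNReal.ofReal_mul (by positivity), gammaPDF_of_nonneg hS.le,
        ← ENNReal.ofReal_mul (by positivity)]
      congr 2
      have e1 : r ^ n * r ^ (N * (α - 1)) = r ^ (N * α - 1) := by
        rw [← Real.rpow_natCast, ← Real.rpow_add hrpos]
        congr 1
        rw [hN]; push_cast; ring
      rw [hC, Real.one_rpow, one_mul]
      calc _ = (Real.Gamma α)⁻¹ ^ (n + 1) * (r ^ n * r ^ (N * (α - 1))) * Real.exp (-S) := by ring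
        _ = _ := by
          rw [e1, hr, Real.div_rpow hS.le hNpos.le, inv_pow]
          field_simp
  have hKe : Measurable fun p => K
      ((MeasurableEquiv.piFinSuccAbove (fun _ : Fin (n + 1) => ℝ) (Fin.last n)).symm p) :=
    hKm.comp (MeasurableEquiv.measurable _)
  rw [hlhs, hrhs, ← ((volume_preserving_piFinSuccAbove (fun _ : Fin (n + 1) => ℝ)
    (Fin.last n)).symm).lintegral_comp hKm, Measure.volume_eq_prod,
    lintegral_prod _ hKe.aemeasurable]
  refine (lintegral_congr_ae hinner).trans ?_
  rw [lintegral_mul_const _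
    (measurable_gammaPDF _),
    lintegral_gammaPDF_eq_one (mul_pos hNpos hα) one_pos, one_mul]

lemma map_gammaConfig (n : ℕ) {α : ℝ} (hα : 0 < α) :
    (gammaProd (n + 1) α).map (gammaConfig n) = equilibrium (n + 1) α := by
  refine Measure.ext_of_lintegral _ fun f hf => ?_
  rw [lintegral_map hf (measurable_gammaConfig n), lintegral_gammaConfig hα hf]

lemma isProbabilityMeasure_equilibrium {N : ℕ} (hN : 1 ≤ N) {α : ℝ} (hα : 0 < α) :
    IsProbabilityMeasure (equilibrium N α) := by
  obtain ⟨n, rfl⟩ : ∃ n, N = n + 1 := ⟨N - 1, by omega⟩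
  rw [← map_gammaConfig n hα]
  have := isProbabilityMeasure_gammaProd (n + 1) hα
  exact Measure.isProbabilityMeasure_map (measurable_gammaConfig n).aemeasurable

end Gamma

section Stationarity

open scoped ENNReal

variable {N : ℕ} {α : ℝ} {i : Fin (N - 1)} {U : Finset (Fin (N - 1))}
  {f g : (Fin (N - 1) → ℝ) → ℝ}

lemma measurable_resample (i : Fin (N - 1)) :
    Measurable fun p : (Fin (N - 1) → ℝ) × ℝ => resample N i p.2 p.1 :=
  (resample_continuous i).measurable

/-- The pair of configurations before and after an update is exchangeable in equilibrium. -/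
lemma map_swap_resample_pair (hα : 0 < α) (hN : 1 ≤ N) (i : Fin (N - 1)) :
    (((equilibrium N α).prod (betaMeasure α α)).map fun p => (p.1, resample N i p.2 p.1)).map
      Prod.swap =
    ((equilibrium N α).prod (betaMeasure α α)).map fun p => (p.1, resample N i p.2 p.1) := by
  have := isProbabilityMeasureBeta hα hα
  have := isProbabilityMeasure_equilibrium hN hα
  have hT : Measurable fun p : (Fin (N - 1) → ℝ) × ℝ => (p.1, resample N i p.2 p.1) :=
    measurable_fst.prodMk (measurable_resample i)
  rw [Measure.map_map measurable_swap hT]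
  refine Measure.ext_of_lintegral _ fun F hF => ?_
  rw [lintegral_map hF (measurable_swap.comp hT), lintegral_map hF hT]
  refine (lintegral_prod _ (hF.comp (measurable_swap.comp hT)).aemeasurable).trans
    (Eq.trans ?_ (lintegral_prod _ (hF.comp hT).aemeasurable).symm)
  exact (lintegral_resample_symm hα i (F := fun x x' => F (x, x')) hF).symm

lemma updateLaw_equilibrium (hα : 0 < α) (hN : 1 ≤ N) (i : Fin (N - 1)) :
    updateLaw N α i (equilibrium N α) = equilibrium N α := by
  have := isProbabilityMeasureBeta hα hα
  have := isProbabilityMeasure_equilibrium hN hα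
  have hT : Measurable fun p : (Fin (N - 1) → ℝ) × ℝ => (p.1, resample N i p.2 p.1) :=
    measurable_fst.prodMk (measurable_resample i)
  have h := congrArg (Measure.map Prod.fst) (map_swap_resample_pair hα hN i)
  rw [Measure.map_map measurable_fst measurable_swap,
    Measure.map_map (measurable_fst.comp measurable_swap) hT, Measure.map_map measurable_fst hT] at h
  refine h.trans ?_
  exact Measure.map_fst_prod.trans (by simp)

lemma integrable_equilibrium_of_continuous (hα : 0 < α) (hN : 1 ≤ N) (hf : Continuous f) :
    Integrable f (equilibrium N α) := by
  have := isProbabilityMeasure_equilibrium hN hα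
  have h := hf.continuousOn.integrableOn_compact (μ := equilibrium N α)
    (isCompact_stateSpace (N := N))
  rwa [IntegrableOn, Measure.restrict_eq_self_of_ae_mem equilibrium_ae_mem] at h

lemma integrable_comp_resample_prod (hα : 0 < α) (hN : 1 ≤ N) (i : Fin (N - 1))
    (hf : Integrable f (equilibrium N α)) :
    Integrable (fun p : (Fin (N - 1) → ℝ) × ℝ => f (resample N i p.2 p.1))
      ((equilibrium N α).prod (betaMeasure α α)) := by
  rw [← updateLaw_equilibrium hα hN i] at hf
  exact hf.comp_measurable (measurable_resample i)

lemma ae_resample_mem (hα : 0 < α) (hN : 1 ≤ N) (i : Fin (N - 1)) :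
    ∀ᵐ p ∂((equilibrium N α).prod (betaMeasure α α)), resample N i p.2 p.1 ∈ stateSpace N := by
  have h := equilibrium_ae_mem (N := N) (α := α)
  rw [← updateLaw_equilibrium hα hN i] at h
  exact ae_of_ae_map (measurable_resample i).aemeasurable h

lemma integrable_updateFun (hα : 0 < α) (hN : 1 ≤ N) (i : Fin (N - 1))
    (hf : Integrable f (equilibrium N α)) : Integrable (updateFun N α i f) (equilibrium N α) := by
  have := isProbabilityMeasureBeta hα hα
  exact (integrable_comp_resample_prod hα hN i hf).integral_prod_left

lemma exists_bound_on_stateSpace (hg : Continuous g) :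
    ∃ C, ∀ x ∈ stateSpace N, ‖g x‖ ≤ C :=
  isCompact_stateSpace.exists_bound_of_continuousOn hg.continuousOn

/-- `Q_i` is symmetric in `L²(π)`. -/
lemma integral_mul_updateFun_comm (hα : 0 < α) (hN : 1 ≤ N) (i : Fin (N - 1))
    (hf : Integrable f (equilibrium N α)) (hg : Continuous g) :
    ∫ x, g x * updateFun N α i f x ∂(equilibrium N α) =
      ∫ x, f x * updateFun N α i g x ∂(equilibrium N α) := by
  have := isProbabilityMeasureBeta hα hα
  have := isProbabilityMeasure_equilibrium hN hα
  obtain ⟨C, hC⟩ := exists_bound_on_stateSpace hg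
  set ν := (equilibrium N α).prod (betaMeasure α α) with hν
  have hT : Measurable fun p : (Fin (N - 1) → ℝ) × ℝ => (p.1, resample N i p.2 p.1) :=
    measurable_fst.prodMk (measurable_resample i)
  have hfst : ν.map Prod.fst = equilibrium N α := Measure.map_fst_prod.trans (by simp)
  have hmem1 : ∀ᵐ p ∂ν, p.1 ∈ stateSpace N := by
    have h := equilibrium_ae_mem (N := N) (α := α)
    rw [← hfst] at h
    exact ae_of_ae_map measurable_fst.aemeasurable h
  have hmem2 : ∀ᵐ p ∂ν, resample N i p.2 p.1 ∈ stateSpace N := ae_resample_mem hα hN i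
  have hif1 : Integrable (fun p : (Fin (N - 1) → ℝ) × ℝ => f p.1) ν := by
    rw [← hfst] at hf; exact hf.comp_measurable measurable_fst
  have hif2 : Integrable (fun p : (Fin (N - 1) → ℝ) × ℝ => f (resample N i p.2 p.1)) ν :=
    integrable_comp_resample_prod hα hN i hf
  have hi1 : Integrable (fun p : (Fin (N - 1) → ℝ) × ℝ => g p.1 * f (resample N i p.2 p.1)) ν :=
    hif2.bdd_mul (c := C) (hg.comp continuous_fst).aestronglyMeasurable
      (hmem1.mono fun p hp => hC _ hp)
  have hi2 : Integrable (fun p : (Fin (N - 1) → ℝ) × ℝ => g (resample N i p.2 p.1) * f p.1) ν :=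
    hif1.bdd_mul (c := C) (hg.comp (resample_continuous i)).aestronglyMeasurable
      (hmem2.mono fun p hp => hC _ hp)
  have hfm : AEStronglyMeasurable (fun q : (Fin (N - 1) → ℝ) × (Fin (N - 1) → ℝ) => g q.1 * f q.2)
      (ν.map fun p => (p.1, resample N i p.2 p.1)) := by
    refine (hg.comp continuous_fst).aestronglyMeasurable.mul ?_
    have h2 : (ν.map fun p => (p.1, resample N i p.2 p.1)).map Prod.snd = equilibrium N α := by
      rw [Measure.map_map measurable_snd hT]
      exact updateLaw_equilibrium hα hN i
    have := hf.1
    rw [← h2] at this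
    exact this.comp_measurable measurable_snd
  have hfm' : AEStronglyMeasurable (fun q : (Fin (N - 1) → ℝ) × (Fin (N - 1) → ℝ) => g q.2 * f q.1)
      (ν.map fun p => (p.1, resample N i p.2 p.1)) := by
    rw [← map_swap_resample_pair hα hN i] at hfm
    exact hfm.comp_measurable measurable_swap
  have key : ∫ p, g p.1 * f (resample N i p.2 p.1) ∂ν = ∫ p, g (resample N i p.2 p.1) * f p.1 ∂ν := by
    rw [← integral_map (f := fun q : (Fin (N - 1) → ℝ) × (Fin (N - 1) → ℝ) => g q.1 * f q.2)
      hT.aemeasurable hfm, ← integral_map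
        (f := fun q : (Fin (N - 1) → ℝ) × (Fin (N - 1) → ℝ) => g q.2 * f q.1) hT.aemeasurable hfm',
      ← map_swap_resample_pair hα hN i]
    conv_lhs => rw [show (Prod.swap : (Fin (N - 1) → ℝ) × (Fin (N - 1) → ℝ) → _) =
      (MeasurableEquiv.prodComm : (Fin (N - 1) → ℝ) × (Fin (N - 1) → ℝ) ≃ᵐ _) from rfl]
    rw [integral_map_equiv]
    rw [map_swap_resample_pair hα hN i]
    rfl
  rw [integral_prod _ hi1, integral_prod _ hi2] at key
  simp_rw [integral_const_mul, integral_mul_const] at key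
  rw [show (∫ x, g x * updateFun N α i f x ∂(equilibrium N α)) =
    ∫ x, g x * ∫ u, f (resample N i u x) ∂(betaMeasure α α) ∂(equilibrium N α) from rfl, key]
  refine integral_congr_ae (ae_of_all _ fun x => ?_)
  simp only [updateFun]
  ring

lemma integrable_mul_of_continuous (hα : 0 < α) (hN : 1 ≤ N)
    (hf : Integrable f (equilibrium N α)) (hg : Continuous g) :
    Integrable (fun x => g x * f x) (equilibrium N α) := by
  have := isProbabilityMeasure_equilibrium hN hα
  obtain ⟨C, hC⟩ := exists_bound_on_stateSpace hg
  exact hf.bdd_mul (c := C) hg.aestronglyMeasurable (equilibrium_ae_mem.mono fun p hp => hC _ hp)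

lemma integral_mul_updateOp_comm (hα : 0 < α) (hN : 1 ≤ N)
    (hf : Integrable f (equilibrium N α)) (hg : Continuous g) :
    ∫ x, g x * updateOp N α U f x ∂(equilibrium N α) =
      ∫ x, f x * updateOp N α U g x ∂(equilibrium N α) := by
  simp only [updateOp, Finset.mul_sum]
  rw [integral_finsetSum, integral_finsetSum]
  · exact Finset.sum_congr rfl fun i _ => integral_mul_updateFun_comm hα hN i hf hg
  · intro i _
    have := integrable_mul_of_continuous hα hN hf (updateFun_continuous (i := i) hα hg)
    simpa only [mul_comm] using this
  · exact fun i _ => integrable_mul_of_continuous hα hN (integrable_updateFun hα hN i hf) hg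

lemma integral_mul_updateOp_iterate_comm (hα : 0 < α) (hN : 1 ≤ N)
    (hf : Continuous f) (hg : Continuous g) (n : ℕ) :
    ∫ x, g x * (updateOp N α U)^[n] f x ∂(equilibrium N α) =
      ∫ x, f x * (updateOp N α U)^[n] g x ∂(equilibrium N α) := by
  induction n generalizing f with
  | zero => simp [mul_comm]
  | succ n ih =>
    rw [Function.iterate_succ_apply, Function.iterate_succ_apply', ih (updateOp_continuous hα hf)]
    simp_rw [mul_comm (updateOp N α U f _)]
    exact integral_mul_updateOp_comm hα hN (integrable_equilibrium_of_continuous hα hN hf)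
      (updateOp_iterate_continuous hα hg n)

lemma updateOp_of_invariant (hα : 0 < α) (hg : ∀ i ∈ U, ∀ u x, g (resample N i u x) = g x) (c : ℝ) :
    updateOp N α U (fun x => c * g x) = fun x => U.card * c * g x := by
  have := isProbabilityMeasureBeta hα hα
  ext x
  have : ∀ i ∈ U, updateFun N α i (fun x => c * g x) x = c * g x := fun i hi => by
    simp [updateFun, hg i hi]
  rw [updateOp, Finset.sum_congr rfl this]
  simp [mul_assoc]

lemma updateOp_iterate_of_invariant (hα : 0 < α)
    (hg : ∀ i ∈ U, ∀ u x, g (resample N i u x) = g x) (n : ℕ) :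
    (updateOp N α U)^[n] g = fun x => (U.card : ℝ) ^ n * g x := by
  induction n with
  | zero => simp
  | succ n ih =>
    rw [Function.iterate_succ_apply', ih, updateOp_of_invariant hα hg]
    ext x; ring

lemma integral_updateOp_iterate (hα : 0 < α) (hN : 1 ≤ N) (hf : Continuous f) (n : ℕ) :
    ∫ x, (updateOp N α U)^[n] f x ∂(equilibrium N α) =
      (U.card : ℝ) ^ n * ∫ x, f x ∂(equilibrium N α) := by
  have h := integral_mul_updateOp_iterate_comm (U := U) hα hN hf (g := fun _ => 1) continuous_const n
  rw [updateOp_iterate_of_invariant hα (g := fun _ => 1) fun _ _ _ _ => rfl] at h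
  simpa [integral_const_mul, integral_mul_const, mul_comm] using h

end Stationarity

section Laws

variable {N : ℕ} {α : ℝ} {μ : Measure (Fin (N - 1) → ℝ)} {F : (Fin (N - 1) → ℝ) → ℝ}

lemma updateSum_univ (hα : 0 < α) [IsFiniteMeasure μ] :
    updateSum N α μ Set.univ = ((N - 1 : ℕ) : ENNReal) * μ Set.univ := by
  have := isProbabilityMeasureBeta hα hα
  have : ∀ i, updateLaw N α i μ Set.univ = μ Set.univ := fun i => by
    rw [updateLaw, Measure.map_apply (measurable_resample i) .univ, Set.preimage_univ,
      ← Set.univ_prod_univ, Measure.prod_prod]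
    simp
  simp [updateSum, this]

lemma isFiniteMeasure_updateSum (hα : 0 < α) [IsFiniteMeasure μ] :
    IsFiniteMeasure (updateSum N α μ) :=
  ⟨by rw [updateSum_univ hα]; exact ENNReal.mul_lt_top (ENNReal.natCast_lt_top _) (measure_lt_top _ _)⟩

lemma updateSum_iterate_univ (hα : 0 < α) [IsProbabilityMeasure μ] (n : ℕ) :
    (updateSum N α)^[n] μ Set.univ = ((N - 1 : ℕ) : ENNReal) ^ n := by
  have key : IsFiniteMeasure ((updateSum N α)^[n] μ) ∧
      (updateSum N α)^[n] μ Set.univ = ((N - 1 : ℕ) : ENNReal) ^ n := by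
    induction n with
    | zero => exact ⟨by rw [Function.iterate_zero, id]; infer_instance, by simp⟩
    | succ n ih =>
      have := ih.1
      rw [Function.iterate_succ_apply']
      exact ⟨isFiniteMeasure_updateSum hα, by rw [updateSum_univ hα, ih.2, pow_succ']⟩
  exact key.2

lemma isFiniteMeasure_updateSum_iterate (hα : 0 < α) [IsProbabilityMeasure μ] (n : ℕ) :
    IsFiniteMeasure ((updateSum N α)^[n] μ) :=
  ⟨by rw [updateSum_iterate_univ hα]; exact ENNReal.pow_lt_top (ENNReal.natCast_lt_top _)⟩

lemma abs_updateOp_le (hα : 0 < α) (U : Finset (Fin (N - 1))) {C : ℝ} (hF : ∀ x, |F x| ≤ C)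
    (x : Fin (N - 1) → ℝ) : |updateOp N α U F x| ≤ U.card * C := by
  have := isProbabilityMeasureBeta hα hα
  refine (Finset.abs_sum_le_sum_abs _ _).trans ?_
  rw [← nsmul_eq_mul]
  refine Finset.sum_le_card_nsmul _ _ _ fun i _ => ?_
  have := norm_integral_le_of_norm_le_const (μ := betaMeasure α α) (C := C)
    (f := fun u => F (resample N i u x)) (ae_of_all _ fun u => hF _)
  simpa [updateFun] using this

lemma integral_updateSum (hα : 0 < α) [IsFiniteMeasure μ] (hF : Continuous F) {C : ℝ}
    (hC : ∀ x, |F x| ≤ C) :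
    ∫ x, F x ∂(updateSum N α μ) = ∫ x, updateOp N α Finset.univ F x ∂μ := by
  have := isProbabilityMeasureBeta hα hα
  have hint : ∀ (ν : Measure (Fin (N - 1) → ℝ)) [IsFiniteMeasure ν], Integrable F ν := fun ν _ =>
    Integrable.of_bound hF.aestronglyMeasurable C (ae_of_all _ hC)
  have hfin : ∀ i, IsFiniteMeasure (updateLaw N α i μ) := fun i => by
    unfold updateLaw; infer_instance
  have hprod : ∀ i, Integrable (fun p : (Fin (N - 1) → ℝ) × ℝ => F (resample N i p.2 p.1))
      (μ.prod (betaMeasure α α)) := fun i =>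
    Integrable.of_bound (hF.comp (resample_continuous i)).aestronglyMeasurable C
      (ae_of_all _ fun p => hC _)
  have : ∀ i, ∫ x, F x ∂(updateLaw N α i μ) = ∫ x, updateFun N α i F x ∂μ := fun i => by
    rw [updateLaw, integral_map (measurable_resample i).aemeasurable hF.aestronglyMeasurable,
      integral_prod _ (hprod i)]
    rfl
  simp only [updateSum, updateOp]
  rw [integral_finsetSum_measure fun i _ => hint _, integral_finsetSum _ fun i _ => ?_]
  · simp_rw [this]
  · exact (hprod i).integral_prod_left

lemma integral_updateSum_iterate (hα : 0 < α) [IsProbabilityMeasure μ] (hF : Continuous F) {C : ℝ}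
    (hC : ∀ x, |F x| ≤ C) (n : ℕ) :
    ∫ x, F x ∂((updateSum N α)^[n] μ) = ∫ x, (updateOp N α Finset.univ)^[n] F x ∂μ := by
  induction n generalizing F C with
  | zero => simp
  | succ n ih =>
    have := isFiniteMeasure_updateSum_iterate (μ := μ) hα n
    rw [Function.iterate_succ_apply', Function.iterate_succ_apply, integral_updateSum hα hF hC]
    exact ih (updateOp_continuous hα hF) (abs_updateOp_le hα _ hC)

end Laws

section Barrier

variable {N : ℕ} {b : ℝ}

/-- A positive eigenfunction of the discrete Laplacian on `{0, …, N}`, with eigenvalue slightly below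
the spectral gap when `b` is slightly below `1`. -/
noncomputable def barrier (N : ℕ) (b : ℝ) (k : ℕ) : ℝ :=
  Real.cos (b * Real.pi / N * (k - N / 2))

lemma barrier_add (k : ℕ) :
    barrier N b k + barrier N b (k + 2) =
      2 * Real.cos (b * Real.pi / N) * barrier N b (k + 1) := by
  unfold barrier
  set t := b * Real.pi / N
  have h1 : t * ((k : ℝ) - N / 2) = t * (((k + 1 : ℕ) : ℝ) - N / 2) - t := by push_cast; ring
  have h2 : t * (((k + 2 : ℕ) : ℝ) - N / 2) = t * (((k + 1 : ℕ) : ℝ) - N / 2) + t := by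
    push_cast; ring
  rw [h1, h2, Real.cos_sub, Real.cos_add]
  ring

lemma barrier_le_one (k : ℕ) : barrier N b k ≤ 1 := Real.cos_le_one _

lemma le_barrier (hN : 1 ≤ N) (hb0 : 0 ≤ b) (hb1 : b ≤ 1) {k : ℕ} (hk : k ≤ N) :
    Real.cos (b * Real.pi / 2) ≤ barrier N b k := by
  have hN' : (0 : ℝ) < N := by exact_mod_cast hN
  have hk' : (k : ℝ) ≤ N := by exact_mod_cast hk
  have hπ := Real.pi_pos
  unfold barrier
  rw [← Real.cos_abs (b * Real.pi / N * _)]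
  refine Real.cos_le_cos_of_nonneg_of_le_pi (abs_nonneg _) ?_ ?_
  · nlinarith
  · rw [abs_mul, abs_of_nonneg (by positivity)]
    have : |(k : ℝ) - N / 2| ≤ N / 2 := by
      rw [abs_le]; constructor <;> linarith [k.cast_nonneg (α := ℝ)]
    calc b * Real.pi / N * |(k : ℝ) - N / 2| ≤ b * Real.pi / N * (N / 2) := by gcongr
      _ = b * Real.pi / 2 := by field_simp

lemma cos_half_pos (hb0 : 0 ≤ b) (hb1 : b < 1) : 0 < Real.cos (b * Real.pi / 2) := by
  have hπ := Real.pi_pos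
  refine Real.cos_pos_of_mem_Ioo ⟨?_, ?_⟩ <;> nlinarith

lemma cos_step_nonneg (hN : 2 ≤ N) (hb0 : 0 ≤ b) (hb1 : b ≤ 1) :
    0 ≤ Real.cos (b * Real.pi / N) := by
  have hπ := Real.pi_pos
  have hN' : (2 : ℝ) ≤ N := by exact_mod_cast hN
  refine Real.cos_nonneg_of_mem_Icc ⟨?_, ?_⟩
  · have : 0 ≤ b * Real.pi / N := by positivity
    linarith
  · rw [div_le_div_iff₀ (by linarith) two_pos]
    nlinarith

/-- Comparison of the eigenvalue of the barrier with that of the sine. -/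
lemma sq_mul_one_sub_cos_le (hN : 1 ≤ N) (hb0 : 0 ≤ b) (hb1 : b ≤ 1) :
    b ^ 2 * (1 - Real.cos (Real.pi / N)) ≤ 1 - Real.cos (b * Real.pi / N) := by
  have hN' : (1 : ℝ) ≤ N := by exact_mod_cast hN
  have hπ := Real.pi_pos
  set y := Real.pi / N / 2 with hy
  have hy0 : 0 ≤ y := by positivity
  have hyπ : y ≤ Real.pi := by
    have : Real.pi / N ≤ Real.pi := div_le_self hπ.le hN'
    linarith
  have h1 : 1 - Real.cos (Real.pi / N) = 2 * Real.sin y ^ 2 := by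
    rw [show Real.pi / N = 2 * y by rw [hy]; ring, Real.cos_two_mul, Real.cos_sq']; ring
  have h2 : 1 - Real.cos (b * Real.pi / N) = 2 * Real.sin (b * y) ^ 2 := by
    rw [show b * Real.pi / N = 2 * (b * y) by rw [hy]; ring, Real.cos_two_mul, Real.cos_sq']; ring
  have h3 : b * Real.sin y ≤ Real.sin (b * y) := by
    have := strictConcaveOn_sin_Icc.concaveOn.2 (x := y) (y := 0) ⟨hy0, hyπ⟩ ⟨le_rfl, hπ.le⟩
      hb0 (sub_nonneg.2 hb1) (by ring)
    simpa using this
  have h4 : 0 ≤ b * Real.sin y := mul_nonneg hb0 (Real.sin_nonneg_of_nonneg_of_le_pi hy0 hyπ)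
  rw [h1, h2]
  nlinarith [mul_self_le_mul_self h4 h3]

lemma one_sub_cos_pos (hN : 2 ≤ N) : 0 < 1 - Real.cos (Real.pi / N) := by
  have hπ := Real.pi_pos
  have hN' : (2 : ℝ) ≤ N := by exact_mod_cast hN
  have h0 : 0 < Real.pi / N := by positivity
  have h1 : Real.pi / N ≤ Real.pi := div_le_self hπ.le (by linarith)
  have := Real.cos_lt_cos_of_nonneg_of_le_pi le_rfl h1 h0
  rw [Real.cos_zero] at this
  linarith

end Barrier

section Modulus

variable {N : ℕ} {φ : ℕ → ℝ} {M : ℝ} {F : (Fin (N - 1) → ℝ) → ℝ} {U : Finset (Fin (N - 1))}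

lemma HasModulus.restrict (hφ : ∀ k ≤ N, 0 ≤ φ k) (h : HasModulus N φ Finset.univ M F)
    (U : Finset (Fin (N - 1))) : HasModulus N φ U M F := by
  classical
  obtain ⟨w, hw, hw0, hwN, -, hM, hmod⟩ := h
  refine ⟨fun k => if ∃ i ∉ U, k = (i : ℕ) + 1 then 0 else w k, fun k => ?_, ?_, fun k hk => ?_,
    fun i hi => ?_, le_trans (Finset.sum_le_sum fun i _ => ?_) hM, fun x x' hx => ?_⟩
  · beta_reduce
    split_ifs <;> [exact le_rfl; exact hw k]
  · beta_reduce
    rw [hw0, ite_self]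
  · beta_reduce
    rw [hwN k hk, ite_self]
  · beta_reduce
    rw [if_pos ⟨i, hi, rfl⟩]
  · have hi := i.2
    refine mul_le_mul_of_nonneg_left ?_ (hφ _ (by omega))
    beta_reduce
    split_ifs <;> [exact hw _; exact le_rfl]
  · refine (hmod x x' (by simp)).trans (Finset.sum_le_sum fun i _ => ?_)
    beta_reduce
    split_ifs with h
    · obtain ⟨j, hj, hij⟩ := h
      have : i = j := Fin.ext (by omega)
      rw [this, hx j hj]; simp
    · exact le_rfl

/-- A function that is Lipschitz in the coordinates of `S` has a modulus with weights on `S`. -/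
lemma hasModulus_of_abs_sub_le (S : Finset (Fin (N - 1))) {c : ℝ} (hc : 0 ≤ c)
    (hφ : ∀ k, φ k ≤ 1) (hF : ∀ x x', |F x - F x'| ≤ c * ∑ i ∈ S, |x i - x' i|) :
    HasModulus N φ Finset.univ (S.card * c) F := by
  classical
  have key : ∀ i : Fin (N - 1), (∃ j ∈ S, (i : ℕ) + 1 = (j : ℕ) + 1) ↔ i ∈ S := fun i => by
    constructor
    · rintro ⟨j, hj, hij⟩
      rwa [show i = j from Fin.ext (by omega)]
    · exact fun h => ⟨i, h, rfl⟩
  refine ⟨fun k => if ∃ j ∈ S, k = (j : ℕ) + 1 then c else 0, fun k => ?_, ?_, fun k hk => ?_,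
    by simp, ?_, fun x x' _ => ?_⟩
  · beta_reduce
    split_ifs <;> [exact hc; exact le_rfl]
  · beta_reduce
    rw [if_neg]
    rintro ⟨j, -, h⟩; omega
  · beta_reduce
    rw [if_neg]
    rintro ⟨j, -, h⟩; have := j.2; omega
  · simp only [key, mul_ite, mul_zero, Finset.sum_ite_mem, Finset.univ_inter]
    rw [← nsmul_eq_mul]
    refine Finset.sum_le_card_nsmul _ _ _ fun i _ => ?_
    exact mul_le_of_le_one_left hc (hφ _)
  · refine (hF x x').trans (le_of_eq ?_)
    simp only [key, ite_mul, zero_mul, Finset.sum_ite_mem, Finset.univ_inter, Finset.mul_sum]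

lemma LipschitzWith.hasModulus {L : NNReal} (hφ : ∀ k, φ k ≤ 1) (hF : LipschitzWith L F) :
    HasModulus N φ Finset.univ ((Finset.univ : Finset (Fin (N - 1))).card * L) F := by
  refine hasModulus_of_abs_sub_le _ L.2 hφ fun x x' => ?_
  have h1 := hF.dist_le_mul x x'
  rw [Real.dist_eq] at h1
  refine h1.trans (mul_le_mul_of_nonneg_left ?_ L.2)
  refine (dist_pi_le_iff (Finset.sum_nonneg fun i _ => abs_nonneg _)).2 fun i => ?_
  rw [Real.dist_eq]
  exact Finset.single_le_sum (f := fun i => |x i - x' i|) (fun i _ => abs_nonneg _)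
    (Finset.mem_univ i)

variable {α b : ℝ}

/-- The oscillation of the iterates of `∑_i Q_i` on the state space. -/
lemma HasModulus.abs_iterate_sub_le (hα : 0 < α) (hN : 2 ≤ N) (hb0 : 0 ≤ b) (hb1 : b < 1)
    (hU : U.Nonempty) (hF : Continuous F) (h : HasModulus N (barrier N b) U M F) (n : ℕ)
    {x x' : Fin (N - 1) → ℝ} (hx : x ∈ stateSpace N) (hx' : x' ∈ stateSpace N)
    (hxx' : ∀ i, i ∉ U → x i = x' i) :
    |(BetaResampling.updateOp N α U)^[n] F x - (BetaResampling.updateOp N α U)^[n] F x'| ≤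
      N / Real.cos (b * Real.pi / 2) * ((U.card - 1 + Real.cos (b * Real.pi / N)) ^ n * M) := by
  have hpos := cos_half_pos hb0 hb1
  have hle : ∀ k ≤ N, Real.cos (b * Real.pi / 2) ≤ barrier N b k :=
    fun k hk => le_barrier (by omega) hb0 hb1.le hk
  exact (h.updateOp_iterate hα (fun k hk => hpos.le.trans (hle k hk)) (cos_step_nonneg hN hb0 hb1.le)
    barrier_add hU hF n).abs_sub_le hpos hle hxx' (abs_sub_le_of_mem_stateSpace hx hx')
    (Nat.cast_nonneg _)

end Modulus

section Gap

variable {N : ℕ} {α b lam : ℝ} {f g : (Fin (N - 1) → ℝ) → ℝ}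

lemma updateOp_univ_ae_eq_of_eigen (hα : 0 < α) (hN : 1 ≤ N) (hf : Integrable f (equilibrium N α))
    (h : (fun x => -generator N α f x) =ᵐ[equilibrium N α] fun x => lam * f x) :
    updateOp N α Finset.univ f =ᵐ[equilibrium N α] fun x => ((N - 1 : ℕ) - lam) * f x := by
  have := isProbabilityMeasureBeta hα hα
  have := isProbabilityMeasure_equilibrium hN hα
  have hint : ∀ᵐ x ∂(equilibrium N α), ∀ i : Fin (N - 1),
      Integrable (fun u => f (resample N i u x)) (betaMeasure α α) :=
    ae_all_iff.2 fun i => (integrable_comp_resample_prod hα hN i hf).prod_right_ae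
  filter_upwards [h, hint] with x hx hi
  have h1 : ∀ i : Fin (N - 1), ∫ u, (f (resample N i u x) - f x) ∂(betaMeasure α α) =
      updateFun N α i f x - f x := fun i => by
    rw [integral_sub (hi i) (integrable_const _)]
    simp [updateFun]
  have h2 : generator N α f x = updateOp N α Finset.univ f x - (N - 1 : ℕ) * f x := by
    simp only [generator, h1, updateOp, Finset.sum_sub_distrib]
    simp
  rw [h2] at hx
  linarith

lemma integral_eigen_mul_iterate (hα : 0 < α) (hN : 1 ≤ N) (hf : Integrable f (equilibrium N α))
    {κ : ℝ} (h : updateOp N α Finset.univ f =ᵐ[equilibrium N α] fun x => κ * f x)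
    (hg : Continuous g) (n : ℕ) :
    ∫ x, f x * (updateOp N α Finset.univ)^[n] g x ∂(equilibrium N α) =
      κ ^ n * ∫ x, f x * g x ∂(equilibrium N α) := by
  induction n with
  | zero => simp
  | succ n ih =>
    rw [Function.iterate_succ_apply', ← integral_mul_updateOp_comm hα hN hf
      (updateOp_iterate_continuous hα hg n), pow_succ', mul_assoc, ← ih, ← integral_const_mul]
    refine integral_congr_ae ?_
    filter_upwards [h] with x hx
    rw [hx]; ring

/-- An eigenfunction with small eigenvalue is orthogonal to mean zero Lipschitz functions. -/
lemma integral_eigen_mul_eq_zero (hα : 0 < α) (hN : 2 ≤ N) (hb0 : 0 ≤ b) (hb1 : b < 1)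
    (hf : Integrable f (equilibrium N α)) {κ : ℝ}
    (h : updateOp N α Finset.univ f =ᵐ[equilibrium N α] fun x => κ * f x)
    (hκ : (N - 1 : ℕ) - 1 + Real.cos (b * Real.pi / N) < κ) {M : ℝ} (hg : Continuous g)
    (hM : HasModulus N (barrier N b) Finset.univ M g) (hg0 : ∫ x, g x ∂(equilibrium N α) = 0) :
    ∫ x, f x * g x ∂(equilibrium N α) = 0 := by
  have := isProbabilityMeasure_equilibrium (N := N) (by omega) hα
  set κ' := ((N - 1 : ℕ) : ℝ) - 1 + Real.cos (b * Real.pi / N) with hκ'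
  have hκ'0 : 0 ≤ κ' := by
    have h1 := cos_step_nonneg hN hb0 hb1.le
    have h2 : (1 : ℝ) ≤ ((N - 1 : ℕ) : ℝ) := by exact_mod_cast (by omega : 1 ≤ N - 1)
    linarith
  have hκ0 : 0 < κ := hκ'0.trans_lt hκ
  have hU : (Finset.univ : Finset (Fin (N - 1))).Nonempty := ⟨⟨0, by omega⟩, Finset.mem_univ _⟩
  set A := (N : ℝ) / Real.cos (b * Real.pi / 2)
  have hbound : ∀ n, ∀ x ∈ stateSpace N, |(updateOp N α Finset.univ)^[n] g x| ≤ A * (κ' ^ n * M) := by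
    intro n x hx
    have hc := updateOp_iterate_continuous (U := Finset.univ) hα hg n
    have hi := integrable_equilibrium_of_continuous hα (by omega) hc
    have h1 : ∫ y, (updateOp N α Finset.univ)^[n] g y ∂(equilibrium N α) = 0 := by
      rw [integral_updateOp_iterate hα (by omega) hg, hg0, mul_zero]
    have h2 : (updateOp N α Finset.univ)^[n] g x = ∫ y, ((updateOp N α Finset.univ)^[n] g x -
        (updateOp N α Finset.univ)^[n] g y) ∂(equilibrium N α) := by
      rw [integral_sub (integrable_const _) hi, h1]; simp
    rw [h2]
    have := norm_integral_le_of_norm_le_const (μ := equilibrium N α) (C := A * (κ' ^ n * M))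
      (f := fun y => (updateOp N α Finset.univ)^[n] g x - (updateOp N α Finset.univ)^[n] g y) (by
        filter_upwards [equilibrium_ae_mem] with y hy
        have := hM.abs_iterate_sub_le hα hN hb0 hb1 hU hg n hx hy (by simp)
        simpa [Finset.card_univ, Fintype.card_fin] using this)
    simpa using this
  set I := ∫ x, f x * g x ∂(equilibrium N α)
  have hI : ∀ n : ℕ, |I| ≤ (∫ x, |f x| ∂(equilibrium N α)) * A * M * (κ' / κ) ^ n := by
    intro n
    have h1 := integral_eigen_mul_iterate hα (by omega) hf h hg n
    have h2 : |κ ^ n * I| ≤ ∫ x, |f x| * (A * (κ' ^ n * M)) ∂(equilibrium N α) := by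
      rw [← h1]
      refine (abs_integral_le_integral_abs).trans (integral_mono_ae ?_ (hf.abs.mul_const _) ?_)
      · have := integrable_mul_of_continuous hα (by omega) hf
          (updateOp_iterate_continuous (U := Finset.univ) hα hg n)
        simpa only [mul_comm] using this.abs
      · filter_upwards [equilibrium_ae_mem] with x hx
        rw [abs_mul]
        exact mul_le_mul_of_nonneg_left (hbound n x hx) (abs_nonneg _)
    rw [integral_mul_const, abs_mul, abs_of_pos (pow_pos hκ0 n)] at h2
    rw [div_pow, mul_div_assoc', le_div_iff₀ (pow_pos hκ0 n)]
    linarith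
  have hlim : Tendsto (fun n : ℕ => (∫ x, |f x| ∂(equilibrium N α)) * A * M * (κ' / κ) ^ n) atTop
      (𝓝 0) := by
    have := (tendsto_pow_atTop_nhds_zero_of_lt_one (div_nonneg hκ'0 hκ0.le)
      ((div_lt_one hκ0).2 hκ)).const_mul ((∫ x, |f x| ∂(equilibrium N α)) * A * M)
    simpa using this
  exact abs_nonpos_iff.1 (ge_of_tendsto' hlim hI)

lemma HasModulus.sub_const {φ : ℕ → ℝ} {U : Finset (Fin (N - 1))} {M : ℝ}
    (h : HasModulus N φ U M g) (c : ℝ) : HasModulus N φ U M fun x => g x - c := by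
  obtain ⟨w, h1, h2, h3, h4, h5, h6⟩ := h
  exact ⟨w, h1, h2, h3, h4, h5, fun x x' hx => by simpa using h6 x x' hx⟩

lemma le_of_isNontrivialEigenvalue (hα : 0 < α) (hN : 2 ≤ N) (hb0 : 0 ≤ b) (hb1 : b < 1)
    (h : IsNontrivialEigenvalue N α lam) : 1 - Real.cos (b * Real.pi / N) ≤ lam := by
  have := isProbabilityMeasure_equilibrium (N := N) (by omega) hα
  obtain ⟨f, hf2, hnc, heig⟩ := h
  by_contra! hlam
  have hf : Integrable f (equilibrium N α) := hf2.integrable one_le_two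
  have hT := updateOp_univ_ae_eq_of_eigen hα (by omega) hf heig
  refine hnc ⟨∫ x, f x ∂(equilibrium N α), ?_⟩
  set c := ∫ x, f x ∂(equilibrium N α)
  have hloc : LocallyIntegrable (fun x => f x - c) (equilibrium N α) :=
    (hf.sub (integrable_const c)).locallyIntegrable
  have key := ae_eq_zero_of_integral_contDiff_smul_eq_zero hloc fun g hg hsupp => by
    obtain ⟨L, hL⟩ := ContDiff.lipschitzWith_of_hasCompactSupport hsupp hg (by simp)
    have hgi := integrable_equilibrium_of_continuous hα (by omega : 1 ≤ N) hg.continuous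
    have hfg := integrable_mul_of_continuous hα (by omega : 1 ≤ N) hf hg.continuous
    set d := ∫ x, g x ∂(equilibrium N α) with hd
    have h0 := integral_eigen_mul_eq_zero hα hN hb0 hb1 hf hT (by linarith)
      (g := fun x => g x - d) (hg.continuous.sub continuous_const)
      ((LipschitzWith.hasModulus barrier_le_one hL).sub_const d) (by
        rw [integral_sub hgi (integrable_const _)]; simp [hd])
    have h1 : ∫ x, f x * (g x - d) ∂(equilibrium N α) =
        ∫ x, g x * f x ∂(equilibrium N α) - c * d := by
      simp_rw [mul_sub, mul_comm (f _) (g _)]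
      rw [integral_sub hfg (hf.mul_const d), integral_mul_const]
    simp only [smul_eq_mul, mul_sub]
    rw [integral_sub hfg (hgi.mul_const c), integral_mul_const]
    linarith
  filter_upwards [key] with x hx
  linarith

/-- Configurations with strictly increasing positions are interior points of the support. -/
lemma equilibrium_pos_of_mem_open (hα : 0 < α) (hN : 1 ≤ N) {O : Set (Fin (N - 1) → ℝ)}
    (hO : IsOpen O) {x : Fin (N - 1) → ℝ} (hx : ∀ k < N, pos N x k < pos N x (k + 1))
    (hxO : x ∈ O) : equilibrium N α O ≠ 0 := by
  intro h0
  set S : Set (Fin (N - 1) → ℝ) := ⋂ k ∈ Finset.range N, {x | pos N x k < pos N x (k + 1)} with hS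
  have hSo : IsOpen S := isOpen_biInter_finset fun k _ =>
    isOpen_lt (pos_continuous k) (pos_continuous (k + 1))
  have hSmem : ∀ y, y ∈ S ↔ ∀ k < N, pos N y k < pos N y (k + 1) := fun y => by simp [hS]
  have h1 : equilibrium N α = (volume.restrict (stateSpace N)).withDensity (equilibriumDensity N α) :=
    rfl
  rw [h1, withDensity_apply_eq_zero measurable_equilibriumDensity,
    Measure.restrict_apply' isClosed_stateSpace.measurableSet] at h0
  have h2 : (O ∩ S) ⊆ ({y | equilibriumDensity N α y ≠ 0} ∩ O) ∩ stateSpace N := by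
    rintro y ⟨hyO, hyS⟩
    rw [hSmem] at hyS
    refine ⟨⟨?_, hyO⟩, fun k hk => (hyS k hk).le⟩
    have hN' : (0 : ℝ) < N := by exact_mod_cast hN
    have : 0 < Real.Gamma (N * α) / (Real.Gamma α ^ N * (N : ℝ) ^ (N * α - 1)) *
      ∏ k ∈ Finset.range N, (pos N y (k + 1) - pos N y k) ^ (α - 1) := by
      have h3 := Real.Gamma_pos_of_pos hα
      have h4 := Real.Gamma_pos_of_pos (mul_pos hN' hα)
      have h5 : 0 < ∏ k ∈ Finset.range N, (pos N y (k + 1) - pos N y k) ^ (α - 1) :=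
        Finset.prod_pos fun k hk => Real.rpow_pos_of_pos
          (sub_pos.2 (hyS k (Finset.mem_range.1 hk))) _
      positivity
    simpa [equilibriumDensity] using this
  exact ((hO.inter hSo).measure_pos volume ⟨x, hxO, (hSmem x).2 hx⟩).ne'
    (measure_mono_null h2 h0)

/-- The eigenfunction of the spectral gap. -/
noncomputable def sineFun (N : ℕ) (x : Fin (N - 1) → ℝ) : ℝ :=
  ∑ i : Fin (N - 1), Real.sin (Real.pi / N * (i + 1 : ℕ)) * (x i - (i + 1 : ℕ))

lemma continuous_sineFun : Continuous (sineFun N) := by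
  unfold sineFun; fun_prop

lemma sineFun_update (i : Fin (N - 1)) (x : Fin (N - 1) → ℝ) (z : ℝ) :
    sineFun N (Function.update x i z) - sineFun N x =
      Real.sin (Real.pi / N * (i + 1 : ℕ)) * (z - x i) := by
  unfold sineFun
  rw [← Finset.sum_sub_distrib, Finset.sum_eq_single i]
  · rw [Function.update_self]; ring
  · intro j _ hj
    rw [Function.update_of_ne hj]; ring
  · simp

lemma generator_sineFun (hα : 0 < α) (hN : 2 ≤ N) (x : Fin (N - 1) → ℝ) :
    -generator N α (sineFun N) x = (1 - Real.cos (Real.pi / N)) * sineFun N x := by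
  have hN' : (N : ℝ) ≠ 0 := by positivity
  have := isProbabilityMeasureBeta hα hα
  set a : ℕ → ℝ := fun k => Real.sin (Real.pi / N * k) with ha
  set d : ℕ → ℝ := fun k => pos N x k - k with hd
  have h1 : generator N α (sineFun N) x =
      ∑ i : Fin (N - 1), a (i + 1) * ((d i + d (i + 2)) / 2 - d (i + 1)) := by
    refine Finset.sum_congr rfl fun i _ => ?_
    simp_rw [resample, sineFun_update]
    rw [integral_const_mul, integral_sub (integrable_betaMeasure hα (by fun_prop))
      (integrable_const _), integral_affine_betaMeasure hα]
    simp only [ha, hd, pos_succ, integral_const, probReal_univ, one_smul]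
    push_cast
    ring
  have h2 := sum_mul_neighbors a d (N - 1)
  have e1 : N - 1 + 1 = N := by omega
  have ea0 : a 0 = 0 := by simp [ha]
  have eaN : a N = 0 := by simp only [ha]; rw [div_mul_cancel₀ _ hN', Real.sin_pi]
  have ed0 : d 0 = 0 := by simp [hd]
  have edN : d N = 0 := by simp [hd, pos_of_le (N := N) (k := N) le_rfl (by omega)]
  have eadd : ∀ k, a k + a (k + 2) = 2 * Real.cos (Real.pi / N) * a (k + 1) := by
    intro k
    simp only [ha]
    set t := Real.pi / N
    have h1 : t * (k : ℝ) = t * ((k + 1 : ℕ) : ℝ) - t := by push_cast; ring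
    have h2 : t * ((k + 2 : ℕ) : ℝ) = t * ((k + 1 : ℕ) : ℝ) + t := by push_cast; ring
    rw [h1, h2, Real.sin_sub, Real.sin_add]
    ring
  rw [e1, ea0, eaN, ed0, edN] at h2
  simp only [eadd] at h2
  rw [← Fin.sum_univ_eq_sum_range (fun j => a (j + 1) * (d j + d (j + 2))),
    ← Fin.sum_univ_eq_sum_range (fun j => d (j + 1) * (2 * Real.cos (Real.pi / N) * a (j + 1)))] at h2
  have h3 : sineFun N x = ∑ i : Fin (N - 1), a (i + 1) * d (i + 1) := by
    simp [sineFun, ha, hd]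
  have h4 : ∑ i : Fin (N - 1), a (i + 1) * ((d i + d (i + 2)) / 2 - d (i + 1)) =
      (∑ i : Fin (N - 1), a (i + 1) * (d i + d (i + 2))) / 2 -
        ∑ i : Fin (N - 1), a (i + 1) * d (i + 1) := by
    rw [Finset.sum_div, ← Finset.sum_sub_distrib]
    exact Finset.sum_congr rfl fun i _ => by ring
  have h5 : ∑ i : Fin (N - 1), d (i + 1) * (2 * Real.cos (Real.pi / N) * a (i + 1)) =
      2 * Real.cos (Real.pi / N) * ∑ i : Fin (N - 1), a (i + 1) * d (i + 1) := by
    rw [Finset.mul_sum]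
    exact Finset.sum_congr rfl fun i _ => by ring
  rw [h1, h4, h2, h5, h3]
  ring

lemma isNontrivialEigenvalue_one_sub_cos (hα : 0 < α) (hN : 2 ≤ N) :
    IsNontrivialEigenvalue N α (1 - Real.cos (Real.pi / N)) := by
  have := isProbabilityMeasure_equilibrium (N := N) (by omega) hα
  refine ⟨sineFun N, ?_, ?_, ae_of_all _ (generator_sineFun hα hN)⟩
  · obtain ⟨C, hC⟩ := exists_bound_on_stateSpace (continuous_sineFun (N := N))
    exact MemLp.of_bound continuous_sineFun.aestronglyMeasurable C
      (equilibrium_ae_mem.mono fun x hx => hC x hx)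
  · rintro ⟨c, hc⟩
    have hopen : IsOpen {x : Fin (N - 1) → ℝ | sineFun N x ≠ c} :=
      isOpen_ne_fun continuous_sineFun continuous_const
    have hnull : equilibrium N α {x | sineFun N x ≠ c} = 0 := hc
    set i0 : Fin (N - 1) := ⟨0, by omega⟩
    set x : Fin (N - 1) → ℝ := fun i => ((i + 1 : ℕ) : ℝ) with hx
    have hposx : ∀ k ≤ N, pos N x k = k := by
      intro k hk
      rcases Nat.eq_zero_or_pos k with rfl | h0
      · simp
      · rcases hk.eq_or_lt with rfl | hk
        · rw [pos_of_le le_rfl (by omega)]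
        · rw [pos_eq_coord (by omega) hk, hx]
          simp only [Nat.cast_inj]; omega
    set x' : Fin (N - 1) → ℝ := Function.update x i0 (1 / 2) with hx'
    have hstrict : ∀ k < N, pos N x k < pos N x (k + 1) := by
      intro k hk
      rw [hposx k (by omega), hposx (k + 1) (by omega)]
      push_cast; linarith
    have hstrict' : ∀ k < N, pos N x' k < pos N x' (k + 1) := by
      intro k hk
      rw [hx', pos_update, pos_update, hposx k (by omega), hposx (k + 1) (by omega)]
      have hi0 : (i0 : ℕ) = 0 := rfl
      rcases Nat.eq_zero_or_pos k with rfl | h0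
      · simp [hi0]
      · rw [if_neg (by omega : ¬ k + 1 = i0 + 1)]
        have : (1 : ℝ) ≤ k := by exact_mod_cast h0
        split_ifs <;> push_cast <;> linarith
    have h1 : sineFun N x = c := by
      by_contra h
      exact equilibrium_pos_of_mem_open hα (by omega) hopen hstrict h hnull
    have h2 : sineFun N x' = c := by
      by_contra h
      exact equilibrium_pos_of_mem_open hα (by omega) hopen hstrict' h hnull
    have h3 := sineFun_update i0 x (1 / 2)
    rw [← hx', h1, h2] at h3
    have hsin : 0 < Real.sin (Real.pi / N * ((i0 : ℕ) + 1 : ℕ)) := by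
      have hN' : (2 : ℝ) ≤ N := by exact_mod_cast hN
      have hπ := Real.pi_pos
      refine Real.sin_pos_of_pos_of_lt_pi (by positivity) ?_
      simp only [i0, zero_add, Nat.cast_one, mul_one]
      exact div_lt_self hπ (by linarith)
    have h4 : (1 / 2 : ℝ) - x i0 = -1 / 2 := by simp [hx, i0]; norm_num
    rw [h4] at h3
    linarith

lemma spectralGap_le (hα : 0 < α) (hN : 2 ≤ N) :
    spectralGap N α ≤ 1 - Real.cos (Real.pi / N) := by
  refine csInf_le ⟨1 - Real.cos ((1 / 2 : ℝ) * Real.pi / N), fun lam h => ?_⟩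
    (isNontrivialEigenvalue_one_sub_cos hα hN)
  exact le_of_isNontrivialEigenvalue hα hN (by norm_num) (by norm_num) h

lemma spectralGap_pos (hα : 0 < α) (hN : 2 ≤ N) : 0 < spectralGap N α := by
  have h1 : 1 - Real.cos ((1 / 2 : ℝ) * Real.pi / N) ≤ spectralGap N α :=
    le_csInf ⟨_, isNontrivialEigenvalue_one_sub_cos hα hN⟩ fun lam h =>
      le_of_isNontrivialEigenvalue hα hN (by norm_num) (by norm_num) h
  have h2 := sq_mul_one_sub_cos_le (N := N) (b := 1 / 2) (by omega) (by norm_num) (by norm_num)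
  have h3 := one_sub_cos_pos hN
  linarith

end Gap

section Special

variable {N K : ℕ} {x x' : Fin (N - 1) → ℝ}

/-- The coordinates of the special particles. -/
def specialSites (N K : ℕ) : Finset (Fin (N - 1)) :=
  Finset.univ.biUnion fun j : Fin (K - 1) =>
    Finset.univ.filter fun i : Fin (N - 1) => ((j : ℕ) + 1) * N / K = i + 1

lemma card_specialSites_le : (specialSites N K).card ≤ K - 1 := by
  refine (Finset.card_biUnion_le_card_mul _ _ 1 fun j _ => Finset.card_le_one.2 ?_).trans (by simp)
  intro i hi i' hi'
  simp only [Finset.mem_filter, Finset.mem_univ, true_and] at hi hi'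
  exact Fin.ext (by omega)

lemma dist_specialPositions_le :
    dist (specialPositions N K x) (specialPositions N K x') ≤ ∑ i ∈ specialSites N K, |x i - x' i| := by
  have hnn : 0 ≤ ∑ i ∈ specialSites N K, |x i - x' i| := Finset.sum_nonneg fun i _ => abs_nonneg _
  refine (dist_pi_le_iff hnn).2 fun j => ?_
  rw [Real.dist_eq]
  simp only [specialPositions]
  set u := ((j : ℕ) + 1) * N / K with hu
  rcases Nat.eq_zero_or_pos u with h0 | h0
  · simpa [h0] using hnn
  rcases lt_or_ge u N with hN | hN
  · rw [pos_eq_coord h0.ne' hN, pos_eq_coord h0.ne' hN]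
    refine Finset.single_le_sum (f := fun i => |x i - x' i|) (fun i _ => abs_nonneg _) ?_
    simp only [specialSites, Finset.mem_biUnion, Finset.mem_univ, Finset.mem_filter, true_and]
    exact ⟨j, by rw [← hu]; omega⟩
  · rw [pos_of_le hN h0.ne', pos_of_le hN h0.ne']
    simpa using hnn

lemma specialPositions_congr (h : ∀ i, i ∉ (specialSites N K)ᶜ → x i = x' i) :
    specialPositions N K x = specialPositions N K x' := by
  refine dist_le_zero.1 (dist_specialPositions_le.trans (le_of_eq ?_))
  refine Finset.sum_eq_zero fun i hi => ?_
  rw [h i (by simpa using hi)]; simp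

lemma specialPositions_resample {i : Fin (N - 1)} (hi : i ∈ (specialSites N K)ᶜ) (u : ℝ)
    (x : Fin (N - 1) → ℝ) :
    specialPositions N K (resample N i u x) = specialPositions N K x :=
  specialPositions_congr fun j hj => resample_apply_of_ne (fun h : j = i => hj (h.symm ▸ hi)) u

lemma continuous_specialPositions : Continuous (specialPositions N K) :=
  continuous_pi fun _ => pos_continuous _

lemma mem_specialSites_of_congr (hx : ∀ i ∈ specialSites N K, x i = x' i) :
    ∀ i, i ∉ (specialSites N K)ᶜ → x i = x' i := fun i hi => hx i (by simpa using hi)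

lemma coord_le_of_specialPositions_le
    (h : specialPositions N K x ≤ specialPositions N K x') {i : Fin (N - 1)}
    (hi : i ∈ specialSites N K) : x i ≤ x' i := by
  simp only [specialSites, Finset.mem_biUnion, Finset.mem_univ, Finset.mem_filter, true_and] at hi
  obtain ⟨j, hj⟩ := hi
  have := h j
  simp only [specialPositions] at this
  rwa [hj, pos_succ, pos_succ] at this

/-- The upward closure of the special positions of the configurations where `g ≥ 1`. -/
def upperLevelSet (N K : ℕ) (g : (Fin (N - 1) → ℝ) → ℝ) : Set (Fin (K - 1) → ℝ) :=
  {y | ∃ x ∈ stateSpace N, 1 ≤ g x ∧ specialPositions N K x ≤ y}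

lemma isUpperSet_upperLevelSet (g : (Fin (N - 1) → ℝ) → ℝ) : IsUpperSet (upperLevelSet N K g) :=
  fun _ _ h ⟨x, hx, hg, hxy⟩ => ⟨x, hx, hg, hxy.trans h⟩

lemma isClosed_upperLevelSet {g : (Fin (N - 1) → ℝ) → ℝ} (hg : Continuous g) :
    IsClosed (upperLevelSet N K g) := by
  have hc : IsCompact (stateSpace N ∩ {x | 1 ≤ g x}) :=
    isCompact_stateSpace.inter_right (isClosed_le continuous_const hg)
  have h := (isClosed_Ici (a := (0 : Fin (K - 1) → ℝ))).add_left_of_isCompact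
    (hc.image (continuous_specialPositions (N := N) (K := K)))
  convert h using 1
  ext y
  rw [Set.mem_add]
  constructor
  · rintro ⟨x, hx, hgx, hxy⟩
    exact ⟨_, ⟨x, ⟨hx, hgx⟩, rfl⟩, y - specialPositions N K x, sub_nonneg.2 hxy, by simp⟩
  · rintro ⟨_, ⟨x, ⟨hx, hgx⟩, rfl⟩, z, hz, rfl⟩
    exact ⟨x, hx, hgx, le_add_of_nonneg_right hz⟩

end Special

section Comparison

variable {N K : ℕ} {α b : ℝ}

/-- Increasing Lipschitz functions concentrated near the maximal configuration. -/
lemma exists_bump_near_maxConfig (hα : 0 < α) (hN : 2 ≤ N) {ε : ℝ} (hε : 0 < ε) :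
    ∃ F : (Fin (N - 1) → ℝ) → ℝ, Continuous F ∧ Monotone F ∧ (∀ x, 0 ≤ F x) ∧
      (∃ M, HasModulus N (barrier N b) Finset.univ M F) ∧
      (∀ x, F x ≠ 0 → ∀ i, (N : ℝ) - x i < ε) ∧ 0 < ∫ x, F x ∂(equilibrium N α) := by
  have := isProbabilityMeasure_equilibrium (N := N) (by omega) hα
  have hN' : (2 : ℝ) ≤ N := by exact_mod_cast hN
  set S : (Fin (N - 1) → ℝ) → ℝ := fun x => ∑ i, max 0 ((N : ℝ) - x i) with hS
  set F : (Fin (N - 1) → ℝ) → ℝ := fun x => max 0 (1 - S x / ε) with hF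
  have hSc : Continuous S := continuous_finsetSum _ fun i _ => by fun_prop
  have hFc : Continuous F := by fun_prop
  have hF0 : ∀ x, 0 ≤ F x := fun x => le_max_left _ _
  refine ⟨F, hFc, ?_, hF0, ?_, ?_, ?_⟩
  · intro x x' h
    refine max_le_max le_rfl ?_
    have : S x' ≤ S x := Finset.sum_le_sum fun i _ => max_le_max le_rfl (by linarith [h i])
    gcongr
  · refine ⟨_, hasModulus_of_abs_sub_le Finset.univ (c := 1 / ε) (by positivity) barrier_le_one
      fun x x' => ?_⟩
    calc |F x - F x'| ≤ |(1 - S x / ε) - (1 - S x' / ε)| := by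
          have := abs_max_sub_max_le_abs (1 - S x / ε) (1 - S x' / ε) 0
          simpa [hF, max_comm] using this
      _ = 1 / ε * |S x' - S x| := by
          rw [show (1 - S x / ε) - (1 - S x' / ε) = 1 / ε * (S x' - S x) by ring, abs_mul,
            abs_of_pos (by positivity)]
      _ ≤ _ := by
          refine mul_le_mul_of_nonneg_left ?_ (by positivity)
          simp only [hS]
          rw [← Finset.sum_sub_distrib]
          refine (Finset.abs_sum_le_sum_abs _ _).trans (Finset.sum_le_sum fun i _ => ?_)
          have := abs_max_sub_max_le_abs ((N : ℝ) - x' i) ((N : ℝ) - x i) 0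
          rw [max_comm 0, max_comm 0]
          refine this.trans (le_of_eq ?_)
          congr 1; ring
  · intro x hx i
    by_contra! h
    apply hx
    refine max_eq_left ?_
    have h1 : ε ≤ S x := h.trans ((le_max_right 0 _).trans
      (Finset.single_le_sum (f := fun i => max 0 ((N : ℝ) - x i)) (fun i _ => le_max_left _ _)
        (Finset.mem_univ i)))
    have := (one_le_div hε).2 h1
    linarith
  · rw [integral_pos_iff_support_of_nonneg hF0 (integrable_equilibrium_of_continuous hα (by omega) hFc),
      pos_iff_ne_zero]
    set τ := min (1 / 2) (ε / (2 * N ^ 2)) with hτ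
    have hτ0 : 0 < τ := lt_min (by norm_num) (by positivity)
    have hτ1 : τ ≤ 1 / 2 := min_le_left _ _
    have hτε : τ * N ^ 2 ≤ ε / 2 := by
      have := min_le_right (1 / 2) (ε / (2 * (N : ℝ) ^ 2))
      rw [← hτ, le_div_iff₀ (by positivity)] at this
      linarith
    set x : Fin (N - 1) → ℝ := fun i => N - τ * (N - (i + 1 : ℕ)) with hx
    have hposx : ∀ k, k ≠ 0 → k ≤ N → pos N x k = N - τ * (N - k) := by
      intro k h0 hk
      rcases hk.eq_or_lt with rfl | hk
      · rw [pos_of_le le_rfl h0]; ring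
      · rw [pos_eq_coord h0 hk, hx]
        simp only [show k - 1 + 1 = k by omega]
    have hopen : IsOpen (Function.support F) := by
      have : Function.support F = {x | F x ≠ 0} := rfl
      rw [this]
      exact isOpen_ne_fun hFc continuous_const
    refine equilibrium_pos_of_mem_open hα (by omega) hopen (x := x) ?_ ?_
    · intro k hk
      rw [hposx (k + 1) (by omega) (by omega)]
      rcases Nat.eq_zero_or_pos k with rfl | h0
      · simp only [pos_zero]; push_cast
        nlinarith
      · rw [hposx k (by omega) (by omega)]
        push_cast
        nlinarith
    · have hSx : S x ≤ ε / 2 := by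
        have h1 : S x ≤ ∑ _i : Fin (N - 1), τ * (N : ℝ) := by
          refine Finset.sum_le_sum fun i _ => max_le (by positivity) ?_
          simp only [hx]
          have : (0 : ℝ) ≤ ((i + 1 : ℕ) : ℝ) := Nat.cast_nonneg _
          nlinarith
        rw [Finset.sum_const, nsmul_eq_mul, Finset.card_univ, Fintype.card_fin] at h1
        have h2 : ((N - 1 : ℕ) : ℝ) ≤ N := by exact_mod_cast Nat.sub_le N 1
        have h3 : ((N - 1 : ℕ) : ℝ) * (τ * N) ≤ N * (τ * N) := by gcongr
        linarith [show (N : ℝ) * (τ * N) = τ * N ^ 2 by ring]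
      have : 0 < 1 - S x / ε := by
        have : S x / ε ≤ 1 / 2 := by rw [div_le_iff₀ hε]; linarith
        linarith
      exact (lt_max_of_lt_right this).ne'

/-- If `g` is increasing and nearly constant on the fibres of the special positions, then it is nearly
at least `1` on the upward closure of its level set. -/
lemma le_of_mem_upperLevelSet {g : (Fin (N - 1) → ℝ) → ℝ}
    (hm : Monotone g) {ε : ℝ}
    (hosc : ∀ x ∈ stateSpace N, ∀ x' ∈ stateSpace N, (∀ i, i ∉ (specialSites N K)ᶜ → x i = x' i) →
      |g x - g x'| ≤ ε)
    {x : Fin (N - 1) → ℝ} (hx : x ∈ stateSpace N)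
    (hxB : specialPositions N K x ∈ upperLevelSet N K g) : 1 - ε ≤ g x := by
  obtain ⟨z, hz, hgz, hzx⟩ := hxB
  have h1 : g z ≤ g (z ⊔ x) := hm le_sup_left
  have h2 := hosc (z ⊔ x) (mem_stateSpace_sup hz hx) x hx (mem_specialSites_of_congr fun i hi => by
    simpa using coord_le_of_specialPositions_le hzx hi)
  rw [abs_le] at h2
  linarith

/-- Testing a probability density `g` that is increasing and nearly constant on fibres against a
function of the special positions with values in `[0,1]`. -/
lemma integral_sub_one_mul_le (hα : 0 < α) (hN : 1 ≤ N)
    {g κ : (Fin (N - 1) → ℝ) → ℝ} (hgc : Continuous g) (hm : Monotone g) {ε : ℝ} (hε : 0 ≤ ε)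
    (hosc : ∀ x ∈ stateSpace N, ∀ x' ∈ stateSpace N, (∀ i, i ∉ (specialSites N K)ᶜ → x i = x' i) →
      |g x - g x'| ≤ ε)
    (hκ : Continuous κ) (hκ0 : ∀ x, 0 ≤ κ x) (hκ1 : ∀ x, κ x ≤ 1) :
    ∫ x, (g x - 1) * κ x ∂(equilibrium N α) ≤
      ∫ x in specialPositions N K ⁻¹' upperLevelSet N K g, (g x - 1) ∂(equilibrium N α) + ε := by
  have := isProbabilityMeasure_equilibrium hN hα
  have hB : MeasurableSet (specialPositions N K ⁻¹' upperLevelSet N K g) :=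
    ((isClosed_upperLevelSet hgc).preimage continuous_specialPositions).measurableSet
  have hg1 : Integrable (fun x => g x - 1) (equilibrium N α) :=
    integrable_equilibrium_of_continuous hα hN (hgc.sub continuous_const)
  rw [← integral_indicator hB]
  have : ∫ x, ((specialPositions N K ⁻¹' upperLevelSet N K g).indicator (fun x => g x - 1) x + ε)
      ∂(equilibrium N α) = ∫ x, (specialPositions N K ⁻¹' upperLevelSet N K g).indicator
        (fun x => g x - 1) x ∂(equilibrium N α) + ε := by
    rw [integral_add (hg1.indicator hB) (integrable_const _)]; simp
  rw [← this]
  refine integral_mono_ae (integrable_equilibrium_of_continuous hα hN (by fun_prop))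
    ((hg1.indicator hB).add (integrable_const _)) ?_
  filter_upwards [equilibrium_ae_mem] with x hx
  by_cases hxB : x ∈ specialPositions N K ⁻¹' upperLevelSet N K g
  · rw [Set.indicator_of_mem hxB]
    have h1 := le_of_mem_upperLevelSet hm hosc hx hxB
    nlinarith [hκ0 x, hκ1 x]
  · rw [Set.indicator_of_notMem hxB]
    have h1 : g x < 1 := by
      by_contra! h
      exact hxB ⟨x, hx, h, le_rfl⟩
    nlinarith [hκ0 x]

/-- Comparison of the law after `n` updates from the maximal configuration with the equilibrium, for
functions of the special positions. -/
theorem iterate_maxConfig_le (hα : 0 < α) (hK : 1 ≤ K) (hKN : K < N) (hb0 : 0 < b)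
    (hb1 : b < 1) {s η : ℝ} (hs : 0 < s)
    (hshift : ∀ B : Set (Fin (K - 1) → ℝ), IsUpperSet B → MeasurableSet B →
      (equilibrium N α).real (specialPositions N K ⁻¹' Metric.thickening s B) ≤
        (equilibrium N α).real (specialPositions N K ⁻¹' B) + η)
    {k : (Fin (K - 1) → ℝ) → ℝ} (hk : Continuous k) (hk0 : ∀ y, 0 ≤ k y) (hk1 : ∀ y, k y ≤ 1)
    (n : ℕ) :
    (updateOp N α Finset.univ)^[n] (fun x => k (specialPositions N K x)) (maxConfig N) ≤
      ((N - 1 : ℕ) : ℝ) ^ n *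
        (∫ x, k (specialPositions N K x) ∂(equilibrium N α) + η) +
      N / Real.cos (b * Real.pi / 2) *
        ((((N - 1 : ℕ) : ℝ) - 1 + Real.cos (b * Real.pi / N)) ^ n * (K * (1 / s))) := by
  have hN : 2 ≤ N := by omega
  have := isProbabilityMeasure_equilibrium (N := N) (by omega) hα
  set π := equilibrium N α with hπ
  set T := updateOp N α Finset.univ with hT
  set U := (specialSites N K)ᶜ with hU
  set κ : (Fin (N - 1) → ℝ) → ℝ := fun x => k (specialPositions N K x) with hκ
  have hκc : Continuous κ := hk.comp continuous_specialPositions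
  have hUne : U.Nonempty := by
    rw [hU, ← Finset.card_pos, Finset.card_compl, Fintype.card_fin]
    have := card_specialSites_le (N := N) (K := K)
    omega
  have huniv : (Finset.univ : Finset (Fin (N - 1))).Nonempty := hUne.mono (Finset.subset_univ _)
  have hcU : (0 : ℝ) < U.card := by exact_mod_cast hUne.card_pos
  set p : ℝ := ((N - 1 : ℕ) : ℝ) ^ n with hp
  have hp1 : 1 ≤ p := one_le_pow₀ (by exact_mod_cast (by omega : 1 ≤ N - 1))
  have hcard : ((Finset.univ : Finset (Fin (N - 1))).card : ℝ) = ((N - 1 : ℕ) : ℝ) := by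
    rw [Finset.card_univ, Fintype.card_fin]
  have hpos := cos_half_pos hb0.le hb1
  have hbar : ∀ k ≤ N, 0 ≤ barrier N b k :=
    fun k hk => hpos.le.trans (le_barrier (by omega) hb0.le hb1.le hk)
  have hcos := cos_step_nonneg hN hb0.le hb1.le
  set osc := (N : ℝ) / Real.cos (b * Real.pi / 2) *
        ((((N - 1 : ℕ) : ℝ) - 1 + Real.cos (b * Real.pi / N)) ^ n * (K * (1 / s))) with hoscdef
  refine le_of_forall_pos_le_add fun ε hε => ?_
  set ε' := ε / (2 * p) with hε'
  have hε'0 : 0 < ε' := by positivity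
  have hFc : Continuous (T^[n] κ) := updateOp_iterate_continuous hα hκc n
  obtain ⟨δ, hδ, hδF⟩ := Metric.continuousAt_iff.1 (hFc.continuousAt (x := maxConfig N)) (ε / 2)
    (by positivity)
  obtain ⟨f₀, hf₀c, hf₀m, hf₀0, ⟨M, hM⟩, hf₀supp, hf₀int⟩ :=
    exists_bump_near_maxConfig (b := b) hα hN hδ
  set c₀ := ∫ x, f₀ x ∂π with hc₀
  have hInt : ∀ {F : (Fin (N - 1) → ℝ) → ℝ}, Continuous F → Integrable F π :=
    fun h => integrable_equilibrium_of_continuous hα (by omega) h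
  have hloc : (T^[n] κ (maxConfig N) - ε / 2) * c₀ ≤ ∫ x, f₀ x * T^[n] κ x ∂π := by
    rw [hc₀, ← integral_const_mul]
    refine integral_mono_ae (hInt (by fun_prop)) (hInt (by fun_prop)) ?_
    filter_upwards [equilibrium_ae_mem] with x hx
    by_cases h0 : f₀ x = 0
    · simp [h0]
    · have hd : dist x (maxConfig N) < δ := by
        refine (dist_pi_lt_iff hδ).2 fun i => ?_
        rw [Real.dist_eq, maxConfig, abs_sub_comm, abs_of_nonneg (sub_nonneg.2 (coord_mem_Icc hx i).2)]
        exact hf₀supp x h0 i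
      have := hδF hd
      rw [Real.dist_eq, abs_lt] at this
      rw [mul_comm (f₀ x)]
      exact mul_le_mul_of_nonneg_right (by linarith) (hf₀0 x)
  have hf : Continuous (T^[n] f₀) := updateOp_iterate_continuous hα hf₀c n
  have hfM : HasModulus N (barrier N b) U
      (((Finset.univ : Finset (Fin (N - 1))).card - 1 + Real.cos (b * Real.pi / N)) ^ n * M)
      (T^[n] f₀) :=
    (hM.updateOp_iterate hα hbar hcos barrier_add huniv hf₀c n).restrict hbar U
  set M' := (((Finset.univ : Finset (Fin (N - 1))).card - 1 + Real.cos (b * Real.pi / N)) ^ n * M)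
  set r := ((U.card : ℝ) - 1 + Real.cos (b * Real.pi / N)) / U.card with hr
  have hU1 : (1 : ℝ) ≤ U.card := by exact_mod_cast hUne.card_pos
  have hr0 : 0 ≤ r := div_nonneg (by linarith) hcU.le
  have hr1 : r < 1 := by
    have h1 := sq_mul_one_sub_cos_le (N := N) (by omega) hb0.le hb1.le
    have h2 := mul_pos (pow_pos hb0 2) (one_sub_cos_pos hN)
    rw [hr, div_lt_one hcU]
    linarith
  obtain ⟨m, hm⟩ : ∃ m : ℕ, N / Real.cos (b * Real.pi / 2) * M' / (p * c₀) * r ^ m ≤ ε' := by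
    have h := (tendsto_pow_atTop_nhds_zero_of_lt_one hr0 hr1).const_mul
      (N / Real.cos (b * Real.pi / 2) * M' / (p * c₀))
    rw [mul_zero] at h
    exact (h.eventually_le_const hε'0).exists
  set D := (U.card : ℝ) ^ m * p * c₀ with hD
  have hD0 : 0 < D := by positivity
  set g : (Fin (N - 1) → ℝ) → ℝ := fun x => (updateOp N α U)^[m] (T^[n] f₀) x / D with hg
  have hgc : Continuous g := (updateOp_iterate_continuous hα hf m).div_const _
  have hgm : Monotone g := fun x x' h => by
    have := updateOp_iterate_mono (U := U) hα hf (updateOp_iterate_mono hα hf₀c hf₀m n) m h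
    simp only [hg]
    gcongr
  have hgosc : ∀ x ∈ stateSpace N, ∀ x' ∈ stateSpace N, (∀ i, i ∉ U → x i = x' i) →
      |g x - g x'| ≤ ε' := by
    intro x hx x' hx' hxx'
    have h := hfM.abs_iterate_sub_le hα hN hb0.le hb1 hUne hf m hx hx' hxx'
    simp only [hg]
    rw [← sub_div, abs_div, abs_of_pos hD0, div_le_iff₀ hD0]
    refine h.trans ?_
    have : ε' * D ≥ N / Real.cos (b * Real.pi / 2) * M' / (p * c₀) * r ^ m * D := by gcongr
    refine le_trans (le_of_eq ?_) this
    rw [hr, div_pow, hD]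
    field_simp
  have htest : ∀ h : (Fin (K - 1) → ℝ) → ℝ, Continuous h →
      ∫ x, g x * h (specialPositions N K x) ∂π =
        (∫ x, f₀ x * T^[n] (fun x => h (specialPositions N K x)) x ∂π) / (p * c₀) := by
    intro h hh
    have hhc : Continuous fun x : Fin (N - 1) → ℝ => h (specialPositions N K x) :=
      hh.comp continuous_specialPositions
    have e1 : ∀ x, g x * h (specialPositions N K x) =
        h (specialPositions N K x) * (updateOp N α U)^[m] (T^[n] f₀) x / D := fun x => by
      simp only [hg]; ring
    simp_rw [e1]
    rw [integral_div, integral_mul_updateOp_iterate_comm hα (by omega) hf hhc,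
      updateOp_iterate_of_invariant hα (g := fun x => h (specialPositions N K x))
        (fun i hi u x => by simp only [specialPositions_resample hi])]
    have e2 : ∀ x, T^[n] f₀ x * ((U.card : ℝ) ^ m * h (specialPositions N K x)) =
        (U.card : ℝ) ^ m * (h (specialPositions N K x) * T^[n] f₀ x) := fun x => by ring
    simp_rw [e2]
    rw [integral_const_mul, integral_mul_updateOp_iterate_comm hα (by omega) hf₀c hhc, hD]
    field_simp
    rfl
  have hg1 : ∫ x, g x ∂π = 1 := by
    have := htest (fun _ => 1) continuous_const
    rw [updateOp_iterate_of_invariant hα (g := fun _ => (1 : ℝ)) (fun _ _ _ _ => rfl), hcard] at this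
    simp only [mul_one, integral_mul_const] at this
    rw [this, ← hp, ← hc₀]
    field_simp
  set B := upperLevelSet N K g with hB
  have hBm : MeasurableSet B := (isClosed_upperLevelSet hgc).measurableSet
  have hBm' : MeasurableSet (specialPositions N K ⁻¹' B) :=
    hBm.preimage continuous_specialPositions.measurable
  set h : (Fin (K - 1) → ℝ) → ℝ := fun y => thickenedIndicator hs B y with hh
  have hhc : Continuous h := NNReal.continuous_coe.comp (thickenedIndicator hs B).continuous
  have hh1 : ∀ y, h y ≤ 1 := fun y => by exact_mod_cast thickenedIndicator_le_one hs B y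
  have hh0 : ∀ y, 0 ≤ h y := fun y => NNReal.coe_nonneg _
  set H : (Fin (N - 1) → ℝ) → ℝ := fun x => h (specialPositions N K x) with hH
  have hHc : Continuous H := hhc.comp continuous_specialPositions
  have hHM : HasModulus N (barrier N b) Finset.univ ((specialSites N K).card * (1 / s)) H := by
    refine hasModulus_of_abs_sub_le _ (by positivity) barrier_le_one fun x x' => ?_
    have h1 := (lipschitzWith_thickenedIndicator hs B).dist_le_mul (specialPositions N K x)
      (specialPositions N K x')
    rw [NNReal.dist_eq, NNReal.coe_inv, Real.coe_toNNReal _ hs.le] at h1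
    refine h1.trans ?_
    rw [one_div]
    exact mul_le_mul_of_nonneg_left dist_specialPositions_le (by positivity)
  have hHosc : ∀ x ∈ stateSpace N, T^[n] H x ≤ p * ∫ x, H x ∂π + osc := by
    intro x hx
    have h1 : p * ∫ x, H x ∂π = ∫ y, T^[n] H y ∂π := by
      rw [integral_updateOp_iterate hα (by omega) hHc, hcard]
    have h2 : ∫ y, (T^[n] H x - osc) ∂π ≤ ∫ y, T^[n] H y ∂π := by
      refine integral_mono_ae (integrable_const _)
        (hInt (updateOp_iterate_continuous hα hHc n)) ?_
      filter_upwards [equilibrium_ae_mem] with y hy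
      have h3 := hHM.abs_iterate_sub_le hα hN hb0.le hb1 huniv hHc n hx hy (by simp)
      have h4 : (N : ℝ) / Real.cos (b * Real.pi / 2) *
          ((((Finset.univ : Finset (Fin (N - 1))).card : ℝ) - 1 + Real.cos (b * Real.pi / N)) ^ n *
            ((specialSites N K).card * (1 / s))) ≤ osc := by
        have h5 : ((specialSites N K).card : ℝ) ≤ K := by
          exact_mod_cast card_specialSites_le.trans (Nat.sub_le K 1)
        have h6 : (1 : ℝ) ≤ ((N - 1 : ℕ) : ℝ) := by exact_mod_cast (by omega : 1 ≤ N - 1)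
        have h7 : 0 ≤ ((N - 1 : ℕ) : ℝ) - 1 + Real.cos (b * Real.pi / N) := by linarith
        rw [hcard, hoscdef]
        gcongr
      have := (abs_le.1 (h3.trans h4)).2
      linarith
    rw [integral_const, probReal_univ, one_smul] at h2
    linarith
  have hHint : ∫ x, g x * H x ∂π ≤ ∫ x, H x ∂π + osc / p := by
    rw [hH, htest h hhc, div_le_iff₀ (by positivity)]
    have h1 : ∫ x, f₀ x * T^[n] H x ∂π ≤ ∫ x, f₀ x * (p * ∫ x, H x ∂π + osc) ∂π := by
      refine integral_mono_ae (hInt (hf₀c.mul (updateOp_iterate_continuous hα hHc n)))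
        (hInt (by fun_prop)) ?_
      filter_upwards [equilibrium_ae_mem] with x hx
      exact mul_le_mul_of_nonneg_left (hHosc x hx) (hf₀0 x)
    rw [integral_mul_const] at h1
    refine h1.trans (le_of_eq ?_)
    rw [← hc₀]
    field_simp
    rfl
  have hHle : ∫ x, H x ∂π ≤ π.real (specialPositions N K ⁻¹' B) + η := by
    refine le_trans ?_ (hshift B (isUpperSet_upperLevelSet g) hBm)
    have hth : MeasurableSet (specialPositions N K ⁻¹' Metric.thickening s B) :=
      Metric.isOpen_thickening.measurableSet.preimage continuous_specialPositions.measurable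
    rw [← integral_indicator_one hth]
    refine integral_mono (hInt hHc) ((integrable_const (1 : ℝ)).indicator hth) fun x => ?_
    by_cases hx : x ∈ specialPositions N K ⁻¹' Metric.thickening s B
    · rw [Set.indicator_of_mem hx]
      exact hh1 _
    · rw [Set.indicator_of_notMem hx]
      simp only [hH, hh]
      rw [thickenedIndicator_zero hs B hx]
      simp
  have hgB : ∫ x in specialPositions N K ⁻¹' B, (g x - 1) ∂π ≤
      ∫ x, g x * H x ∂π - π.real (specialPositions N K ⁻¹' B) := by
    rw [integral_sub (hInt hgc).integrableOn (integrable_const _).integrableOn]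
    have h1 : ∫ x in specialPositions N K ⁻¹' B, g x ∂π ≤ ∫ x, g x * H x ∂π := by
      rw [← integral_indicator hBm']
      refine integral_mono ((hInt hgc).indicator hBm') (hInt (by fun_prop)) fun x => ?_
      have hgx : 0 ≤ g x := div_nonneg (updateOp_iterate_nonneg
        (fun x => updateOp_iterate_nonneg hf₀0 n x) m x) hD0.le
      by_cases hx : x ∈ specialPositions N K ⁻¹' B
      · rw [Set.indicator_of_mem hx]
        simp only [hH, hh]
        rw [thickenedIndicator_one hs B hx]
        simp
      · rw [Set.indicator_of_notMem hx]
        exact mul_nonneg hgx (hh0 _)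
    rw [integral_const]
    simpa using h1
  have hκint := integral_sub_one_mul_le hα (by omega) hgc hgm hε'0.le hgosc hκc
    (fun x => hk0 _) (fun x => hk1 _)
  have hκsplit : ∫ x, (g x - 1) * κ x ∂π = ∫ x, g x * κ x ∂π - ∫ x, κ x ∂π := by
    simp_rw [sub_mul, one_mul]
    exact integral_sub (hInt (by fun_prop)) (hInt hκc)
  have hκg : (T^[n] κ (maxConfig N) - ε / 2) / p ≤ ∫ x, g x * κ x ∂π := by
    rw [hκ, htest k hk, div_le_div_iff₀ (by positivity) (by positivity)]
    calc _ = p * ((T^[n] κ (maxConfig N) - ε / 2) * c₀) := by ring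
      _ ≤ p * ∫ x, f₀ x * T^[n] κ x ∂π := by gcongr
      _ = _ := by ring
  have hfinal : (T^[n] κ (maxConfig N) - ε / 2) / p ≤
      ∫ x, κ x ∂π + ε' + η + osc / p := by linarith
  rw [div_le_iff₀ (by positivity)] at hfinal
  have e : (∫ x, κ x ∂π + ε' + η + osc / p) * p = p * (∫ x, κ x ∂π + η) + osc + ε / 2 := by
    rw [hε']; field_simp; ring
  linarith

end Comparison

section Shift

open scoped ENNReal

/-- Multiply the first `k` entries by `c`. -/
noncomputable def scaleInitial {m : ℕ} (k : ℕ) (c : ℝ) (g : Fin m → ℝ) : Fin m → ℝ :=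
  fun j => if (j : ℕ) < k then c * g j else g j

lemma measurable_scaleInitial {m : ℕ} (k : ℕ) (c : ℝ) :
    Measurable (scaleInitial (m := m) k c) := by
  refine measurable_pi_lambda _ fun j => ?_
  unfold scaleInitial
  split_ifs <;> fun_prop

/-- The density of the law of `c X` with respect to the law of `X`, for a Gamma variable `X`
of shape `α`. -/
noncomputable def scaleDensity (α c x : ℝ) : ℝ := c ^ (-α) * Real.exp ((1 - c⁻¹) * x)

lemma gammaPDF_div {α c : ℝ} (hα : 0 < α) (hc : 0 < c) (x : ℝ) :
    gammaPDF α 1 (c⁻¹ * x) =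
      ENNReal.ofReal c * (gammaPDF α 1 x * ENNReal.ofReal (scaleDensity α c x)) := by
  rcases lt_or_ge x 0 with hx | hx
  · rw [gammaPDF_of_neg hx, gammaPDF_of_neg (mul_neg_of_pos_of_neg (inv_pos.2 hc) hx)]
    simp
  · have hΓ := Real.Gamma_pos_of_pos hα
    rw [gammaPDF_of_nonneg hx, gammaPDF_of_nonneg (by positivity), ← ENNReal.ofReal_mul (by positivity),
      ← ENNReal.ofReal_mul hc.le, scaleDensity, Real.mul_rpow (by positivity) hx]
    congr 1
    have h1 : c⁻¹ ^ (α - 1) = c * c ^ (-α) := by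
      rw [Real.inv_rpow hc.le, ← Real.rpow_neg hc.le, neg_sub, sub_eq_add_neg,
        Real.rpow_add hc, Real.rpow_one]
    have h2 : Real.exp (-(1 * (c⁻¹ * x))) =
        Real.exp (-(1 * x)) * Real.exp ((1 - c⁻¹) * x) := by
      rw [← Real.exp_add]; ring_nf
    rw [h1, h2]
    ring

/-- The density of the law of `scaleInitial k c g` with respect to that of `g`, in the form of a
factor for each coordinate. -/
noncomputable def scaleFactor {m : ℕ} (k : ℕ) (α c : ℝ) (j : Fin m) (x : ℝ) : ℝ :=
  if (j : ℕ) < k then scaleDensity α c x else 1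

lemma measurable_scaleFactor {m : ℕ} (k : ℕ) (α c : ℝ) (j : Fin m) : Measurable (scaleFactor k α c j) := by
  unfold scaleFactor scaleDensity
  split_ifs <;> fun_prop

lemma scaleFactor_nonneg {m k : ℕ} {α c : ℝ} (hc : 0 < c) (j : Fin m) (x : ℝ) :
    0 ≤ scaleFactor k α c j x := by
  unfold scaleFactor scaleDensity
  split_ifs <;> positivity

lemma lintegral_comp_scaleInitial {m : ℕ} {α c : ℝ} (hα : 0 < α) (hc : 0 < c) (k : ℕ)
    {f : (Fin m → ℝ) → ℝ≥0∞} (hf : Measurable f) :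
    ∫⁻ g, f (scaleInitial k c g) ∂(gammaProd m α) =
      ∫⁻ g, f g * ENNReal.ofReal (∏ j, scaleFactor k α c j (g j)) ∂(gammaProd m α) := by
  set D : Fin m → ℝ := fun j => if (j : ℕ) < k then c else 1 with hD
  have hD0 : ∀ j, 0 < D j := fun j => by simp only [hD]; split_ifs <;> positivity
  have hdet : (Matrix.diagonal D).det = ∏ j, D j := Matrix.det_diagonal
  have hdet0 : 0 < ∏ j, D j := Finset.prod_pos fun j _ => hD0 j
  have hmap := Real.smul_map_diagonal_volume_pi (D := D) (by rw [hdet]; exact hdet0.ne')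
  rw [hdet, abs_of_pos hdet0] at hmap
  have hT : ∀ g : Fin m → ℝ, Matrix.toLin' (Matrix.diagonal D) g = scaleInitial k c g := by
    intro g
    ext j
    simp only [Matrix.toLin'_apply, Matrix.mulVec_diagonal, hD, scaleInitial]
    split_ifs <;> simp
  have hTm : Measurable (Matrix.toLin' (Matrix.diagonal D)) :=
    (LinearMap.continuous_on_pi _).measurable
  set G : (Fin m → ℝ) → ℝ≥0∞ := fun h => f h * ∏ j, gammaPDF α 1 ((D j)⁻¹ * h j) with hG
  have hGm : Measurable G := hf.mul (Finset.measurable_prod _ fun j _ =>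
    (measurable_gammaPDF α).comp ((measurable_pi_apply j).const_mul _))
  have hfT : Measurable fun g : Fin m → ℝ => f (scaleInitial k c g) :=
    hf.comp (measurable_scaleInitial k c)
  have hR : Measurable fun g : Fin m → ℝ =>
      f g * ENNReal.ofReal (∏ j, scaleFactor k α c j (g j)) :=
    hf.mul (Finset.measurable_prod _ fun j _ =>
      (measurable_scaleFactor k α c j).comp (measurable_pi_apply j)).ennreal_ofReal
  have h1 : ∫⁻ g, f (scaleInitial k c g) ∂(gammaProd m α) =
      ∫⁻ g, G (Matrix.toLin' (Matrix.diagonal D) g) := by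
    rw [gammaProd, lintegral_withDensity_eq_lintegral_mul _ (measurable_prod_gammaPDF m α) hfT]
    refine lintegral_congr fun g => ?_
    simp only [hG, hT, Pi.mul_apply]
    rw [mul_comm]
    congr 1
    refine Finset.prod_congr rfl fun j _ => ?_
    congr 1
    simp only [hD, scaleInitial]
    split_ifs
    · field_simp
    · simp
  have h2 : ∫⁻ g, f g * ENNReal.ofReal (∏ j, scaleFactor k α c j (g j)) ∂(gammaProd m α) =
      ∫⁻ h, (ENNReal.ofReal (∏ j, D j))⁻¹ * G h := by
    rw [gammaProd, lintegral_withDensity_eq_lintegral_mul _ (measurable_prod_gammaPDF m α) hR]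
    refine lintegral_congr fun g => ?_
    have h3 : ∀ j, gammaPDF α 1 ((D j)⁻¹ * g j) = ENNReal.ofReal (D j) *
        (gammaPDF α 1 (g j) * ENNReal.ofReal (scaleFactor k α c j (g j))) := by
      intro j
      simp only [hD, scaleFactor]
      split_ifs
      · exact gammaPDF_div hα hc _
      · simp
    simp only [hG, Pi.mul_apply, h3, Finset.prod_mul_distrib]
    rw [ENNReal.ofReal_prod_of_nonneg fun j _ => scaleFactor_nonneg hc j _,
      ENNReal.ofReal_prod_of_nonneg fun j _ => (hD0 j).le]
    set d := ∏ j, ENNReal.ofReal (D j) with hd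
    have hd' : d = ENNReal.ofReal (∏ j, D j) :=
      (ENNReal.ofReal_prod_of_nonneg fun j _ => (hD0 j).le).symm
    have hd0 : d⁻¹ * d = 1 := by
      rw [hd']
      exact ENNReal.inv_mul_cancel (by simpa using hdet0) ENNReal.ofReal_ne_top
    calc _ = (d⁻¹ * d) * ((∏ j, gammaPDF α 1 (g j)) *
          (f g * ∏ j, ENNReal.ofReal (scaleFactor k α c j (g j)))) := by rw [hd0, one_mul]
      _ = _ := by ring
  rw [h1, h2, lintegral_const_mul _ hGm]
  conv_rhs => rw [← hmap]
  rw [lintegral_smul_measure, lintegral_map hGm hTm, smul_eq_mul, ← mul_assoc,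
    ENNReal.inv_mul_cancel (by simpa using hdet0) ENNReal.ofReal_ne_top, one_mul]

lemma lintegral_sq_scaleFactor {m : ℕ} {α θ : ℝ} (hα : 0 < α) (h0 : 0 < θ) (h1 : θ < 1) (k : ℕ) :
    ∫⁻ g, ENNReal.ofReal ((∏ j, scaleFactor k α (1 + θ) j (g j)) ^ 2) ∂(gammaProd m α) ≤
      ENNReal.ofReal (((1 - θ ^ 2) ^ (-α)) ^ m) := by
  have hc : 0 < 1 + θ := by linarith
  have e : ∀ g : Fin m → ℝ, ENNReal.ofReal ((∏ j, scaleFactor k α (1 + θ) j (g j)) ^ 2) =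
      ∏ j : Fin m, ENNReal.ofReal (scaleFactor k α (1 + θ) j (g j) ^ 2) := fun g => by
    rw [← Finset.prod_pow, ENNReal.ofReal_prod_of_nonneg fun j _ => sq_nonneg _]
  simp_rw [e]
  rw [lintegral_prod_gammaProd (fun (j : Fin m) x => ENNReal.ofReal (scaleFactor k α (1 + θ) j x ^ 2))
    fun j => ((measurable_scaleFactor k α _ j).pow_const 2).ennreal_ofReal]
  have hle : 1 ≤ (1 - θ ^ 2) ^ (-α) :=
    Real.one_le_rpow_of_pos_of_le_one_of_nonpos (by nlinarith) (by nlinarith) (by linarith)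
  have hb : ∀ j : Fin m, ∫⁻ x, gammaPDF α 1 x * ENNReal.ofReal (scaleFactor k α (1 + θ) j x ^ 2) ≤
      ENNReal.ofReal ((1 - θ ^ 2) ^ (-α)) := by
    intro j
    by_cases hj : (j : ℕ) < k
    · have hl : 2 * (1 - (1 + θ)⁻¹) < 1 := by
        have : 1 / 2 < (1 + θ)⁻¹ := by
          rw [one_div]; exact inv_strictAnti₀ hc (by linarith)
        linarith
      have e2 : ∀ x, gammaPDF α 1 x * ENNReal.ofReal (scaleFactor k α (1 + θ) j x ^ 2) =
          ENNReal.ofReal (((1 + θ) ^ (-α)) ^ 2) *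
            (gammaPDF α 1 x * ENNReal.ofReal (Real.exp (2 * (1 - (1 + θ)⁻¹) * x))) := by
        intro x
        have e3 : scaleFactor k α (1 + θ) j x ^ 2 =
            ((1 + θ) ^ (-α)) ^ 2 * Real.exp (2 * (1 - (1 + θ)⁻¹) * x) := by
          rw [scaleFactor, if_pos hj, scaleDensity, mul_pow, ← Real.exp_nat_mul]
          congr 2
          push_cast
          ring
        rw [e3, ENNReal.ofReal_mul (by positivity)]
        ring
      have hm : Measurable fun x =>
          gammaPDF α 1 x * ENNReal.ofReal (Real.exp (2 * (1 - (1 + θ)⁻¹) * x)) :=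
        (measurable_gammaPDF α).mul (by fun_prop)
      simp_rw [e2]
      rw [lintegral_const_mul _ hm, lintegral_exp_mul_gammaPDF hα hl,
        ← ENNReal.ofReal_mul (by positivity)]
      refine le_of_eq (congrArg _ ?_)
      rw [← Real.rpow_natCast, ← Real.rpow_mul hc.le, mul_comm (-α), Real.rpow_mul hc.le,
        ← Real.mul_rpow (by positivity) (by linarith)]
      congr 1
      push_cast
      rw [Real.rpow_ofNat]
      field_simp
      ring
    · have e2 : ∀ x, scaleFactor k α (1 + θ) j x = 1 := fun x => by rw [scaleFactor, if_neg hj]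
      simp only [e2, one_pow, ENNReal.ofReal_one, mul_one]
      rw [lintegral_gammaPDF_eq_one hα one_pos]
      simpa using ENNReal.ofReal_le_ofReal hle
  refine (Finset.prod_le_prod' fun j _ => hb j).trans (le_of_eq ?_)
  rw [Finset.prod_const, Finset.card_univ, Fintype.card_fin, ENNReal.ofReal_pow (by positivity)]

/-- Multiplying the first entries by `1 + r / √m` changes the probability of an event by `O(r)`. -/
lemma gammaProd_preimage_scaleInitial_le {m : ℕ} (hm : 1 ≤ m) {α r : ℝ} (hα : 0 < α) (hr : 0 < r)
    (hr1 : 2 * r ^ 2 ≤ 1) (hr2 : 2 * α * r ^ 2 ≤ 1) (k : ℕ) {A : Set (Fin m → ℝ)}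
    (hA : MeasurableSet A) :
    (gammaProd m α).real (scaleInitial k (1 + r / √m) ⁻¹' A) ≤
      (gammaProd m α).real A + (2 * α + 1) * r := by
  have hprob := isProbabilityMeasure_gammaProd m hα
  set ν := gammaProd m α with hν
  have hm0 : (0 : ℝ) < m := by exact_mod_cast hm
  have hm1 : (1 : ℝ) ≤ m := by exact_mod_cast hm
  set θ := r / √m with hθ
  have hθ0 : 0 < θ := by positivity
  have hθsq : θ ^ 2 = r ^ 2 / m := by rw [hθ, div_pow, Real.sq_sqrt hm0.le]
  have hθle : θ ^ 2 ≤ r ^ 2 := by rw [hθsq]; exact div_le_self (by positivity) hm1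
  have hθ1 : θ < 1 := by nlinarith
  have hc : 0 < 1 + θ := by linarith
  set R : (Fin m → ℝ) → ℝ := fun g => ∏ j, scaleFactor k α (1 + θ) j (g j) with hR
  have hR0 : ∀ g, 0 ≤ R g := fun g => Finset.prod_nonneg fun j _ => scaleFactor_nonneg hc j _
  have hRm : Measurable R := Finset.measurable_prod _ fun j _ =>
    (measurable_scaleFactor k α _ j).comp (measurable_pi_apply j)
  have hAR : ∫⁻ g, A.indicator 1 g * ENNReal.ofReal (R g) ∂ν =
      ν (scaleInitial k (1 + θ) ⁻¹' A) := by
    rw [← lintegral_comp_scaleInitial hα hc k (measurable_one.indicator hA),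
      ← lintegral_indicator_one (hA.preimage (measurable_scaleInitial k _))]
    rfl
  have hR1 : ∫⁻ g, ENNReal.ofReal (R g) ∂ν = 1 := by
    have := lintegral_comp_scaleInitial (m := m) hα hc k (measurable_const (a := (1 : ℝ≥0∞)))
    simpa [← hν] using this.symm
  have hR2 : ∫⁻ g, ENNReal.ofReal (R g ^ 2) ∂ν ≤ ENNReal.ofReal (1 + 4 * α * r ^ 2) := by
    refine (lintegral_sq_scaleFactor hα hθ0 hθ1 k).trans (ENNReal.ofReal_le_ofReal ?_)
    have h1 : Real.exp (-(2 * θ ^ 2)) ≤ 1 - θ ^ 2 := by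
      have h2 : 1 - θ ^ 2 > 0 := by nlinarith
      have h3 := Real.add_one_le_exp (θ ^ 2 + θ ^ 2)
      have h4 : 1 ≤ (1 - θ ^ 2) * (1 + 2 * θ ^ 2) := by nlinarith [sq_nonneg θ]
      rw [Real.exp_neg, inv_le_comm₀ (Real.exp_pos _) h2]
      rw [two_mul, inv_le_iff_one_le_mul₀ h2]
      nlinarith
    have h2 : (1 - θ ^ 2) ^ (-α) ≤ Real.exp (2 * α * θ ^ 2) := by
      refine (Real.rpow_le_rpow_of_nonpos (Real.exp_pos _) h1 (by linarith)).trans (le_of_eq ?_)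
      rw [← Real.exp_mul]
      ring_nf
    have h3 : 0 ≤ (1 - θ ^ 2) ^ (-α) := Real.rpow_nonneg (by nlinarith) _
    calc ((1 - θ ^ 2) ^ (-α)) ^ m ≤ Real.exp (2 * α * θ ^ 2) ^ m := by gcongr
      _ = Real.exp (2 * α * r ^ 2) := by
        rw [← Real.exp_nat_mul, hθsq]
        congr 1
        field_simp
      _ ≤ 1 + 4 * α * r ^ 2 := by
        have h4 := abs_le.1 (Real.abs_exp_sub_one_sub_id_le (x := 2 * α * r ^ 2)
          (by rw [abs_of_nonneg (by positivity)]; exact hr2))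
        have h5 : 0 ≤ 2 * α * r ^ 2 := by positivity
        nlinarith [h4.2]
  have hpt : ∀ g, A.indicator 1 g * ENNReal.ofReal (R g) + ENNReal.ofReal r⁻¹ * ENNReal.ofReal (R g) ≤
      A.indicator 1 g + (ENNReal.ofReal (r⁻¹ / 2) * ENNReal.ofReal (R g ^ 2) +
        ENNReal.ofReal (r⁻¹ / 2 + r / 2)) := by
    intro g
    have h1 : r⁻¹ / 2 * (R g - 1 - r) ^ 2 ≥ 0 := by positivity
    have h2 : r⁻¹ * r = 1 := inv_mul_cancel₀ hr.ne'
    have hr' : 0 < r⁻¹ := inv_pos.2 hr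
    rw [← ENNReal.ofReal_mul hr'.le, ← ENNReal.ofReal_mul (by positivity),
      ← ENNReal.ofReal_add (by positivity) (by positivity)]
    by_cases hg : g ∈ A
    · rw [Set.indicator_of_mem hg, Pi.one_apply, one_mul, ← ENNReal.ofReal_one,
        ← ENNReal.ofReal_add (hR0 g) (mul_nonneg hr'.le (hR0 g)),
        ← ENNReal.ofReal_add zero_le_one (by positivity)]
      refine ENNReal.ofReal_le_ofReal ?_
      have : r⁻¹ / 2 * (R g - 1 - r) ^ 2 = r⁻¹ / 2 * R g ^ 2 + r⁻¹ / 2 + (r⁻¹ * r) * r / 2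
        - r⁻¹ * R g - (r⁻¹ * r) * R g + (r⁻¹ * r) := by ring
      rw [h2] at this
      linarith
    · rw [Set.indicator_of_notMem hg, zero_mul, zero_add, zero_add]
      refine ENNReal.ofReal_le_ofReal ?_
      have : 0 ≤ r⁻¹ / 2 * (R g - 1) ^ 2 := by positivity
      nlinarith
  have hRm' : Measurable fun g => ENNReal.ofReal (R g) := hRm.ennreal_ofReal
  have hRm2 : Measurable fun g => ENNReal.ofReal (R g ^ 2) := (hRm.pow_const 2).ennreal_ofReal
  have hI : Measurable fun g : Fin m → ℝ => A.indicator (1 : (Fin m → ℝ) → ℝ≥0∞) g :=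
    measurable_one.indicator hA
  have hIR : Measurable fun g => A.indicator (1 : (Fin m → ℝ) → ℝ≥0∞) g * ENNReal.ofReal (R g) :=
    hI.mul hRm'
  have hmain := lintegral_mono (μ := ν) hpt
  rw [lintegral_add_left hIR, lintegral_add_left hI, lintegral_add_right _ measurable_const,
    lintegral_const_mul _ hRm', lintegral_const_mul _ hRm2, hAR, hR1, lintegral_indicator_one hA,
    lintegral_const, measure_univ, mul_one, mul_one] at hmain
  have hmain2 : ν (scaleInitial k (1 + θ) ⁻¹' A) + ENNReal.ofReal r⁻¹ ≤
      ν A + ENNReal.ofReal (r⁻¹ / 2 * (1 + 4 * α * r ^ 2) + (r⁻¹ / 2 + r / 2)) := by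
    refine hmain.trans ?_
    rw [ENNReal.ofReal_add (p := r⁻¹ / 2 * (1 + 4 * α * r ^ 2)) (by positivity) (by positivity),
      ENNReal.ofReal_mul (by positivity)]
    gcongr
  have hfin := ENNReal.toReal_mono (by finiteness) hmain2
  rw [ENNReal.toReal_add (by finiteness) (by finiteness),
    ENNReal.toReal_add (by finiteness) (by finiteness), ENNReal.toReal_ofReal (by positivity),
    ENNReal.toReal_ofReal (by positivity)] at hfin
  have : r⁻¹ / 2 * (1 + 4 * α * r ^ 2) + (r⁻¹ / 2 + r / 2) = r⁻¹ + 2 * α * r + r / 2 := by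
    field_simp; ring
  rw [this] at hfin
  simp only [Measure.real]
  linarith

/-- Exponential Markov inequality for a sum of independent Gamma variables. -/
lemma gammaProd_exp_markov {m : ℕ} {α l : ℝ} (hα : 0 < α) (hl : l < 1) (J : Finset (Fin m)) (a : ℝ) :
    (gammaProd m α).real {g | a ≤ l * ∑ j ∈ J, g j} ≤
      Real.exp (-a) * ((1 - l) ^ (-α)) ^ J.card := by
  have hprob := isProbabilityMeasure_gammaProd m hα
  have hS : MeasurableSet {g : Fin m → ℝ | a ≤ l * ∑ j ∈ J, g j} :=
    measurableSet_le measurable_const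
      ((Finset.measurable_sum _ fun j _ => measurable_pi_apply j).const_mul l)
  have h0 : 0 ≤ (1 - l) ^ (-α) := Real.rpow_nonneg (by linarith) _
  refine ENNReal.toReal_le_of_le_ofReal (by positivity) ?_
  rw [← lintegral_indicator_one hS]
  set f : Fin m → ℝ → ℝ≥0∞ := fun j x =>
    if j ∈ J then ENNReal.ofReal (Real.exp (l * x)) else 1 with hf
  have hfm : ∀ j, Measurable (f j) := fun j => by
    simp only [hf]; split_ifs <;> fun_prop
  have hprod : ∀ g : Fin m → ℝ, ∏ j, f j (g j) = ENNReal.ofReal (Real.exp (l * ∑ j ∈ J, g j)) := by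
    intro g
    simp only [hf]
    rw [Finset.prod_ite_mem, Finset.univ_inter, Finset.mul_sum, Real.exp_sum,
      ENNReal.ofReal_prod_of_nonneg fun j _ => (Real.exp_pos _).le]
  calc _ ≤ ∫⁻ g, ENNReal.ofReal (Real.exp (-a)) * ∏ j, f j (g j) ∂(gammaProd m α) := by
        refine lintegral_mono fun g => ?_
        by_cases hg : g ∈ {g : Fin m → ℝ | a ≤ l * ∑ j ∈ J, g j}
        · rw [Set.indicator_of_mem hg, hprod, ← ENNReal.ofReal_mul (Real.exp_pos _).le,
            ← Real.exp_add, Pi.one_apply, ← ENNReal.ofReal_one]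
          have hg' : a ≤ l * ∑ j ∈ J, g j := hg
          exact ENNReal.ofReal_le_ofReal (Real.one_le_exp (by linarith))
        · rw [Set.indicator_of_notMem hg]
          exact zero_le
    _ = _ := by
        have hm : Measurable fun g : Fin m → ℝ => ∏ j, f j (g j) :=
          Finset.measurable_prod _ fun j _ => (hfm j).comp (measurable_pi_apply j)
        rw [lintegral_const_mul _ hm, lintegral_prod_gammaProd f hfm,
          ENNReal.ofReal_mul (Real.exp_pos _).le, ENNReal.ofReal_pow h0]
        congr 1
        have : ∀ j, ∫⁻ x, gammaPDF α 1 x * f j x =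
            if j ∈ J then ENNReal.ofReal ((1 - l) ^ (-α)) else 1 := by
          intro j
          simp only [hf]
          split_ifs
          · exact lintegral_exp_mul_gammaPDF hα hl
          · simpa using lintegral_gammaPDF_eq_one hα one_pos
        simp_rw [this]
        rw [Finset.prod_ite_mem, Finset.univ_inter, Finset.prod_const]

end Shift

section Shift

lemma psum_scaleInitial {m : ℕ} (g : Fin m → ℝ) (θ : ℝ) {k u : ℕ} (hu : k ≤ u) :
    psum (scaleInitial k (1 + θ) g) u = psum g u + θ * psum g k := by
  simp only [psum, scaleInitial, Finset.mul_sum, ← Finset.sum_add_distrib]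
  refine Finset.sum_congr rfl fun j _ => ?_
  by_cases h : (j : ℕ) < k
  · simp only [h, h.trans_le hu, if_true]; ring
  · simp only [h, if_false]; ring

lemma psum_eq_sum_filter {m : ℕ} (g : Fin m → ℝ) (k : ℕ) :
    psum g k = ∑ j with (j : Fin m).val < k, g j := by
  rw [psum, Finset.sum_filter]

lemma psum_mono {m : ℕ} {g : Fin m → ℝ} (hg : ∀ j, 0 ≤ g j) : Monotone (psum g) := by
  intro k u hu
  refine Finset.sum_le_sum fun j _ => ?_
  have := hg j
  split_ifs <;> first | omega | exact le_rfl

lemma psum_sub_eq_sum_filter {m : ℕ} (g : Fin m → ℝ) {k : ℕ} :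
    psum g m - psum g k = ∑ j with k ≤ (j : Fin m).val, g j := by
  rw [Finset.sum_filter, psum, psum, ← Finset.sum_sub_distrib]
  refine Finset.sum_congr rfl fun j _ => ?_
  have := j.2
  split_ifs <;> first | omega | simp

lemma card_filter_val_lt {m k : ℕ} (hk : k ≤ m) :
    (Finset.univ.filter fun j : Fin m => j.val < k).card = k := by
  simp [Fin.card_filter_val_lt, hk]

lemma card_filter_le_val {m k : ℕ} :
    (Finset.univ.filter fun j : Fin m => k ≤ j.val).card = m - k := by
  have h := Finset.card_filter_add_card_filter_not (s := Finset.univ) fun j : Fin m => j.val < k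
  simp only [not_lt, Fin.card_filter_val_lt, Finset.card_univ, Fintype.card_fin] at h
  omega

lemma pos_gammaConfig {n : ℕ} {g : Fin (n + 1) → ℝ} (hg : psum g (n + 1) ≠ 0) {k : ℕ}
    (hk : k ≤ n + 1) :
    pos (n + 1) (gammaConfig n g) k = ((n + 1 : ℕ) : ℝ) * psum g k / psum g (n + 1) := by
  rcases Nat.eq_zero_or_pos k with rfl | h0
  · simp [pos_zero, psum_zero]
  rcases hk.eq_or_lt with rfl | hk
  · rw [pos_of_le le_rfl (by omega)]
    field_simp
  · rw [pos_eq_coord (by omega) hk, gammaConfig]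
    simp only [Nat.sub_add_cancel h0]

/-- Scaling the initial gaps moves every later particle to the right. -/
lemma add_le_pos_gammaConfig_scaleInitial {n : ℕ} {g : Fin (n + 1) → ℝ} (hg : ∀ j, 0 ≤ g j)
    {a L θ : ℝ} (hL : 0 < L) (ha : 0 ≤ a) (hθ0 : 0 ≤ θ) (hθ1 : θ ≤ 1) {k u v : ℕ} (hku : k ≤ u)
    (huv : u ≤ v) (hv : v ≤ n + 1) (h1 : a ≤ psum g k) (h2 : a ≤ psum g (n + 1) - psum g v)
    (h0 : 0 < psum g (n + 1)) (h3 : psum g (n + 1) ≤ L) :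
    pos (n + 1) (gammaConfig n g) u + ((n + 1 : ℕ) : ℝ) * θ * a ^ 2 / (2 * L ^ 2) ≤
      pos (n + 1) (gammaConfig n (scaleInitial k (1 + θ) g)) u := by
  have hmono := psum_mono hg
  have hk0 : 0 ≤ psum g k := ha.trans h1
  have hkS : psum g k ≤ psum g (n + 1) := hmono (by omega)
  have hu := hmono huv
  set S := psum g (n + 1) with hS
  have hS' : 0 < S + θ * psum g k := by positivity
  have e : psum (scaleInitial k (1 + θ) g) (n + 1) = S + θ * psum g k :=
    psum_scaleInitial g θ (by omega)
  rw [pos_gammaConfig h0.ne' (by omega), pos_gammaConfig (by rw [e]; exact hS'.ne') (by omega), e,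
    psum_scaleInitial g θ hku, ← hS]
  have key : ((n + 1 : ℕ) : ℝ) * (psum g u + θ * psum g k) / (S + θ * psum g k) =
      ((n + 1 : ℕ) : ℝ) * psum g u / S +
        ((n + 1 : ℕ) : ℝ) * θ * (psum g k * (S - psum g u)) / (S * (S + θ * psum g k)) := by
    field_simp
    ring
  rw [key]
  have hd : S * (S + θ * psum g k) ≤ 2 * L ^ 2 := by
    have h4 : S + θ * psum g k ≤ 2 * L := by
      linarith [mul_le_of_le_one_left hk0 hθ1]
    calc _ ≤ L * (2 * L) := by gcongr
      _ = _ := by ring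
  have hnum : a ^ 2 ≤ psum g k * (S - psum g u) := by
    rw [sq]; exact mul_le_mul h1 (by linarith) ha hk0
  have : 0 ≤ psum g k * (S - psum g u) := (sq_nonneg a).trans hnum
  have h4 : 0 ≤ ((n + 1 : ℕ) : ℝ) * θ * (psum g k * (S - psum g u)) := by positivity
  refine add_le_add_right (div_le_div₀ h4 ?_ (by positivity) hd) _
  exact mul_le_mul_of_nonneg_left hnum (by positivity)

lemma add_le_specialPositions {n K : ℕ} (hK : 1 ≤ K) {g : Fin (n + 1) → ℝ} (hg : ∀ j, 0 ≤ g j)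
    {a L θ : ℝ} (hL : 0 < L) (ha : 0 ≤ a) (hθ0 : 0 ≤ θ) (hθ1 : θ ≤ 1)
    (h1 : a ≤ psum g ((n + 1) / K))
    (h2 : a ≤ psum g (n + 1) - psum g ((K - 1) * (n + 1) / K))
    (h0 : 0 < psum g (n + 1)) (h3 : psum g (n + 1) ≤ L) (i : Fin (K - 1)) :
    specialPositions (n + 1) K (gammaConfig n g) i +
        ((n + 1 : ℕ) : ℝ) * θ * a ^ 2 / (2 * L ^ 2) ≤
      specialPositions (n + 1) K (gammaConfig n (scaleInitial ((n + 1) / K) (1 + θ) g)) i := by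
  have hi := i.2
  refine add_le_pos_gammaConfig_scaleInitial hg hL ha hθ0 hθ1 ?_
    (v := (K - 1) * (n + 1) / K) ?_ ?_ h1 h2 h0 h3
  · exact Nat.div_le_div_right (Nat.le_mul_of_pos_left _ (by omega))
  · exact Nat.div_le_div_right (Nat.mul_le_mul_right _ (by omega))
  · exact Nat.div_le_of_le_mul (Nat.mul_le_mul_right _ (by omega))

/-- A sum of Gamma variables is at least half its mean, up to an exponentially small probability. -/
lemma gammaProd_deviation_le {m : ℕ} {α c : ℝ} (hα : 0 < α) {J : Finset (Fin m)}
    (hc : 0 ≤ c) (hJ : c ≤ J.card) :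
    (gammaProd m α).real {g | ∑ j ∈ J, g j ≤ α * c / 2} ≤ Real.exp (-(α * c / 8)) := by
  have h := gammaProd_exp_markov (l := -1) hα (by norm_num) J (-(α * c / 2))
  have e : {g : Fin m → ℝ | -(α * c / 2) ≤ -1 * ∑ j ∈ J, g j} =
      {g | ∑ j ∈ J, g j ≤ α * c / 2} := by
    ext g; constructor <;> intro hg <;> simp only [Set.mem_ofPred_eq] at * <;> linarith
  rw [e] at h
  refine h.trans ?_
  rw [← Real.rpow_natCast, ← Real.rpow_mul (by norm_num), Real.rpow_def_of_pos (by norm_num),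
    ← Real.exp_add]
  refine Real.exp_le_exp.2 ?_
  have h2 := Real.log_two_gt_d9
  have h3 : α * c * Real.log 2 ≤ α * J.card * Real.log 2 := by gcongr
  have h4 : α * c * (5 / 8) ≤ α * c * Real.log 2 := by gcongr; linarith
  norm_num
  linarith

lemma gammaProd_sum_ge_le {m : ℕ} {α : ℝ} (hα : 0 < α) :
    (gammaProd m α).real {g | 2 * α * m ≤ ∑ j, g j} ≤ Real.exp (-(α * m / 8)) := by
  have h := gammaProd_exp_markov (m := m) (l := 1 / 2) hα (by norm_num) Finset.univ (α * m)
  have e : {g : Fin m → ℝ | α * m ≤ 1 / 2 * ∑ j, g j} = {g | 2 * α * m ≤ ∑ j, g j} := by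
    ext g; constructor <;> intro hg <;> simp only [Set.mem_ofPred_eq] at * <;> linarith
  rw [e] at h
  refine h.trans ?_
  rw [Finset.card_univ, Fintype.card_fin, ← Real.rpow_natCast, ← Real.rpow_mul (by norm_num),
    Real.rpow_def_of_pos (by norm_num), ← Real.exp_add]
  refine Real.exp_le_exp.2 ?_
  have h2 : Real.log (1 - 1 / 2) = -Real.log 2 := by
    rw [← Real.log_inv]; norm_num
  have := Real.log_two_lt_d9
  rw [h2]
  have : 0 ≤ α * m := by positivity
  nlinarith

/-- Enlarging an upper set by `r √N / (128 K²)` changes the equilibrium probability by `O(r)`. -/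
lemma equilibrium_thickening_le {N K : ℕ} {α r : ℝ} (hα : 0 < α) (hK : 1 ≤ K) (hN : 2 * K ≤ N)
    (hr : 0 < r) (hr1 : 2 * r ^ 2 ≤ 1) (hr2 : 2 * α * r ^ 2 ≤ 1) {B : Set (Fin (K - 1) → ℝ)}
    (hB : IsUpperSet B) (hBm : MeasurableSet B) :
    (equilibrium N α).real
        (specialPositions N K ⁻¹' Metric.thickening (r * √N / (128 * K ^ 2)) B) ≤
      (equilibrium N α).real (specialPositions N K ⁻¹' B) +
        ((2 * α + 1) * r + 3 * Real.exp (-(α / (16 * K) * N))) := by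
  obtain ⟨n, rfl⟩ : ∃ n, N = n + 1 := ⟨N - 1, by omega⟩
  set M : ℝ := ((n + 1 : ℕ) : ℝ) with hM
  have hM1 : 1 ≤ M := by rw [hM]; exact_mod_cast (by omega : 1 ≤ n + 1)
  have hK0 : (0 : ℝ) < K := by exact_mod_cast hK
  have hprob := isProbabilityMeasure_gammaProd (n + 1) hα
  set ν := gammaProd (n + 1) α with hν
  set y : (Fin (n + 1) → ℝ) → Fin (K - 1) → ℝ :=
    fun g => specialPositions (n + 1) K (gammaConfig n g) with hy
  have hym : Measurable y := continuous_specialPositions.measurable.comp (measurable_gammaConfig n)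
  have htransfer : ∀ S, MeasurableSet S →
      (equilibrium (n + 1) α).real (specialPositions (n + 1) K ⁻¹' S) = ν.real (y ⁻¹' S) := by
    intro S hS
    rw [← map_gammaConfig n hα, map_measureReal_apply (measurable_gammaConfig n)
      (hS.preimage continuous_specialPositions.measurable)]
    rfl
  rw [htransfer _ hBm, htransfer _ Metric.isOpen_thickening.measurableSet]
  set k := (n + 1) / K with hk
  set v := (K - 1) * (n + 1) / K with hv
  set c : ℝ := M / (2 * K) with hc
  have hc0 : 0 ≤ c := by positivity
  have hkc : c ≤ k := by
    have h1 : n + 1 ≤ 2 * K * k := by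
      have := Nat.div_add_mod (n + 1) K
      have := Nat.mod_lt (n + 1) (by omega : 0 < K)
      rw [← hk] at *
      nlinarith
    rw [hc, div_le_iff₀ (by positivity)]
    have h2 : M ≤ 2 * K * k := by rw [hM]; exact_mod_cast h1
    linarith
  have hvk : k ≤ n + 1 - v := by
    have h1 : K * v ≤ (K - 1) * (n + 1) := Nat.mul_div_le _ _
    have h2 : K * k ≤ n + 1 := Nat.mul_div_le _ _
    have h3 : K * (k + v) ≤ K * (n + 1) := by
      calc K * (k + v) = K * k + K * v := by ring
        _ ≤ (n + 1) + (K - 1) * (n + 1) := by omega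
        _ = (K - 1 + 1) * (n + 1) := by ring
        _ = _ := by rw [Nat.sub_add_cancel hK]
    have := Nat.le_of_mul_le_mul_left h3 (by omega)
    omega
  set J₁ : Finset (Fin (n + 1)) := Finset.univ.filter fun j => j.val < k with hJ₁
  set J₂ : Finset (Fin (n + 1)) := Finset.univ.filter fun j => v ≤ j.val with hJ₂
  have hd1 := gammaProd_deviation_le (m := n + 1) (J := J₁) hα hc0
    (by rw [hJ₁, card_filter_val_lt (Nat.div_le_self _ _)]; exact hkc)
  have hd2 := gammaProd_deviation_le (m := n + 1) (J := J₂) hα hc0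
    (by rw [hJ₂, card_filter_le_val]; exact hkc.trans (by exact_mod_cast hvk))
  have hd3 := gammaProd_sum_ge_le (m := n + 1) hα
  set E₁ : Set (Fin (n + 1) → ℝ) := {g | ∑ j ∈ J₁, g j ≤ α * c / 2} with hE₁
  set E₂ : Set (Fin (n + 1) → ℝ) := {g | ∑ j ∈ J₂, g j ≤ α * c / 2} with hE₂
  set E₃ : Set (Fin (n + 1) → ℝ) := {g | 2 * α * ((n + 1 : ℕ) : ℝ) ≤ ∑ j, g j} with hE₃
  set θ := r / √M with hθ
  have hsM : 0 < √M := Real.sqrt_pos.2 (by linarith)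
  have hθ0 : 0 < θ := by positivity
  have hθ1 : θ ≤ 1 := by
    rw [hθ, div_le_one hsM]
    calc r ≤ 1 := by nlinarith
      _ ≤ √M := Real.one_le_sqrt.2 hM1
  have hs : M * θ * (α * c / 2) ^ 2 / (2 * (2 * α * M) ^ 2) = r * √M / (128 * K ^ 2) := by
    have : M = √M ^ 2 := (Real.sq_sqrt (by linarith)).symm
    rw [hc, hθ]
    field_simp
    rw [Real.sq_sqrt (by linarith)]
    ring
  have hsub : y ⁻¹' Metric.thickening (r * √M / (128 * K ^ 2)) B ≤ᵐ[ν]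
      (scaleInitial k (1 + θ) ⁻¹' (y ⁻¹' B) ∪ (E₁ ∪ E₂ ∪ E₃) : Set (Fin (n + 1) → ℝ)) := by
    filter_upwards [gammaProd_ae_nonneg (n + 1) α] with g hg hgB
    by_cases hE : g ∈ E₁ ∪ E₂ ∪ E₃
    · exact Or.inr hE
    left
    simp only [Set.mem_union, not_or, hE₁, hE₂, hE₃, Set.mem_ofPred_eq, not_le] at hE
    obtain ⟨⟨h1, h2⟩, h3⟩ := hE
    rw [← psum_eq_sum_filter] at h1
    rw [← psum_sub_eq_sum_filter] at h2
    have hall : ∑ j, g j = psum g (n + 1) :=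
      Finset.sum_congr rfl fun j _ => (if_pos j.2).symm
    rw [hall] at h3
    have ha : 0 ≤ α * c / 2 := by positivity
    have h0 : 0 < psum g (n + 1) := (ha.trans_lt h1).trans_le (psum_mono hg (Nat.div_le_self _ _))
    obtain ⟨z, hz, hdz⟩ := Metric.mem_thickening_iff.1 hgB
    refine hB (fun i => ?_) hz
    have h4 := add_le_specialPositions hK hg (L := 2 * α * M) (by positivity) ha hθ0.le hθ1 h1.le
      h2.le h0 h3.le i
    rw [← hM, hs] at h4
    have h5 := (dist_le_pi_dist (y g) z i).trans hdz.le
    rw [Real.dist_eq] at h5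
    have h6 := (abs_le.1 h5).1
    refine le_trans ?_ h4
    simp only [hy] at h6
    linarith
  have hmain := gammaProd_preimage_scaleInitial_le (m := n + 1) (by omega) hα hr hr1 hr2 k
    (hBm.preimage hym)
  have h1 : ν.real (y ⁻¹' Metric.thickening (r * √M / (128 * K ^ 2)) B) ≤
      ν.real (scaleInitial k (1 + θ) ⁻¹' (y ⁻¹' B)) + (ν.real E₁ + ν.real E₂ + ν.real E₃) := by
    refine (ENNReal.toReal_mono (by finiteness) (measure_mono_ae hsub)).trans ?_
    refine (measureReal_union_le _ _).trans ?_
    gcongr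
    refine (measureReal_union_le _ _).trans ?_
    gcongr
    exact measureReal_union_le _ _
  have e1 : Real.exp (-(α * c / 8)) = Real.exp (-(α / (16 * K) * M)) := by
    rw [hc]; congr 2; field_simp; norm_num
  have e2 : Real.exp (-(α * M / 8)) ≤ Real.exp (-(α / (16 * K) * M)) := by
    rw [← e1]
    refine Real.exp_le_exp.2 (neg_le_neg ?_)
    have : c ≤ M := by
      rw [hc]
      refine div_le_self (by linarith) ?_
      have : (1 : ℝ) ≤ K := by exact_mod_cast hK
      linarith
    gcongr
  rw [e1] at hd1 hd2
  linarith

end Shift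

section Conclusion

variable {E : Type*} [PseudoMetricSpace E] [MeasurableSpace E] [BorelSpace E]

/-- It suffices to compare two measures on continuous functions with values in `[0, 1]`. -/
lemma measureReal_le_of_forall_integral_le {μ ν : Measure E} [IsFiniteMeasure μ] [IsFiniteMeasure ν]
    {e : ℝ} (h : ∀ k : E → ℝ, Continuous k → (∀ y, 0 ≤ k y) → (∀ y, k y ≤ 1) →
      ∫ y, k y ∂μ ≤ ∫ y, k y ∂ν + e) {A : Set E} (hA : MeasurableSet A) :
    μ.real A ≤ ν.real A + e := by
  have hclosed : ∀ F : Set E, IsClosed F → F ⊆ A → μ.real F ≤ ν.real A + e := by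
    intro F hF hFA
    have hpos : ∀ n : ℕ, (0 : ℝ) < 1 / ((n : ℝ) + 1) := fun n => by positivity
    have hint : ∀ (κ : Measure E) (n : ℕ), ∫ y, (thickenedIndicator (hpos n) F y : ℝ) ∂κ =
        (∫⁻ y, (thickenedIndicator (hpos n) F y : ENNReal) ∂κ).toReal := by
      intro κ n
      rw [integral_eq_lintegral_of_nonneg_ae (ae_of_all _ fun y => NNReal.coe_nonneg _)
        (NNReal.continuous_coe.comp (thickenedIndicator (hpos n) F).continuous).aestronglyMeasurable]
      simp
    have hlim : ∀ κ : Measure E, IsFiniteMeasure κ →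
        Tendsto (fun n => ∫ y, (thickenedIndicator (hpos n) F y : ℝ) ∂κ) atTop (𝓝 (κ.real F)) := by
      intro κ _
      simp_rw [hint]
      exact (ENNReal.tendsto_toReal (measure_ne_top κ F)).comp
        (tendsto_lintegral_thickenedIndicator_of_isClosed κ hF hpos
          tendsto_one_div_add_atTop_nhds_zero_nat)
    have := le_of_tendsto_of_tendsto' (hlim μ inferInstance) ((hlim ν inferInstance).add_const e)
      fun n => h _ (NNReal.continuous_coe.comp (thickenedIndicator (hpos n) F).continuous)
        (fun y => NNReal.coe_nonneg _)
        fun y => by exact_mod_cast thickenedIndicator_le_one (hpos n) F y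
    refine this.trans ?_
    gcongr
    exact measure_ne_top _ _
  refine le_of_forall_pos_le_add fun ε hε => ?_
  obtain ⟨F, hFA, hF, hlt⟩ := hA.exists_isClosed_lt_add (measure_ne_top μ A)
    (ENNReal.ofReal_pos.2 hε).ne'
  have h1 := ENNReal.toReal_mono (by finiteness) hlt.le
  rw [ENNReal.toReal_add (by finiteness) (by finiteness), ENNReal.toReal_ofReal hε.le] at h1
  have h2 := hclosed F hF hFA
  simp only [Measure.real] at *
  linarith

lemma hasSum_poisson_mul_pow (a t c : ℝ) :
    HasSum (fun n : ℕ => Real.exp (-(a * t)) * t ^ n / (n.factorial : ℝ) * c ^ n)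
      (Real.exp (-((a - c) * t))) := by
  have h := (NormedSpace.expSeries_div_hasSum_exp (c * t)).mul_left (Real.exp (-(a * t)))
  rw [← Real.exp_eq_exp_ℝ, ← Real.exp_add] at h
  have e1 : -(a * t) + c * t = -((a - c) * t) := by ring
  rw [e1] at h
  refine h.congr_fun fun n => ?_
  rw [mul_pow]
  ring

variable {N : ℕ} {α t : ℝ} {μ : Measure (Fin (N - 1) → ℝ)}

lemma isProbabilityMeasure_lawAt (hα : 0 < α) (ht : 0 ≤ t) [IsProbabilityMeasure μ] :
    IsProbabilityMeasure (lawAt N α t μ) := by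
  constructor
  rw [lawAt, Measure.sum_apply _ MeasurableSet.univ]
  have hw : ∀ n : ℕ, 0 ≤ Real.exp (-(((N - 1 : ℕ) : ℝ) * t)) * t ^ n / (n.factorial : ℝ) *
      ((N - 1 : ℕ) : ℝ) ^ n := fun n => by positivity
  have e : ∀ n : ℕ, (ENNReal.ofReal (Real.exp (-(((N - 1 : ℕ) : ℝ) * t)) * t ^ n / (n.factorial : ℝ)) •
      (updateSum N α)^[n] μ) Set.univ = ENNReal.ofReal
        (Real.exp (-(((N - 1 : ℕ) : ℝ) * t)) * t ^ n / (n.factorial : ℝ) * ((N - 1 : ℕ) : ℝ) ^ n) := by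
    intro n
    rw [Measure.smul_apply, updateSum_iterate_univ hα, smul_eq_mul, ENNReal.ofReal_mul (by positivity),
      ENNReal.ofReal_pow (by positivity), ENNReal.ofReal_natCast]
  have hs := hasSum_poisson_mul_pow ((N - 1 : ℕ) : ℝ) t ((N - 1 : ℕ) : ℝ)
  simp_rw [e]
  rw [← ENNReal.ofReal_tsum_of_nonneg hw hs.summable, hs.tsum_eq]
  simp

lemma hasSum_integral_lawAt (hα : 0 < α) (ht : 0 ≤ t) [IsProbabilityMeasure μ]
    {F : (Fin (N - 1) → ℝ) → ℝ} (hF : Continuous F) {C : ℝ} (hC : ∀ x, |F x| ≤ C) :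
    HasSum (fun n : ℕ => Real.exp (-(((N - 1 : ℕ) : ℝ) * t)) * t ^ n / (n.factorial : ℝ) *
      ∫ x, (updateOp N α Finset.univ)^[n] F x ∂μ) (∫ x, F x ∂(lawAt N α t μ)) := by
  have := isProbabilityMeasure_lawAt (N := N) (μ := μ) hα ht
  have hint : Integrable F (lawAt N α t μ) :=
    Integrable.of_bound hF.aestronglyMeasurable C (ae_of_all _ hC)
  convert! hasSum_integral_measure hint using 2 with n
  rw [integral_smul_measure, integral_updateSum_iterate hα hF hC,
    ENNReal.toReal_ofReal (by positivity), smul_eq_mul]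

variable {K : ℕ} {b : ℝ}

/-- Comparison with equilibrium of the positions of the special particles. -/
lemma specialMarginal_real_sub_le (hα : 0 < α) (hK : 1 ≤ K) (hKN : K < N) (hb0 : 0 < b)
    (hb1 : b < 1) (ht : 0 ≤ t) {s η : ℝ} (hs : 0 < s)
    (hshift : ∀ B : Set (Fin (K - 1) → ℝ), IsUpperSet B → MeasurableSet B →
      (equilibrium N α).real (specialPositions N K ⁻¹' Metric.thickening s B) ≤
        (equilibrium N α).real (specialPositions N K ⁻¹' B) + η)
    {A : Set (Fin (K - 1) → ℝ)} (hA : MeasurableSet A) :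
    (specialMarginal N K (lawAt N α t (Measure.dirac (maxConfig N)))).real A -
        (specialMarginal N K (equilibrium N α)).real A ≤
      η + N / Real.cos (b * Real.pi / 2) * (K * (1 / s)) *
        Real.exp (-((1 - Real.cos (b * Real.pi / N)) * t)) := by
  have := isProbabilityMeasure_lawAt (N := N) (μ := Measure.dirac (maxConfig N)) hα ht
  have := isProbabilityMeasure_equilibrium (N := N) (by omega) hα
  have hy : Measurable (specialPositions N K) := continuous_specialPositions.measurable
  have h1 : IsProbabilityMeasure
      (specialMarginal N K (lawAt N α t (Measure.dirac (maxConfig N)))) :=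
    Measure.isProbabilityMeasure_map hy.aemeasurable
  have h2 : IsProbabilityMeasure (specialMarginal N K (equilibrium N α)) :=
    Measure.isProbabilityMeasure_map hy.aemeasurable
  rw [sub_le_iff_le_add']
  refine measureReal_le_of_forall_integral_le (fun k hk hk0 hk1 => ?_) hA
  rw [specialMarginal, specialMarginal, integral_map hy.aemeasurable hk.aestronglyMeasurable,
    integral_map hy.aemeasurable hk.aestronglyMeasurable]
  set I := ∫ x, k (specialPositions N K x) ∂(equilibrium N α) with hI
  set D := N / Real.cos (b * Real.pi / 2) * (K * (1 / s)) with hD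
  have hκc : Continuous fun x : Fin (N - 1) → ℝ => k (specialPositions N K x) :=
    hk.comp continuous_specialPositions
  have hsum := hasSum_integral_lawAt (N := N) (μ := Measure.dirac (maxConfig N)) hα ht hκc (C := 1)
    fun x => abs_le.2 ⟨by linarith [hk0 (specialPositions N K x)], hk1 _⟩
  have hup := ((hasSum_poisson_mul_pow ((N - 1 : ℕ) : ℝ) t ((N - 1 : ℕ) : ℝ)).mul_right (I + η)).add
    ((hasSum_poisson_mul_pow ((N - 1 : ℕ) : ℝ) t
      (((N - 1 : ℕ) : ℝ) - 1 + Real.cos (b * Real.pi / N))).mul_right D)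
  have hle := hasSum_le (fun n => ?_) hsum hup
  · refine hle.trans (le_of_eq ?_)
    rw [sub_self, zero_mul, neg_zero, Real.exp_zero]
    ring_nf
  · rw [integral_dirac]
    have h3 := iterate_maxConfig_le hα hK hKN hb0 hb1 hs hshift hk hk0 hk1 n
    have hw : 0 ≤ Real.exp (-(((N - 1 : ℕ) : ℝ) * t)) * t ^ n / (n.factorial : ℝ) := by positivity
    refine (mul_le_mul_of_nonneg_left h3 hw).trans (le_of_eq ?_)
    rw [hD]
    ring

/-- Decay of the comparison error at the time `t_δ`. -/
lemma exp_neg_mul_mixTime_le (hα : 0 < α) (hN : 2 ≤ N) {δ : ℝ} (hδ : 0 < δ) (hb0 : 0 ≤ b)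
    (hb1 : b ≤ 1) (hb : 1 + δ / 2 = b ^ 2 * (1 + δ)) :
    Real.exp (-((1 - Real.cos (b * Real.pi / N)) * mixTime N α δ)) ≤
      (N : ℝ) ^ (-(1 / 2 + δ / 4)) := by
  have hN0 : (0 : ℝ) < N := by exact_mod_cast (by omega : 0 < N)
  have hlog : 0 ≤ Real.log N := Real.log_nonneg (by exact_mod_cast (by omega : 1 ≤ N))
  have hgap := spectralGap_pos hα hN
  rw [Real.rpow_def_of_pos hN0]
  refine Real.exp_le_exp.2 ?_
  have h1 : b ^ 2 * spectralGap N α ≤ 1 - Real.cos (b * Real.pi / N) :=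
    (mul_le_mul_of_nonneg_left (spectralGap_le hα hN) (sq_nonneg b)).trans
      (sq_mul_one_sub_cos_le (by omega) hb0 hb1)
  have h2 : 0 ≤ mixTime N α δ := by unfold mixTime; positivity
  have h3 := mul_le_mul_of_nonneg_right h1 h2
  have h4 : b ^ 2 * spectralGap N α * mixTime N α δ = (b ^ 2 * (1 + δ)) * Real.log N / 2 := by
    unfold mixTime
    field_simp
  rw [h4, ← hb] at h3
  linarith

end Conclusion

end BetaResampling

theorem proposition6p9 (α : ℝ) (hα : 1 ≤ α) (K : ℕ) (hK : 1 ≤ K) (δ : ℝ) (hδ : 0 < δ) :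
    Tendsto (fun N : ℕ =>
        BetaResampling.tvDist
          (BetaResampling.specialMarginal N K
            (BetaResampling.lawAt N α (BetaResampling.mixTime N α δ)
              (Measure.dirac (BetaResampling.maxConfig N))))
          (BetaResampling.specialMarginal N K (BetaResampling.equilibrium N α)))
      atTop (𝓝 0) := by
  have hα0 : 0 < α := by linarith
  have hK0 : (0 : ℝ) < K := by exact_mod_cast hK
  set b : ℝ := √((1 + δ / 2) / (1 + δ)) with hb
  have hb0 : 0 < b := Real.sqrt_pos.2 (by positivity)
  have hb2 : b ^ 2 = (1 + δ / 2) / (1 + δ) := Real.sq_sqrt (by positivity)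
  have hb1 : b < 1 := by
    rw [hb, Real.sqrt_lt' one_pos, one_pow, div_lt_one (by positivity)]
    linarith
  have hbδ : 1 + δ / 2 = b ^ 2 * (1 + δ) := by rw [hb2]; field_simp
  have hcos : 0 < Real.cos (b * Real.pi / 2) := BetaResampling.cos_half_pos hb0.le hb1
  have hlimit : ∀ r : ℝ, Tendsto (fun N : ℕ => (2 * α + 1) * r +
      3 * Real.exp (-(α / (16 * K) * N)) + 128 * K ^ 3 / (r * Real.cos (b * Real.pi / 2)) *
        (N : ℝ) ^ (-(δ / 4))) atTop (𝓝 ((2 * α + 1) * r)) := by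
    intro r
    have h1 : Tendsto (fun N : ℕ => Real.exp (-(α / (16 * K) * N))) atTop (𝓝 0) :=
      Real.tendsto_exp_neg_atTop_nhds_zero.comp
        (tendsto_natCast_atTop_atTop.const_mul_atTop (by positivity))
    have h2 : Tendsto (fun N : ℕ => (N : ℝ) ^ (-(δ / 4))) atTop (𝓝 0) :=
      (tendsto_rpow_neg_atTop (by positivity)).comp tendsto_natCast_atTop_atTop
    simpa using (tendsto_const_nhds.add (h1.const_mul 3)).add
      (h2.const_mul (128 * K ^ 3 / (r * Real.cos (b * Real.pi / 2))))
  have hbound : ∀ r : ℝ, 0 < r → 2 * r ^ 2 ≤ 1 → 2 * α * r ^ 2 ≤ 1 → ∀ N : ℕ, 2 * K ≤ N →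
      ∀ A : Set (Fin (K - 1) → ℝ), MeasurableSet A →
      (BetaResampling.specialMarginal N K (BetaResampling.lawAt N α (BetaResampling.mixTime N α δ)
          (Measure.dirac (BetaResampling.maxConfig N)))).real A -
        (BetaResampling.specialMarginal N K (BetaResampling.equilibrium N α)).real A ≤
      (2 * α + 1) * r + 3 * Real.exp (-(α / (16 * K) * N)) +
        128 * K ^ 3 / (r * Real.cos (b * Real.pi / 2)) * (N : ℝ) ^ (-(δ / 4)) := by
    intro r hr hr1 hr2 N hN A hA
    have hN0 : (0 : ℝ) < N := by exact_mod_cast (by omega : 0 < N)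
    have hsN : 0 < √(N : ℝ) := Real.sqrt_pos.2 hN0
    have ht : 0 ≤ BetaResampling.mixTime N α δ := by
      have := BetaResampling.spectralGap_pos (N := N) hα0 (by omega)
      have : 0 ≤ Real.log N := Real.log_nonneg (by exact_mod_cast (by omega : 1 ≤ N))
      unfold BetaResampling.mixTime
      positivity
    refine (BetaResampling.specialMarginal_real_sub_le hα0 hK (by omega) hb0 hb1 ht
      (s := r * √N / (128 * K ^ 2)) (by positivity) (fun B hB hBm =>
        BetaResampling.equilibrium_thickening_le hα0 hK hN hr hr1 hr2 hB hBm) hA).trans ?_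
    refine add_le_add_right ?_ _
    refine (mul_le_mul_of_nonneg_left (BetaResampling.exp_neg_mul_mixTime_le (N := N) hα0
      (by omega) hδ hb0.le hb1.le hbδ) (by positivity)).trans (le_of_eq ?_)
    have h1 : (N : ℝ) ^ (-(1 / 2 + δ / 4)) = (√N)⁻¹ * (N : ℝ) ^ (-(δ / 4)) := by
      rw [neg_add, Real.rpow_add hN0, Real.sqrt_eq_rpow, Real.rpow_neg hN0.le]
    rw [h1]
    generalize (N : ℝ) ^ (-(δ / 4)) = z
    field_simp
    rw [Real.sq_sqrt hN0.le]
  refine tendsto_order.2 ⟨fun a ha => ?_, fun ε hε => ?_⟩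
  · refine Eventually.of_forall fun N => ha.trans_le ?_
    by_cases hbdd : BddAbove (Set.range fun B : {B : Set (Fin (K - 1) → ℝ) // MeasurableSet B} =>
        (BetaResampling.specialMarginal N K (BetaResampling.lawAt N α
          (BetaResampling.mixTime N α δ) (Measure.dirac (BetaResampling.maxConfig N)))).real B -
        (BetaResampling.specialMarginal N K (BetaResampling.equilibrium N α)).real B)
    · exact le_ciSup_of_le hbdd ⟨∅, MeasurableSet.empty⟩ (by simp)
    · exact (Real.sSup_of_not_bddAbove hbdd).ge
  · set r := min (1 / (2 * (α + 1))) (ε / (2 * (2 * α + 1))) with hrdef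
    have hr : 0 < r := lt_min (by positivity) (by positivity)
    have hra : r * (2 * (α + 1)) ≤ 1 := by
      rw [← le_div_iff₀ (by positivity)]
      exact min_le_left _ _
    have hrε : (2 * α + 1) * r < ε := by
      have : r * (2 * (2 * α + 1)) ≤ ε := by
        rw [← le_div_iff₀ (by positivity)]
        exact min_le_right _ _
      linarith
    have hr1 : r ≤ 1 := by nlinarith
    filter_upwards [(hlimit r).eventually_lt_const hrε, eventually_ge_atTop (2 * K)] with N hN hKN
    have : Nonempty {B : Set (Fin (K - 1) → ℝ) // MeasurableSet B} := ⟨⟨∅, MeasurableSet.empty⟩⟩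
    refine (ciSup_le fun B => ?_).trans_lt hN
    exact hbound r hr (by nlinarith) (by nlinarith) N hKN B B.2
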